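/- Let $\mathcal{U}$ be an open coordinate domain of the (body of the) infinite jet space $J^\infty(\pi)$ of a $\mathbb{Z}_2$-graded bundle $\pi$ with base coordinates $x^1,\dots,x^{n_0}$ (even), $\theta^1,\dots,\theta^{n_1}$ (odd) and fibre coordinates $u^1,\dots,u^{m_0}$ (even), $\xi^1,\dots,\xi^{m_1}$ (odd). Functions are complex-valued smooth superfunctions of finitely many of the jet coordinates. Let $\mathcal{E}=\{F^1=\dots=F^r=0\}$ be a system of $\mathbb{Z}_2$-graded partial differential equations over $\mathcal{U}$, each $F^\ell$ being even or odd, and let $\mathcal{E}^\infty$ be its infinite prolongation, that is, the sub-superspace whose ideal is locally generated by the $F^\ell$ and all their total derivatives. Let $\mathfrak{g}\subseteq\mathfrak{gl}(p|q)$ be a finite-dimensional complex matrix Lie superalgebra and $G\subseteq GL(p|q)$ its connected Lie supergroup. Write $\bar d_h=\sum_i dx^i\,\bar D_{x^i}+\sum_j d\theta^j\,\bar D_{\theta^j}$ for the horizontal differential on $\mathcal{E}^\infty$. A $\mathfrak{g}$-matrix is an element of $C^\infty(\mathcal{E}^\infty)\otimes\mathfrak{g}$, and a $\mathfrak{g}$-valued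 zero-curvature representation is a horizontal $1$-form $\alpha\in\bar\Lambda^1(\mathcal{E}^\infty)\otimes\mathfrak{g}$ with $\bar d_h\alpha=\tfrac12[\alpha,\alpha]$, where $[\cdot,\cdot]$ is the graded bracket $[\rho,\sigma]=\rho\sigma-(-1)^{rs+\mathsf{p}(\rho)\mathsf{p}(\sigma)}\sigma\rho$ for forms of degrees $r,s$ and parities $\mathsf{p}(\rho),\mathsf{p}(\sigma)$. Let $\mathcal{I}$ be either an open interval of $\mathbb{R}$ or a simply connected domain in $\mathbb{C}$. Objects on $\mathcal{E}^\infty$ depending smoothly on $\lambda\in\mathcal{I}$ are smooth objects on $\mathcal{E}^\infty\times\mathcal{I}$, holomorphic in $\lambda$ when $\mathcal{I}\subseteq\mathbb{C}$ is a complex domain. Let $\alpha_\lambda$, $\lambda\in\mathcal{I}$, be a smooth family of $\mathfrak{g}$-valued zero-curvature representations for $\mathcal{E}$. The parameter $\lambda$ is called removable if for each $\lambda_0\in\mathcal{I}$ there are $G$-matrices $S_\lambda\in C^\infty(\mathcal{E}^\infty)\otimes G$, depending smoothly on $\lambda\in\mathcal{I}$, such that $S_{\lambda_0}=1$ and $$\alpha_\lambda=\bar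 d_hS_\lambda\cdot S_\lambda^{-1}+S_\lambda\cdot\alpha_{\lambda_0}\cdot S_\lambda^{-1}\qquad\text{for all }\lambda\in\mathcal{I}.$$ Then $\lambda$ is removable if and only if for each $\lambda\in\mathcal{I}$ there is a $\mathfrak{g}$-matrix $Q_\lambda$, depending smoothly on $\lambda$, such that $\mathsf{p}(Q_\lambda)=\bar 0$ and $$\frac{\partial}{\partial\lambda}\alpha_\lambda=\bar d_hQ_\lambda-[\alpha_\lambda,Q_\lambda].$$ -/

import Mathlib

noncomputable section

namespace SuperZCR

open scoped ContDiff Topology TensorProduct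
open TopologicalSpace (Opens)

/-! ### Smooth superfunctions

`κ` labels even (real) coordinates, `o` labels odd coordinates, both possibly infinitely many, and
`W` is a normed space of parameters. A point is a pair (values of the even coordinates,
value of the parameter). -/

section Superdomain

variable {κ o W : Type} [NormedAddCommGroup W] [NormedSpace ℝ W]

/-- Forget all even coordinates except the finitely many in `T`. -/
def restr (T : Finset κ) (P : (κ → ℝ) × W) : (T → ℝ) × W := (fun c => P.1 c, P.2)

/-- On `𝒰 × 𝓘`, the function `f` is a smooth function of finitely many of the
even coordinates and of the parameter. The values outside `𝒰 × 𝓘` are irrelevant. -/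
def IsSmooth (𝒰 : Opens (κ → ℝ)) (𝓘 : Opens W) (f : (κ → ℝ) × W → ℂ) : Prop :=
  ∃ (T : Finset κ) (g : (T → ℝ) × W → ℂ), ∀ P : (κ → ℝ) × W, P.1 ∈ 𝒰 → P.2 ∈ 𝓘 →
    ContDiffAt ℝ ∞ g (restr T P) ∧ f P = g (restr T P)

theorem IsSmooth.enlarge {𝒰 : Opens (κ → ℝ)} {𝓘 : Opens W} {f : (κ → ℝ) × W → ℂ}
    {T T' : Finset κ} (hT : T ⊆ T') {g : (T → ℝ) × W → ℂ}
    (hg : ∀ P : (κ → ℝ) × W, P.1 ∈ 𝒰 → P.2 ∈ 𝓘 →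
      ContDiffAt ℝ ∞ g (restr T P) ∧ f P = g (restr T P)) :
    ∃ g' : (T' → ℝ) × W → ℂ, ∀ P : (κ → ℝ) × W, P.1 ∈ 𝒰 → P.2 ∈ 𝓘 →
      ContDiffAt ℝ ∞ g' (restr T' P) ∧ f P = g' (restr T' P) := by
  refine ⟨fun z => g (fun c => z.1 ⟨c.1, hT c.2⟩, z.2), fun P h1 h2 => ⟨?_, (hg P h1 h2).2⟩⟩
  have h : ContDiff ℝ ∞
      (fun z : (T' → ℝ) × W => ((fun c : T => z.1 ⟨c.1, hT c.2⟩, z.2) : (T → ℝ) × W)) := by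
    fun_prop
  exact ContDiffAt.comp (restr T' P) (hg P h1 h2).1 h.contDiffAt

theorem IsSmooth.binop {𝒰 : Opens (κ → ℝ)} {𝓘 : Opens W} {f f' : (κ → ℝ) × W → ℂ}
    (hf : IsSmooth 𝒰 𝓘 f) (hf' : IsSmooth 𝒰 𝓘 f') (op : ℂ × ℂ → ℂ) (hop : ContDiff ℝ ∞ op) :
    IsSmooth 𝒰 𝓘 (fun P => op (f P, f' P)) := by
  classical
  obtain ⟨T, g, hg⟩ := hf
  obtain ⟨T', g', hg'⟩ := hf'
  obtain ⟨k, hk⟩ := IsSmooth.enlarge (Finset.subset_union_left (s₂ := T')) hg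
  obtain ⟨k', hk'⟩ := IsSmooth.enlarge (Finset.subset_union_right (s₁ := T)) hg'
  refine ⟨T ∪ T', fun z => op (k z, k' z), fun P h1 h2 => ⟨?_, ?_⟩⟩
  · exact hop.contDiffAt.comp _ ((hk P h1 h2).1.prodMk (hk' P h1 h2).1)
  · simp only
    rw [← (hk P h1 h2).2, ← (hk' P h1 h2).2]

/-- The algebra of complex-valued smooth functions on `𝒰 × 𝓘` of finitely many even coordinates
and of the parameter. -/
def smoothFun (𝒰 : Opens (κ → ℝ)) (𝓘 : Opens W) : Subalgebra ℂ ((κ → ℝ) × W → ℂ) where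
  carrier := {f | IsSmooth 𝒰 𝓘 f}
  mul_mem' hf hg := hf.binop hg (fun z => z.1 * z.2) (by fun_prop)
  add_mem' hf hg := hf.binop hg (fun z => z.1 + z.2) (by fun_prop)
  algebraMap_mem' r := ⟨∅, fun _ => r, fun _ _ _ => ⟨contDiffAt_const, rfl⟩⟩

/-- The Grassmann algebra with generators labelled by `o`. -/
abbrev Grassmann (o : Type) : Type := ExteriorAlgebra ℂ (o →₀ ℂ)

/-- Superfunctions: smooth functions of the even coordinates (and of the parameter)
with values in the Grassmann algebra of the odd coordinates; each of them involves only finitely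
many coordinates. -/
def SuperFun (o : Type) (𝒰 : Opens (κ → ℝ)) (𝓘 : Opens W) : Type :=
  smoothFun 𝒰 𝓘 ⊗[ℂ] Grassmann o

instance (o : Type) (𝒰 : Opens (κ → ℝ)) (𝓘 : Opens W) : Ring (SuperFun o 𝒰 𝓘) :=
  inferInstanceAs (Ring (smoothFun 𝒰 𝓘 ⊗[ℂ] Grassmann o))

instance (o : Type) (𝒰 : Opens (κ → ℝ)) (𝓘 : Opens W) : Algebra ℂ (SuperFun o 𝒰 𝓘) :=
  inferInstanceAs (Algebra ℂ (smoothFun 𝒰 𝓘 ⊗[ℂ] Grassmann o))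

variable {𝒰 : Opens (κ → ℝ)} {𝓘 : Opens W}

theorem hasDerivAt_line {f : (κ → ℝ) × W → ℂ} {T : Finset κ} {g : (T → ℝ) × W → ℂ}
    (hg : ∀ P : (κ → ℝ) × W, P.1 ∈ 𝒰 → P.2 ∈ 𝓘 →
      ContDiffAt ℝ ∞ g (restr T P) ∧ f P = g (restr T P))
    (d P : (κ → ℝ) × W) (h1 : P.1 ∈ 𝒰) (h2 : P.2 ∈ 𝓘) :
    HasDerivAt (fun t : ℝ => f (P + t • d)) (fderiv ℝ g (restr T P) (restr T d)) 0 := by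
  have hline : HasDerivAt (fun t : ℝ => restr T P + t • restr T d) (restr T d) 0 := by
    simpa using ((hasDerivAt_id (0 : ℝ)).smul_const (restr T d)).const_add (restr T P)
  have hgd : HasFDerivAt g (fderiv ℝ g (restr T P)) (restr T P + (0 : ℝ) • restr T d) := by
    have := ((hg P h1 h2).1.differentiableAt (by simp)).hasFDerivAt
    simpa using this
  have key := hgd.comp_hasDerivAt (0 : ℝ) hline
  refine key.congr_of_eventuallyEq ?_
  have hc : Continuous (fun t : ℝ => P + t • d) := by fun_prop
  have hopen : IsOpen {x : (κ → ℝ) × W | x.1 ∈ 𝒰 ∧ x.2 ∈ 𝓘} :=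
    (𝒰.isOpen.preimage continuous_fst).inter (𝓘.isOpen.preimage continuous_snd)
  have hev : ∀ᶠ t : ℝ in 𝓝 0, P + t • d ∈ {x : (κ → ℝ) × W | x.1 ∈ 𝒰 ∧ x.2 ∈ 𝓘} :=
    hc.continuousAt.eventually_mem (hopen.mem_nhds (by simp [h1, h2]))
  filter_upwards [hev] with t ht
  rw [(hg _ ht.1 ht.2).2]
  rfl

open Classical in
/-- The directional derivative on `𝒰 × 𝓘` (put equal to `0` outside). -/
def dirDerivFun (𝒰 : Opens (κ → ℝ)) (𝓘 : Opens W) (d : (κ → ℝ) × W)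
    (f : (κ → ℝ) × W → ℂ) : (κ → ℝ) × W → ℂ :=
  fun P => if P.1 ∈ 𝒰 ∧ P.2 ∈ 𝓘 then deriv (fun t : ℝ => f (P + t • d)) 0 else 0

theorem IsSmooth.dirDerivFun {f : (κ → ℝ) × W → ℂ} (hf : IsSmooth 𝒰 𝓘 f) (d : (κ → ℝ) × W) :
    IsSmooth 𝒰 𝓘 (dirDerivFun 𝒰 𝓘 d f) := by
  obtain ⟨T, g, hg⟩ := hf
  refine ⟨T, fun z => fderiv ℝ g z (restr T d), fun P h1 h2 => ⟨?_, ?_⟩⟩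
  · exact ((hg P h1 h2).1.fderiv_right (m := ∞) (by simp)).clm_apply contDiffAt_const
  · rw [SuperZCR.dirDerivFun, if_pos ⟨h1, h2⟩]
    exact (hasDerivAt_line hg d P h1 h2).deriv

theorem IsSmooth.differentiableAt_line {f : (κ → ℝ) × W → ℂ} (hf : IsSmooth 𝒰 𝓘 f)
    (d P : (κ → ℝ) × W) (h1 : P.1 ∈ 𝒰) (h2 : P.2 ∈ 𝓘) :
    DifferentiableAt ℝ (fun t : ℝ => f (P + t • d)) 0 := by
  obtain ⟨T, g, hg⟩ := hf
  exact (hasDerivAt_line hg d P h1 h2).differentiableAt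

/-- The directional derivative as a linear operator on smooth functions. -/
def dirDeriv (d : (κ → ℝ) × W) : smoothFun 𝒰 𝓘 →ₗ[ℂ] smoothFun 𝒰 𝓘 where
  toFun f := ⟨dirDerivFun 𝒰 𝓘 d f, IsSmooth.dirDerivFun f.2 d⟩
  map_add' f g := by
    ext P
    by_cases h : P.1 ∈ 𝒰 ∧ P.2 ∈ 𝓘
    · simpa [dirDerivFun, h] using
        deriv_fun_add (IsSmooth.differentiableAt_line f.2 d P h.1 h.2)
          (IsSmooth.differentiableAt_line g.2 d P h.1 h.2)
    · simp [dirDerivFun, h]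
  map_smul' a f := by
    ext P
    by_cases h : P.1 ∈ 𝒰 ∧ P.2 ∈ 𝓘
    · simpa [dirDerivFun, h] using
        deriv_const_mul a (IsSmooth.differentiableAt_line f.2 d P h.1 h.2)
    · simp [dirDerivFun, h]

/-- The derivative of superfunctions along an even direction: it acts on the coefficients. -/
def evenDeriv (d : (κ → ℝ) × W) : SuperFun o 𝒰 𝓘 →ₗ[ℂ] SuperFun o 𝒰 𝓘 :=
  (dirDeriv d).rTensor (Grassmann o)

/-- The partial derivative with respect to an odd coordinate: the left antiderivation
`∂/∂η^v (η^{v₁} η^{v₂} ⋯) = δ_{v v₁} η^{v₂} ⋯ - δ_{v v₂} η^{v₁} ⋯ + ⋯`. -/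
def oddDeriv (v : o) : SuperFun o 𝒰 𝓘 →ₗ[ℂ] SuperFun o 𝒰 𝓘 :=
  (CliffordAlgebra.contractLeft (Finsupp.lapply v : (o →₀ ℂ) →ₗ[ℂ] ℂ)).lTensor (smoothFun 𝒰 𝓘)

/-- The even coordinate functions. -/
def evenCoord (c : κ) : SuperFun o 𝒰 𝓘 :=
  (⟨fun P => (P.1 c : ℂ), {c}, fun z => (z.1 ⟨c, Finset.mem_singleton_self c⟩ : ℂ), fun _ _ _ =>
    ⟨(Complex.ofRealCLM.contDiff.comp (by fun_prop :
      ContDiff ℝ ∞ fun z : ((({c} : Finset κ) : Type) → ℝ) × W => z.1 ⟨c, Finset.mem_singleton_self c⟩)).contDiffAt,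
      rfl⟩⟩ : smoothFun 𝒰 𝓘) ⊗ₜ[ℂ] (1 : Grassmann o)

/-- The odd coordinate functions. -/
def oddCoord (v : o) : SuperFun o 𝒰 𝓘 :=
  (1 : smoothFun 𝒰 𝓘) ⊗ₜ[ℂ] ExteriorAlgebra.ι ℂ (Finsupp.single v 1)

/-- The parity automorphism `f ↦ (-1)^{p(f)} f`. -/
def parity : SuperFun o 𝒰 𝓘 →ₐ[ℂ] SuperFun o 𝒰 𝓘 :=
  Algebra.TensorProduct.map (AlgHom.id ℂ _) CliffordAlgebra.involute

/-- Evaluation of a smooth function at a point. -/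
def evalFun (P : (κ → ℝ) × W) : smoothFun 𝒰 𝓘 →ₐ[ℂ] ℂ :=
  (Pi.evalAlgHom ℂ (fun _ : (κ → ℝ) × W => ℂ) P).comp (smoothFun 𝒰 𝓘).val

/-- The value of a superfunction at a point: an element of the Grassmann algebra. -/
def eval (P : (κ → ℝ) × W) : SuperFun o 𝒰 𝓘 →ₐ[ℂ] Grassmann o :=
  (Algebra.TensorProduct.lid ℂ (Grassmann o)).toAlgHom.comp
    (Algebra.TensorProduct.map (evalFun P) (AlgHom.id ℂ _))

/-- Freezing the parameter at `w₀ ∈ 𝓘`: the result is regarded as a function on `𝒰 × 𝓙`,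
which does not depend on the parameter from `𝓙`. -/
def freeze {W' : Type} [NormedAddCommGroup W'] [NormedSpace ℝ W'] (𝓙 : Opens W') (w₀ : 𝓘) :
    SuperFun o 𝒰 𝓘 →ₐ[ℂ] SuperFun o 𝒰 𝓙 :=
  Algebra.TensorProduct.map
    { toFun := fun f => ⟨fun P => f.1 (P.1, w₀.1), by
        obtain ⟨T, g, hg⟩ := f.2
        refine ⟨T, fun z => g (z.1, w₀.1), fun P h1 _ => ⟨?_, (hg (P.1, w₀.1) h1 w₀.2).2⟩⟩
        have h : ContDiff ℝ ∞ (fun z : (T → ℝ) × W' => ((z.1, w₀.1) : (T → ℝ) × W)) := by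
          fun_prop
        exact ContDiffAt.comp (restr T P) (hg (P.1, w₀.1) h1 w₀.2).1 h.contDiffAt⟩
      map_one' := rfl
      map_mul' := fun _ _ => rfl
      map_zero' := rfl
      map_add' := fun _ _ => rfl
      commutes' := fun _ => rfl }
    (AlgHom.id ℂ (Grassmann o))

end Superdomain

/-! ### Infinite jets

The base has `n₀` even coordinates `x^i` and `n₁` odd coordinates `θ^j`, the fibre has `m₀` even
coordinates `u^k` and `m₁` odd coordinates `ξ^a`. -/

section Jets

variable {n₀ n₁ m₀ m₁ : ℕ}

/-- A fibre coordinate of the infinite jet space: `u^k_{I,J}` (for `field = inl k`) or `ξ^a_{I,J}`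
(for `field = inr a`). The subset `J = {j₁ < ⋯ < j_s}` stands for `D_{θ^{j₁}} ⋯ D_{θ^{j_s}}`. -/
structure JetVar (n₀ n₁ m₀ m₁ : ℕ) : Type where
  field : Fin m₀ ⊕ Fin m₁
  I : Fin n₀ → ℕ
  J : Finset (Fin n₁)

/-- The parity `p(u^k_{I,J}) = |J|`, `p(ξ^a_{I,J}) = |J| + 1`. -/
def JetVar.par (v : JetVar n₀ n₁ m₀ m₁) : ZMod 2 :=
  Sum.elim (fun _ => 0) (fun _ => 1) v.field + (v.J.card : ZMod 2)

/-- The even coordinates of the infinite jet space. -/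
abbrev EvenIdx (n₀ n₁ m₀ m₁ : ℕ) : Type := Fin n₀ ⊕ {v : JetVar n₀ n₁ m₀ m₁ // v.par = 0}

/-- The odd coordinates of the infinite jet space. -/
abbrev OddIdx (n₀ n₁ m₀ m₁ : ℕ) : Type := Fin n₁ ⊕ {v : JetVar n₀ n₁ m₀ m₁ // v.par ≠ 0}

variable {W : Type} [NormedAddCommGroup W] [NormedSpace ℝ W]

/-- Superfunctions on the part of the jet space over `𝒰`, depending on a parameter from `𝓘`. -/
abbrev JetFun (𝒰 : Opens (EvenIdx n₀ n₁ m₀ m₁ → ℝ)) (𝓘 : Opens W) : Type :=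
  SuperFun (OddIdx n₀ n₁ m₀ m₁) 𝒰 𝓘

variable {𝒰 : Opens (EvenIdx n₀ n₁ m₀ m₁ → ℝ)} {𝓘 : Opens W}

/-- The coordinate function `u^k_{I,J}` or `ξ^a_{I,J}`. -/
def jetCoord (v : JetVar n₀ n₁ m₀ m₁) : JetFun 𝒰 𝓘 :=
  if h : v.par = 0 then evenCoord (.inr ⟨v, h⟩) else oddCoord (.inr ⟨v, h⟩)

open Classical in
/-- The partial derivative `∂/∂u^k_{I,J}` or `∂/∂ξ^a_{I,J}`. -/
def jetDeriv (v : JetVar n₀ n₁ m₀ m₁) : JetFun 𝒰 𝓘 →ₗ[ℂ] JetFun 𝒰 𝓘 :=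
  if h : v.par = 0 then evenDeriv (Pi.single (.inr ⟨v, h⟩) 1, 0) else oddDeriv (.inr ⟨v, h⟩)

/-- `D_{x^i}` of a fibre coordinate. -/
def shiftX (i : Fin n₀) (v : JetVar n₀ n₁ m₀ m₁) : JetFun 𝒰 𝓘 :=
  jetCoord ⟨v.field, v.I + Pi.single i 1, v.J⟩

/-- `D_{θ^j}` of a fibre coordinate. As the `D_{θ^j}` anticommute, it is
`± u_{I, J ∪ {j}}` if `j ∉ J`, and `0` if `j ∈ J`. -/
def shiftθ (j : Fin n₁) (v : JetVar n₀ n₁ m₀ m₁) : JetFun 𝒰 𝓘 :=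
  if j ∈ v.J then 0
  else ((-1 : ℂ) ^ (v.J.filter (· < j)).card) • jetCoord ⟨v.field, v.I, insert j v.J⟩

open Classical in
/-- The total derivatives `D_{x^i}` (for `inl i`) and `D_{θ^j}` (for `inr j`). The sum over
the fibre coordinates has finitely many non-zero terms on each superfunction. -/
def totalD (c : Fin n₀ ⊕ Fin n₁) (f : JetFun 𝒰 𝓘) : JetFun 𝒰 𝓘 :=
  match c with
  | .inl i => evenDeriv (Pi.single (.inl i) 1, 0) f + ∑ᶠ v, shiftX i v * jetDeriv v f
  | .inr j => oddDeriv (.inl j) f + ∑ᶠ v, shiftθ j v * jetDeriv v f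

/-- A system `F¹ = ⋯ = Fʳ = 0` of `ℤ₂`-graded partial differential equations: the left-hand sides
are superfunctions on the jet space, each of them either even or odd. -/
structure SuperPDE (𝒰 : Opens (EvenIdx n₀ n₁ m₀ m₁ → ℝ)) (r : ℕ) where
  F : Fin r → JetFun 𝒰 (⊤ : Opens PUnit)
  homogeneous : ∀ l, parity (F l) = F l ∨ parity (F l) = - F l

variable {r : ℕ}

/-- The equations of the system and all their differential consequences. -/
inductive SuperPDE.Consequence (E : SuperPDE 𝒰 r) : JetFun 𝒰 (⊤ : Opens PUnit) → Prop
  | eqn (l : Fin r) : E.Consequence (E.F l)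
  | diff (c : Fin n₀ ⊕ Fin n₁) (f : JetFun 𝒰 (⊤ : Opens PUnit)) :
      E.Consequence f → E.Consequence (totalD c f)

/-- The ideal generated by the system and its differential consequences in the algebra of
superfunctions depending on a parameter. -/
def SuperPDE.ideal (E : SuperPDE 𝒰 r) (𝓘 : Opens W) : Ideal (JetFun 𝒰 𝓘) :=
  Ideal.span (freeze 𝓘 ⟨PUnit.unit, TopologicalSpace.Opens.mem_top _⟩ '' {f | E.Consequence f})

/-- The superfunction `f` vanishes on `ℰ^∞ × 𝓘` near the point `P`: close to `P` it coincides
with an element of the ideal generated by the system and its differential consequences. -/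
def SuperPDE.VanishesNear (E : SuperPDE 𝒰 r) (f : JetFun 𝒰 𝓘)
    (P : (EvenIdx n₀ n₁ m₀ m₁ → ℝ) × W) : Prop :=
  ∃ g ∈ E.ideal 𝓘, ∀ᶠ P' in 𝓝 P, eval P' f = eval P' g

/-- The superfunctions `f` and `g` have the same restriction to `ℰ^∞ × 𝓘`. -/
def SuperPDE.EqOn (E : SuperPDE 𝒰 r) (f g : JetFun 𝒰 𝓘) : Prop :=
  ∀ P : (EvenIdx n₀ n₁ m₀ m₁ → ℝ) × W, P.1 ∈ 𝒰 → P.2 ∈ 𝓘 → E.VanishesNear (f - g) P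

end Jets

/-! ### Matrix Lie superalgebras -/

section Matrices

variable {p q : ℕ}

/-- `(-1)^{|i|}` for the index `i` of a basis vector of `ℂ^{p|q}`. -/
def idxSign (i : Fin p ⊕ Fin q) : ℂ := Sum.elim (fun _ => 1) (fun _ => -1) i

/-- The parity automorphism `X ↦ (-1)^{p(X)} X` of `gl(p|q)`. -/
def constParity (X : Matrix (Fin p ⊕ Fin q) (Fin p ⊕ Fin q) ℂ) :
    Matrix (Fin p ⊕ Fin q) (Fin p ⊕ Fin q) ℂ :=
  Matrix.of fun i j => idxSign i * idxSign j * X i j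

/-- The bracket of `gl(p|q)`, `[X, Y] = X Y - (-1)^{p(X) p(Y)} Y X` on homogeneous elements: here
`(Y + constParity Y) / 2` and `(Y - constParity Y) / 2` are the even and the odd part of `Y`. -/
def constBracket (X Y : Matrix (Fin p ⊕ Fin q) (Fin p ⊕ Fin q) ℂ) :
    Matrix (Fin p ⊕ Fin q) (Fin p ⊕ Fin q) ℂ :=
  X * Y - ((2⁻¹ : ℂ) • (Y + constParity Y) * X + (2⁻¹ : ℂ) • (Y - constParity Y) * constParity X)

/-- A (finite-dimensional, complex) matrix Lie superalgebra `𝔤 ⊆ gl(p|q)`: a `ℤ₂`-graded subspace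
closed under the bracket. -/
structure MatrixLieSuperalgebra (p q : ℕ) where
  carrier : Submodule ℂ (Matrix (Fin p ⊕ Fin q) (Fin p ⊕ Fin q) ℂ)
  graded : ∀ X ∈ carrier, constParity X ∈ carrier
  bracket_mem : ∀ X ∈ carrier, ∀ Y ∈ carrier, constBracket X Y ∈ carrier

end Matrices

/-! ### `𝔤`-matrices, horizontal forms and zero-curvature representations

The algebra `gl(p|q) ⊗ C^∞` with the multiplication `(A ⊗ μ)(B ⊗ ν) = (-1)^{p(B) p(μ)} AB ⊗ μν` is
the algebra of matrices over `C^∞` with the ordinary multiplication, when `A ⊗ μ` is identified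
with the matrix whose entries are `A i j * (-1)^{|j| p(μ)} μ`. -/

section ZCR

variable {n₀ n₁ m₀ m₁ p q r : ℕ} {W : Type} [NormedAddCommGroup W] [NormedSpace ℝ W]
variable {𝒰 : Opens (EvenIdx n₀ n₁ m₀ m₁ → ℝ)} {𝓘 : Opens W}

/-- Matrices of format `p|q` whose entries are superfunctions. -/
abbrev SMat (p q : ℕ) (𝒰 : Opens (EvenIdx n₀ n₁ m₀ m₁ → ℝ)) (𝓘 : Opens W) : Type :=
  Matrix (Fin p ⊕ Fin q) (Fin p ⊕ Fin q) (JetFun 𝒰 𝓘)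

/-- The matrix `A ⊗ μ`. -/
def tens (A : Matrix (Fin p ⊕ Fin q) (Fin p ⊕ Fin q) ℂ) (μ : JetFun 𝒰 𝓘) : SMat p q 𝒰 𝓘 :=
  Matrix.of fun i j => A i j • Sum.elim (fun _ => μ) (fun _ => parity μ) j

/-- The `𝔤`-matrices: the elements of `𝔤 ⊗ C^∞`. -/
def gMat (g : MatrixLieSuperalgebra p q) (𝒰 : Opens (EvenIdx n₀ n₁ m₀ m₁ → ℝ)) (𝓘 : Opens W) :
    Submodule ℂ (SMat p q 𝒰 𝓘) :=
  Submodule.span ℂ {M | ∃ A ∈ g.carrier, ∃ μ : JetFun 𝒰 𝓘, M = tens A μ}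

/-- The parity automorphism `M ↦ (-1)^{p(M)} M`, where `p(A ⊗ μ) = p(A) + p(μ)`. -/
def matParity (M : SMat p q 𝒰 𝓘) : SMat p q 𝒰 𝓘 :=
  Matrix.of fun i j => (idxSign i * idxSign j) • parity (M i j)

/-- The total derivative `A ⊗ μ ↦ (-1)^{p(A) p(D_c)} A ⊗ D_c μ` of a matrix. -/
def matD (c : Fin n₀ ⊕ Fin n₁) (M : SMat p q 𝒰 𝓘) : SMat p q 𝒰 𝓘 :=
  Matrix.of fun i j => Sum.elim (fun _ => (1 : ℂ)) (fun _ => idxSign i) c • totalD c (M i j)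

/-- Matrix-valued horizontal 1-forms. The family `α` of matrices stands for
`∑_c dz^c α_c`, where `dz^c` is `dx^i` for `c = inl i` and `dθ^j` for `c = inr j`. -/
abbrev OneForm (p q : ℕ) (𝒰 : Opens (EvenIdx n₀ n₁ m₀ m₁ → ℝ)) (𝓘 : Opens W) : Type :=
  Fin n₀ ⊕ Fin n₁ → SMat p q 𝒰 𝓘

/-- Matrix-valued horizontal 2-forms. The family `φ` of matrices stands for
`∑_{b,c} dz^b ∧ dz^c φ_{bc}`; only its graded antisymmetric part matters. -/
abbrev TwoForm (p q : ℕ) (𝒰 : Opens (EvenIdx n₀ n₁ m₀ m₁ → ℝ)) (𝓘 : Opens W) : Type :=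
  Fin n₀ ⊕ Fin n₁ → Fin n₀ ⊕ Fin n₁ → SMat p q 𝒰 𝓘

/-- `(-1)^{p(dz^b) p(dz^c)}`. -/
def coordSign (b c : Fin n₀ ⊕ Fin n₁) : ℂ :=
  Sum.elim (fun _ => 1) (fun _ => Sum.elim (fun _ => 1) (fun _ => -1) c) b

/-- `M ↦ (-1)^{p(dz^c) p(M)} M`: the result of moving `M` through `dz^c`,
that is, `M dz^c = dz^c (passThrough c M)`. -/
def passThrough (c : Fin n₀ ⊕ Fin n₁) (M : SMat p q 𝒰 𝓘) : SMat p q 𝒰 𝓘 :=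
  Sum.elim (fun _ => M) (fun _ => matParity M) c

/-- The even part of a matrix. -/
def evenPart (M : SMat p q 𝒰 𝓘) : SMat p q 𝒰 𝓘 := (2⁻¹ : ℂ) • (M + matParity M)

/-- The odd part of a matrix. -/
def oddPart (M : SMat p q 𝒰 𝓘) : SMat p q 𝒰 𝓘 := (2⁻¹ : ℂ) • (M - matParity M)

/-- The parity automorphism of 1-forms; `p(dx^i) = 0` and `p(dθ^j) = 1`. -/
def formParity (α : OneForm p q 𝒰 𝓘) : OneForm p q 𝒰 𝓘 :=
  fun c => Sum.elim (fun _ => matParity (α c)) (fun _ => - matParity (α c)) c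

/-- The even part of a 1-form. -/
def formEvenPart (α : OneForm p q 𝒰 𝓘) : OneForm p q 𝒰 𝓘 := (2⁻¹ : ℂ) • (α + formParity α)

/-- The odd part of a 1-form. -/
def formOddPart (α : OneForm p q 𝒰 𝓘) : OneForm p q 𝒰 𝓘 := (2⁻¹ : ℂ) • (α - formParity α)

/-- The product of a matrix and a 1-form. -/
def lmulForm (M : SMat p q 𝒰 𝓘) (α : OneForm p q 𝒰 𝓘) : OneForm p q 𝒰 𝓘 :=
  fun c => passThrough c M * α c

/-- The product of a 1-form and a matrix. -/
def rmulForm (α : OneForm p q 𝒰 𝓘) (M : SMat p q 𝒰 𝓘) : OneForm p q 𝒰 𝓘 :=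
  fun c => α c * M

/-- The product of 1-forms. -/
def wedge (α β : OneForm p q 𝒰 𝓘) : TwoForm p q 𝒰 𝓘 :=
  fun b c => passThrough c (α b) * β c

/-- The bracket `α M - (-1)^{p(α) p(M)} M α` of a 1-form `α` and a matrix `M`. -/
def bracketFormMat (α : OneForm p q 𝒰 𝓘) (M : SMat p q 𝒰 𝓘) : OneForm p q 𝒰 𝓘 :=
  rmulForm α M - (lmulForm (evenPart M) α + lmulForm (oddPart M) (formParity α))

/-- The bracket `α β + (-1)^{p(α) p(β)} β α` of 1-forms. -/
def bracketForms (α β : OneForm p q 𝒰 𝓘) : TwoForm p q 𝒰 𝓘 :=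
  wedge α β + (wedge (formEvenPart β) α + wedge (formOddPart β) (formParity α))

/-- The horizontal differential of a matrix: `d_h M = ∑_c dz^c D_c M`. -/
def dhMat (M : SMat p q 𝒰 𝓘) : OneForm p q 𝒰 𝓘 := fun c => matD c M

/-- The horizontal differential of a 1-form: `d_h α = ∑_{b,c} dz^b ∧ D_b (dz^c α_c)`, and
`D_b` is moved through `dz^c`. -/
def dhForm (α : OneForm p q 𝒰 𝓘) : TwoForm p q 𝒰 𝓘 :=
  fun b c => coordSign b c • matD b (α c)

/-- The components of a 2-form: `dz^b ∧ dz^c = -(-1)^{p(dz^b) p(dz^c)} dz^c ∧ dz^b`. -/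
def twoFormComp (φ : TwoForm p q 𝒰 𝓘) (b c : Fin n₀ ⊕ Fin n₁) : SMat p q 𝒰 𝓘 :=
  φ b c - coordSign b c • φ c b

/-- Equality of matrices on `ℰ^∞ × 𝓘`. -/
def SuperPDE.MatEq (E : SuperPDE 𝒰 r) (M N : SMat p q 𝒰 𝓘) : Prop :=
  ∀ i j, E.EqOn (M i j) (N i j)

/-- Equality of 1-forms on `ℰ^∞ × 𝓘`. -/
def SuperPDE.FormEq (E : SuperPDE 𝒰 r) (α β : OneForm p q 𝒰 𝓘) : Prop :=
  ∀ c, E.MatEq (α c) (β c)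

/-- The 1-form `α` takes values in `𝔤`. -/
def IsGForm (g : MatrixLieSuperalgebra p q) (α : OneForm p q 𝒰 𝓘) : Prop :=
  ∀ c, α c ∈ gMat g 𝒰 𝓘

/-- A `𝔤`-valued horizontal 1-form is a zero-curvature representation: `d_h α = ½ [α, α]` on
`ℰ^∞`. -/
def SuperPDE.IsZCR (E : SuperPDE 𝒰 r) (g : MatrixLieSuperalgebra p q)
    (α : OneForm p q 𝒰 𝓘) : Prop :=
  IsGForm g α ∧ ∀ b c, E.MatEq (twoFormComp (dhForm α) b c)
    (twoFormComp ((2⁻¹ : ℂ) • bracketForms α α) b c)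

/-- The sum `∑_{k < n} N^k / k!`, that is, `exp N` if `N^n = 0`. -/
def nilExp (n : ℕ) (N : SMat p q 𝒰 𝓘) : SMat p q 𝒰 𝓘 :=
  ∑ k ∈ Finset.range n, ((k.factorial : ℂ)⁻¹) • N ^ k

/-- The matrix `M` is, near the point `P`, the exponential of an even `𝔤`-matrix which either is
nilpotent or has entries that do not involve the odd coordinates. -/
def IsExpNear (g : MatrixLieSuperalgebra p q) (P : (EvenIdx n₀ n₁ m₀ m₁ → ℝ) × W)
    (M : SMat p q 𝒰 𝓘) : Prop :=
  (∃ N ∈ gMat g 𝒰 𝓘, matParity N = N ∧ ∃ n, N ^ n = 0 ∧ M = nilExp n N) ∨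
  (∃ X : Matrix (Fin p ⊕ Fin q) (Fin p ⊕ Fin q) (smoothFun 𝒰 𝓘), ∀ᶠ P' in 𝓝 P,
    X.map (evalFun P') ∈ g.carrier ∧
    constParity (X.map (evalFun P')) = X.map (evalFun P') ∧
    M.map (eval P') = (NormedSpace.exp (X.map (evalFun P'))).map (algebraMap ℂ (Grassmann _)))

/-- `S` is a smooth map from `ℰ^∞ × 𝓘` to the (connected) Lie supergroup `G ⊆ GL(p|q)` of `𝔤`,
with inverse `T`. Both are even matrices, and `S` is locally, on `ℰ^∞ × 𝓘`, a finite product of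
exponentials of even `𝔤`-matrices: products of exponentials without odd coordinates are
the smooth maps to the even part `G₀` of `G`, which is generated by `exp 𝔤₀` and has
exponential charts, and each point of `G` over a superalgebra is the product of a point of `G₀`
and the exponential of a nilpotent even element. -/
def SuperPDE.IsGMatrix (E : SuperPDE 𝒰 r) (g : MatrixLieSuperalgebra p q)
    (S T : SMat p q 𝒰 𝓘) : Prop :=
  matParity S = S ∧ matParity T = T ∧ E.MatEq (S * T) 1 ∧ E.MatEq (T * S) 1 ∧
  ∀ P : (EvenIdx n₀ n₁ m₀ m₁ → ℝ) × W, P.1 ∈ 𝒰 → P.2 ∈ 𝓘 →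
    ∃ L : List (SMat p q 𝒰 𝓘), (∀ M ∈ L, IsExpNear g P M) ∧
      ∀ i j, E.VanishesNear ((S - L.prod) i j) P

/-- The gauge transform `α^S = d_h S · S⁻¹ + S α S⁻¹`, where `T = S⁻¹`. -/
def gauge (S T : SMat p q 𝒰 𝓘) (α : OneForm p q 𝒰 𝓘) : OneForm p q 𝒰 𝓘 :=
  rmulForm (dhMat S) T + rmulForm (lmulForm S α) T

/-- The member of a family of matrices for the value `w₀` of the parameter. -/
def freezeMat {W' : Type} [NormedAddCommGroup W'] [NormedSpace ℝ W'] (𝓙 : Opens W') (w₀ : 𝓘)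
    (M : SMat p q 𝒰 𝓘) : SMat p q 𝒰 𝓙 :=
  M.map (freeze 𝓙 w₀)

/-- The member of a family of 1-forms for the value `w₀` of the parameter. -/
def freezeForm {W' : Type} [NormedAddCommGroup W'] [NormedSpace ℝ W'] (𝓙 : Opens W') (w₀ : 𝓘)
    (α : OneForm p q 𝒰 𝓘) : OneForm p q 𝒰 𝓙 :=
  fun c => freezeMat 𝓙 w₀ (α c)

end ZCR

/-! ### Families depending on a real or complex parameter -/

section Families

variable {n₀ n₁ m₀ m₁ p q r : ℕ} {𝕜 : Type} [RCLike 𝕜]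
variable {𝒰 : Opens (EvenIdx n₀ n₁ m₀ m₁ → ℝ)} {𝓘 : Opens 𝕜}

/-- The derivative `∂/∂λ` of a family of matrices. -/
def paramDeriv (M : SMat p q 𝒰 𝓘) : SMat p q 𝒰 𝓘 := M.map (evenDeriv (0, (1 : 𝕜)))

/-- The family of matrices, smooth by definition, depends on the parameter in a `𝕜`-differentiable
way: the derivative in the direction `a ∈ 𝕜` is `a ∂/∂λ`. This is automatic for a real
parameter, and it says that the dependence is holomorphic for a complex one. -/
def IsFamily (M : SMat p q 𝒰 𝓘) : Prop :=
  ∀ (a : 𝕜) (P : (EvenIdx n₀ n₁ m₀ m₁ → ℝ) × 𝕜), P.1 ∈ 𝒰 → P.2 ∈ 𝓘 → ∀ i j,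
    eval P (evenDeriv (0, a) (M i j)) = RCLike.map 𝕜 ℂ a • eval P (paramDeriv M i j)

/-- The parameter of the family `α` is removable: for each value `w₀` there is
a family `S` of gauge transformations that is the identity at `w₀` and transforms the member of
the family at `w₀` to the member at `λ`, for all `λ`. -/
def SuperPDE.IsRemovable (E : SuperPDE 𝒰 r) (g : MatrixLieSuperalgebra p q)
    (α : OneForm p q 𝒰 𝓘) : Prop :=
  ∀ w₀ : 𝓘, ∃ S T : SMat p q 𝒰 𝓘, IsFamily S ∧ IsFamily T ∧ E.IsGMatrix g S T ∧
    E.MatEq (freezeMat (⊤ : Opens PUnit) w₀ S) 1 ∧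
    E.FormEq α (gauge S T (freezeForm 𝓘 w₀ α))

end Families

end SuperZCR

end

/-! If the family is obtained by gauge transformations `S` with inverse `T`, set `Q = ∂S · T`, where
`∂` is the derivative in the parameter. Differentiating `α = D S · T + S α₀ T`, with `α₀`
independent of the parameter, gives `∂α = D Q - [α, Q]` (`gauge_deriv_identity`). The substance of
this direction is that `Q` is `𝔤`-valued. Near each point `S` agrees on `ℰ^∞` with a product of
exponentials of even `𝔤`-matrices, and the logarithmic derivative of such a product lies in `𝔤` by
the formula for the differential of `exp` (`exists_represents_prod`). A parity-preserving projection
onto `𝔤` then produces a global `𝔤`-matrix with the same restriction to `ℰ^∞`.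

Conversely, given `Q`, solve `∂S = Q S` with `S = 1` at `w₀`. The matrix `Q` involves finitely many
coordinates, so this is a linear equation in a finite-dimensional algebra (`Model`) with finitely
many real variables and the parameter. Locally, the equation along segments in the parameter is a
Volterra equation, and smooth dependence comes from smoothness of inversion in a Banach algebra
(`fderiv_localSol`). Quotients of local solutions are locally constant, so for each fixed jet point
the solutions form a covering of `𝓘`. It has a section because `𝓘` is simply connected, and joint
smoothness propagates from the initial slice (`exists_global_solution`).

The solution takes values in `G`. In a chart `exp (p₀ Y) exp (p₁ Y) (1 + π Y)`, with `ker π` the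
even `𝔤`-matrices, the coordinate `π Y` satisfies a homogeneous linear differential inequality and
vanishes by Gronwall (`chart_coord_eq_zero`). The projections `p₀` and `p₁` pick the body and the
nilpotent soul, which are the two kinds of exponentials admitted in `IsExpNear`. Connectedness of
`𝓘` spreads this to all parameters (`expProduct_of_solution`).

Finally `T α S - T · D S - α₀` is zero at `w₀` and its parameter derivative vanishes on `ℰ^∞`. To
conclude that it vanishes on `ℰ^∞`, integrate in the parameter: the ideal of `ℰ^∞` has generators
free of the parameter, so only their coefficients are integrated and membership is preserved
(`mem_vanishing_of_deriv`). -/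

noncomputable section

set_option linter.unusedSectionVars false

namespace SuperZCR

open scoped ContDiff Topology TensorProduct unitInterval
open TopologicalSpace (Opens)

/-! ### Calculus in the space of paths: parameters, primitives, cutoffs -/

section Curry

variable {P F : Type} [NormedAddCommGroup P] [NormedSpace ℝ P]
  [NormedAddCommGroup F] [NormedSpace ℝ F]

/-- The path of values over the unit interval of a function with a real argument. -/
def curryI (f : P × ℝ → F) (hf : Continuous f) (p : P) : C(I, F) :=
  ⟨fun s => f (p, s), by fun_prop⟩

theorem continuous_curryI {f : P × ℝ → F} (hf : Continuous f) : Continuous (curryI f hf) := by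
  refine ContinuousMap.continuous_of_continuous_uncurry _ ?_
  change Continuous fun z : P × I => f (z.1, z.2)
  fun_prop

/-- A path of linear maps as a linear map into the space of paths. -/
def pathCLM : C(I, P →L[ℝ] F) →L[ℝ] (P →L[ℝ] C(I, F)) :=
  LinearMap.mkContinuous₂
    (LinearMap.mk₂ ℝ (fun (Φ : C(I, P →L[ℝ] F)) (v : P) => (⟨fun s => Φ s v, by fun_prop⟩ : C(I, F)))
      (fun _ _ _ => by ext; simp) (fun _ _ _ => by ext; simp) (fun _ _ _ => by ext; simp)
      (fun _ _ _ => by ext; simp)) 1 fun Φ v => by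
    rw [one_mul]
    refine (ContinuousMap.norm_le _ (by positivity)).2 fun s => ?_
    exact ((Φ s).le_opNorm v).trans
      (mul_le_mul_of_nonneg_right (ContinuousMap.norm_coe_le_norm Φ s) (norm_nonneg v))

/-- The remainder has to be small uniformly in the time. Continuity of the derivative as a
path-valued map supplies one radius that serves all times, and the mean value inequality on that
ball does the rest for each time separately. -/
theorem hasFDerivAt_curryI {f : P × ℝ → F} {f' : P × ℝ → P →L[ℝ] F} (hf : Continuous f)
    (hf' : Continuous f') (h : ∀ p s, HasFDerivAt (fun q => f (q, s)) (f' (p, s)) p) (p : P) :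
    HasFDerivAt (curryI f hf) (pathCLM (curryI f' hf' p)) p := by
  rw [hasFDerivAt_iff_isLittleO, Asymptotics.isLittleO_iff]
  intro ε hε
  have hc := (continuous_curryI hf').continuousAt (x := p)
  obtain ⟨δ, hδ, hball⟩ := Metric.continuousAt_iff.1 hc ε hε
  filter_upwards [Metric.ball_mem_nhds p hδ] with q hq
  refine (ContinuousMap.norm_le _ (by positivity)).2 fun s => ?_
  refine (convex_ball p δ).norm_image_sub_le_of_norm_hasFDerivWithin_le'
    (f := fun q => f (q, s)) (f' := fun q => f' (q, s)) (φ := f' (p, s))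
    (fun x _ => (h x s).hasFDerivWithinAt) (fun x hx => ?_) (Metric.mem_ball_self hδ) hq
  have := (ContinuousMap.dist_lt_iff hε).1 (hball hx) s
  rw [dist_eq_norm] at this
  exact this.le

/-- The derivative is again a curried path, that of the partial derivative, followed by the fixed
linear map `pathCLM`. This allows induction on the order, with the target space varying. -/
theorem contDiff_curryI {f : P × ℝ → F} (hf : ContDiff ℝ ∞ f) :
    ContDiff ℝ ∞ (curryI f hf.continuous) := by
  refine contDiff_infty.2 fun n => ?_
  induction n generalizing F with
  | zero => exact contDiff_zero.2 (continuous_curryI hf.continuous)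
  | succ n ih =>
    have hf' : ContDiff ℝ ∞ (fun z : P × ℝ =>
        (fderiv ℝ f z).comp (ContinuousLinearMap.inl ℝ P ℝ)) :=
      (hf.fderiv_right (m := ∞) (by simp)).clm_comp contDiff_const
    refine contDiff_succ_iff_hasFDerivAt.2
      ⟨fun p => pathCLM (curryI _ hf'.continuous p), ?_, ?_⟩
    · exact (ContinuousLinearMap.contDiff (E := C(I, P →L[ℝ] F)) (F := P →L[ℝ] C(I, F)) pathCLM).comp
        (ih hf')
    · refine hasFDerivAt_curryI hf.continuous hf'.continuous fun p s => ?_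
      have h1 : HasFDerivAt f (fderiv ℝ f (p, s)) (p, s) :=
        (hf.differentiable (by simp) _).hasFDerivAt
      have h2 : HasFDerivAt (fun q : P => (q, s)) (ContinuousLinearMap.inl ℝ P ℝ) p :=
        hasFDerivAt_prodMk_left p s
      exact h1.comp p h2

end Curry

section Volterra

variable {F : Type} [NormedAddCommGroup F] [NormedSpace ℂ F]

theorem continuous_extend (f : C(I, F)) :
    Continuous (Set.IccExtend zero_le_one f : ℝ → F) := f.continuous.Icc_extend'

/-- The primitive of a path that vanishes at `0`. -/
def primitive [CompleteSpace F] : C(I, F) →L[ℂ] C(I, F) :=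
  LinearMap.mkContinuous
    { toFun := fun f => ⟨fun s => ∫ u in (0 : ℝ)..s, Set.IccExtend zero_le_one f u, by
        have : Continuous fun s : ℝ => ∫ u in (0 : ℝ)..s, Set.IccExtend zero_le_one f u :=
          intervalIntegral.continuous_primitive
            (fun a b => (continuous_extend f).intervalIntegrable a b) 0
        exact this.comp continuous_subtype_val⟩
      map_add' := fun f g => by
        ext s
        exact intervalIntegral.integral_add ((continuous_extend f).intervalIntegrable _ _)
          ((continuous_extend g).intervalIntegrable _ _)
      map_smul' := fun c f => by
        ext s
        exact intervalIntegral.integral_smul c _ } 1 fun f => by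
    rw [one_mul]
    refine (ContinuousMap.norm_le _ (norm_nonneg f)).2 fun s => ?_
    have h := intervalIntegral.norm_integral_le_of_norm_le_const
      (f := fun u => (Set.IccExtend zero_le_one f u : F)) (a := (0 : ℝ)) (b := s) (C := ‖f‖)
      fun u _ => ContinuousMap.norm_coe_le_norm f _
    refine h.trans ?_
    rw [sub_zero, abs_of_nonneg s.2.1]
    exact mul_le_of_le_one_right (norm_nonneg f) s.2.2

theorem primitive_apply [CompleteSpace F] (f : C(I, F)) (s : I) :
    primitive f s = ∫ u in (0 : ℝ)..s, Set.IccExtend zero_le_one f u := rfl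

theorem primitive_eq_of_hasDerivAt [CompleteSpace F] (f : C(I, F)) (Z : ℝ → F)
    (hZ : ∀ s : I, HasDerivAt Z (f s) s) (s : I) : primitive f s = Z s - Z 0 := by
  rw [primitive_apply]
  have hmem : ∀ u ∈ Set.uIcc (0 : ℝ) s, u ∈ Set.Icc (0 : ℝ) 1 := by
    intro u hu
    rw [Set.uIcc_of_le s.2.1] at hu
    exact ⟨hu.1, hu.2.trans s.2.2⟩
  refine intervalIntegral.integral_eq_sub_of_hasDerivAt (fun u hu => ?_)
    ((continuous_extend f).intervalIntegrable _ _)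
  have := hZ ⟨u, hmem u hu⟩
  rwa [← Set.IccExtend_of_mem zero_le_one f (hmem u hu)] at this

end Volterra

section Cutoff

variable {P F : Type} [NormedAddCommGroup P] [NormedSpace ℝ P] [FiniteDimensional ℝ P]
  [NormedAddCommGroup F] [NormedSpace ℝ F]

/-- Locally smooth data can thus be fed to constructions that ask for global smoothness, without
changing anything near the point. -/
theorem exists_contDiff_eventuallyEq {f : P → F} {p₀ : P} (hf : ∀ᶠ p in 𝓝 p₀, ContDiffAt ℝ ∞ f p) :
    ∃ χ : P → ℝ, ContDiff ℝ ∞ χ ∧ χ =ᶠ[𝓝 p₀] 1 ∧ ContDiff ℝ ∞ (fun p => χ p • f p) := by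
  obtain ⟨ε, hε, hball⟩ := Metric.eventually_nhds_iff_ball.1 hf
  -- The closed ball of radius `ε / 2` supports the bump and lies inside the ball of radius `ε`
  -- where `f` is smooth.
  let χ : ContDiffBump p₀ := ⟨ε / 4, ε / 2, by positivity, by linarith⟩
  refine ⟨χ, χ.contDiff, χ.eventuallyEq_one, contDiff_iff_contDiffAt.2 fun p => ?_⟩
  by_cases hp : p ∈ Metric.ball p₀ ε
  · exact χ.contDiff.contDiffAt.smul (hball p hp)
  · have hnot : p ∉ tsupport χ := by
      rw [χ.tsupport_eq]
      intro h
      exact hp (Metric.closedBall_subset_ball (by change ε / 2 < ε; linarith) h)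
    have : (fun p => χ p • f p) =ᶠ[𝓝 p] fun _ => 0 := by
      filter_upwards [notMem_tsupport_iff_eventuallyEq.1 hnot] with q hq
      simp [hq]
    exact contDiffAt_const.congr_of_eventuallyEq this

end Cutoff

end SuperZCR
end

noncomputable section
set_option linter.unusedSectionVars false

namespace SuperZCR

open scoped ContDiff Topology TensorProduct unitInterval
open TopologicalSpace (Opens)

/-! ### Local solutions of linear equations by inverting a Volterra operator -/

section FixedPoint

variable {B : Type} [NormedRing B] [NormedAlgebra ℂ B]

/-- The operator `Y ↦ Y - K (a Y)`. -/
def volterra (K : B →L[ℂ] B) (a : B) : B →L[ℂ] B := 1 - K.comp (ContinuousLinearMap.mul ℂ B a)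

@[simp] theorem volterra_apply (K : B →L[ℂ] B) (a Y : B) : volterra K a Y = Y - K (a * Y) := rfl

/-- The solution of `Y = 1 + K (a Y)`. -/
def volterraSol (K : B →L[ℂ] B) (a : B) : B := Ring.inverse (volterra K a) 1

theorem eq_of_volterra {K : B →L[ℂ] B} {a Y Z : B} (h : IsUnit (volterra K a))
    (e : volterra K a Y = Z) : Y = Ring.inverse (volterra K a) Z := by
  rw [← e]
  exact (congrArg (fun L : B →L[ℂ] B => L Y) (Ring.inverse_mul_cancel _ h)).symm

theorem volterraSol_eq {K : B →L[ℂ] B} {a : B} (h : IsUnit (volterra K a)) :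
    volterraSol K a = 1 + K (a * volterraSol K a) := by
  have : volterra K a (volterraSol K a) = 1 :=
    congrArg (fun L : B →L[ℂ] B => L 1) (Ring.mul_inverse_cancel _ h)
  rwa [volterra_apply, sub_eq_iff_eq_add] at this

theorem contDiff_volterra (K : B →L[ℂ] B) : ContDiff ℝ ∞ (volterra K) :=
  contDiff_const.sub (((ContinuousLinearMap.compL ℂ B B B K).comp
    (ContinuousLinearMap.mul ℂ B)).restrictScalars ℝ).contDiff

/-- Openness replaces the usual estimates for iterated integrals: along a segment of length zero the
coefficient is `0` and the operator is the identity, so it stays invertible for short segments. -/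
theorem isOpen_isUnit_volterra [CompleteSpace B] (K : B →L[ℂ] B) :
    IsOpen {a | IsUnit (volterra K a)} :=
  Units.isOpen.preimage (contDiff_volterra K).continuous

/-- Write `L = 1 - K (a ·)`. The derivative of `L⁻¹` is `-L⁻¹ (dL) L⁻¹`, and `dL` in the direction
`b` is `-K (b ·)`; apply this to `1`. -/
theorem hasFDerivAt_volterraSol [CompleteSpace B] {K : B →L[ℂ] B} {a : B}
    (h : IsUnit (volterra K a)) :
    ∃ D : B →L[ℝ] B, HasFDerivAt (volterraSol K) D a ∧
      ∀ b, D b = Ring.inverse (volterra K a) (K (b * volterraSol K a)) := by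
  obtain ⟨u, hu⟩ := h
  have h1 : HasFDerivAt (volterra K) (-(((ContinuousLinearMap.compL ℂ B B B K).comp
      (ContinuousLinearMap.mul ℂ B)).restrictScalars ℝ)) a :=
    (((ContinuousLinearMap.compL ℂ B B B K).comp
      (ContinuousLinearMap.mul ℂ B)).restrictScalars ℝ).hasFDerivAt.const_sub 1
  have h2 := hasFDerivAt_ringInverse (𝕜 := ℝ) u
  rw [hu] at h2
  have h3 := h2.comp a h1
  have h4 := ((ContinuousLinearMap.apply ℂ B (1 : B)).restrictScalars ℝ).hasFDerivAt
    (x := Ring.inverse (volterra K a))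
  have h5 := h4.comp a h3
  refine ⟨_, h5, fun b => ?_⟩
  have hinv : Ring.inverse (volterra K a) = ↑u⁻¹ := by rw [← hu, Ring.inverse_unit]
  simp only [volterraSol, hinv]
  simp [ContinuousLinearMap.mulLeftRight_apply]

theorem contDiffAt_volterraSol [CompleteSpace B] {K : B →L[ℂ] B} {a : B}
    (h : IsUnit (volterra K a)) : ContDiffAt ℝ ∞ (volterraSol K) a := by
  obtain ⟨u, hu⟩ := h
  have h2 := contDiffAt_ringInverse ℝ (n := ∞) u
  rw [hu] at h2
  exact ((ContinuousLinearMap.apply ℂ B (1 : B)).restrictScalars ℝ).contDiff.contDiffAt.comp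
    a (h2.comp a (contDiff_volterra K).contDiffAt)

end FixedPoint

section LocalSolution

variable {E 𝕜 𝔸 : Type} [NormedAddCommGroup E] [NormedSpace ℝ E]
  [RCLike 𝕜] [NormedRing 𝔸] [NormedAlgebra ℂ 𝔸] [CompleteSpace 𝔸]

/-- The point at the time `s` of the segment from `(x, c)` to `(x, w)`. -/
def ray (c : 𝕜) (z : (E × 𝕜) × ℝ) : E × 𝕜 := (z.1.1, c + z.2 • (z.1.2 - c))

theorem contDiff_ray (c : 𝕜) : ContDiff ℝ ∞ (ray (E := E) c) := by
  unfold ray; fun_prop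

/-- The coefficient of the equation `U' = Q U` along the segments that start over `c`. -/
def rayCoeff (c : 𝕜) (Q : E × 𝕜 → 𝔸) (z : (E × 𝕜) × ℝ) : 𝔸 :=
  RCLike.map 𝕜 ℂ (z.1.2 - c) • Q (ray c z)

theorem contDiff_rayCoeff (c : 𝕜) {Q : E × 𝕜 → 𝔸} (hQ : ContDiff ℝ ∞ Q) :
    ContDiff ℝ ∞ (rayCoeff c Q) := by
  have h1 : ContDiff ℝ ∞ fun z : (E × 𝕜) × ℝ => RCLike.map 𝕜 ℂ (z.1.2 - c) :=
    (RCLike.map 𝕜 ℂ).contDiff.comp (by fun_prop)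
  exact h1.smul (hQ.comp (contDiff_ray c))

/-- Balls of the product are star-shaped in the parameter direction, so everything assumed on a ball
holds along the segments. -/
theorem mem_ball_ray {p₀ p : E × 𝕜} {ε : ℝ} (hp : p ∈ Metric.ball p₀ ε) {s : ℝ}
    (h0 : 0 ≤ s) (h1 : s ≤ 1) : ray p₀.2 (p, s) ∈ Metric.ball p₀ ε := by
  rw [Metric.mem_ball, Prod.dist_eq, max_lt_iff] at hp ⊢
  refine ⟨hp.1, ?_⟩
  have hp2 := hp.2
  rw [dist_eq_norm] at hp2 ⊢
  simp only [ray, add_sub_cancel_left, norm_smul, Real.norm_eq_abs, abs_of_nonneg h0]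
  exact (mul_le_of_le_one_left (norm_nonneg _) h1).trans_lt hp2

/-- The local solution of `∂U/∂w = Q U` with `U = 1` for `w = c`. -/
def localSol (c : 𝕜) (Q : E × 𝕜 → 𝔸) (hQ : ContDiff ℝ ∞ Q) (p : E × 𝕜) : 𝔸 :=
  volterraSol primitive (curryI _ (contDiff_rayCoeff c hQ).continuous p) 1

/-- With time rescaled to the unit interval, the path `Y` over the segment to `(x, w)` solves `Y' =
(w - c) Q Y`. Its variation in the direction `a` is guessed to be `a s Q Y`, as it would be for a
true solution evaluated at `c + s (w - c)`; at `s = 1` this is the asserted equation. Holomorphy of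
`Q` enters by writing its derivative in each direction as a multiple of a single one. -/
theorem fderiv_localSol (c : 𝕜) {Q : E × 𝕜 → 𝔸} (hQ : ContDiff ℝ ∞ Q) (p : E × 𝕜)
    (hu : IsUnit (volterra primitive (curryI _ (contDiff_rayCoeff c hQ).continuous p)))
    (hhol : ∀ s : I, ∀ a, fderiv ℝ Q (ray c (p, s)) (0, a) =
      RCLike.map 𝕜 ℂ a • fderiv ℝ Q (ray c (p, s)) (0, 1)) :
    ContDiffAt ℝ ∞ (localSol c Q hQ) p ∧
      ∀ a, fderiv ℝ (localSol c Q hQ) p (0, a) =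
        RCLike.map 𝕜 ℂ a • (Q p * localSol c Q hQ p) := by
  set A := curryI _ (contDiff_rayCoeff c hQ).continuous with hA
  set Y := volterraSol primitive (A p) with hY
  have hev : ContDiff ℝ ∞ (fun f : C(I, 𝔸) => f 1) :=
    (ContinuousMap.evalCLM ℝ (1 : I) : C(I, 𝔸) →L[ℝ] 𝔸).contDiff
  have hAc : ContDiff ℝ ∞ A := contDiff_curryI (contDiff_rayCoeff c hQ)
  refine ⟨hev.contDiffAt.comp p ((contDiffAt_volterraSol hu).comp p hAc.contDiffAt), fun a => ?_⟩
  obtain ⟨D, hD, hDapp⟩ := hasFDerivAt_volterraSol hu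
  have hQd : ∀ z, HasFDerivAt Q (fderiv ℝ Q z) z := fun z =>
    (hQ.differentiable (by simp) z).hasFDerivAt
  -- the derivative of `A` in the direction `a`
  have hAd : HasFDerivAt A (fderiv ℝ A p) p := (hAc.differentiable (by simp) p).hasFDerivAt
  have hAa : ∀ s : I, fderiv ℝ A p (0, a) s = RCLike.map 𝕜 ℂ a • (Q (ray c (p, s)) +
      ((s : ℝ) : ℂ) • RCLike.map 𝕜 ℂ (p.2 - c) • fderiv ℝ Q (ray c (p, s)) (0, 1)) := by
    intro s
    have e1 : HasFDerivAt (fun q => A q s)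
        ((ContinuousMap.evalCLM ℝ s : C(I, 𝔸) →L[ℝ] 𝔸).comp (fderiv ℝ A p)) p :=
      (ContinuousMap.evalCLM ℝ s : C(I, 𝔸) →L[ℝ] 𝔸).hasFDerivAt.comp p hAd
    have hline : HasDerivAt (fun t : ℝ => p + t • ((0, a) : E × 𝕜)) (0, a) 0 := by
      simpa using ((hasDerivAt_id (0 : ℝ)).smul_const ((0, a) : E × 𝕜)).const_add p
    have e2 : HasDerivAt (fun t : ℝ => A (p + t • ((0, a) : E × 𝕜)) s) (fderiv ℝ A p (0, a) s) 0 := by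
      have e1' : HasFDerivAt (fun q => A q s)
          ((ContinuousMap.evalCLM ℝ s : C(I, 𝔸) →L[ℝ] 𝔸).comp (fderiv ℝ A p))
          (p + (0 : ℝ) • ((0, a) : E × 𝕜)) := by simpa using e1
      exact e1'.comp_hasDerivAt (0 : ℝ) hline
    have e3 : HasDerivAt (fun t : ℝ => RCLike.map 𝕜 ℂ (p.2 - c + t • a))
        (RCLike.map 𝕜 ℂ a) 0 := by
      have : HasDerivAt (fun t : ℝ => p.2 - c + t • a) a 0 := by
        simpa using ((hasDerivAt_id (0 : ℝ)).smul_const a).const_add (p.2 - c)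
      exact ((RCLike.map 𝕜 ℂ).hasFDerivAt).comp_hasDerivAt (0 : ℝ) this
    have e4 : HasDerivAt (fun t : ℝ => ray c (p + t • ((0, a) : E × 𝕜), (s : ℝ))) (0, (s : ℝ) • a) 0 := by
      have : HasDerivAt (fun t : ℝ => ((p.1, c + (s : ℝ) • (p.2 + t • a - c)) : E × 𝕜))
          (0, (s : ℝ) • a) 0 := by
        refine (hasDerivAt_const _ _).prodMk ?_
        have : HasDerivAt (fun t : ℝ => p.2 + t • a - c) a 0 := by
          simpa using (((hasDerivAt_id (0 : ℝ)).smul_const a).const_add p.2).sub_const c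
        exact (this.const_smul (s : ℝ)).const_add c
      simpa [ray] using this
    have e5 : HasDerivAt (fun t : ℝ => Q (ray c (p + t • ((0, a) : E × 𝕜), (s : ℝ))))
        (fderiv ℝ Q (ray c (p, s)) (0, (s : ℝ) • a)) 0 := by
      refine HasFDerivAt.comp_hasDerivAt (0 : ℝ) ?_ e4
      simpa using hQd (ray c (p, s))
    have e6 : HasDerivAt (fun t : ℝ => A (p + t • ((0, a) : E × 𝕜)) s)
        (RCLike.map 𝕜 ℂ (p.2 - c) • fderiv ℝ Q (ray c (p, s)) (0, (s : ℝ) • a) +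
          RCLike.map 𝕜 ℂ a • Q (ray c (p, s))) 0 := by
      have := e3.smul e5
      simp only [zero_smul, add_zero] at this
      refine this.congr_of_eventuallyEq (Filter.Eventually.of_forall fun t => ?_)
      simp [hA, curryI, rayCoeff, add_sub_right_comm]
    rw [e2.unique e6]
    have : ((0, (s : ℝ) • a) : E × 𝕜) = (s : ℝ) • (0, a) := by simp
    rw [this, map_smul, hhol s a, smul_add, add_comm]
    congr 1
    rw [← Complex.coe_smul, smul_comm _ (RCLike.map 𝕜 ℂ a), smul_comm _ (RCLike.map 𝕜 ℂ a),
      smul_comm (RCLike.map 𝕜 ℂ (p.2 - c))]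
  -- the candidate for the derivative of the path
  have hYeq := volterraSol_eq hu
  rw [← hY] at hYeq
  let G : ℝ → 𝔸 := fun t => 1 + ∫ u in (0 : ℝ)..t, Set.IccExtend zero_le_one (A p * Y) u
  have hG : ∀ s : I, G s = Y s := fun s => by
    conv_rhs => rw [hYeq]
    rfl
  have hGd : ∀ s : I, HasDerivAt G (A p s * Y s) s := by
    intro s
    have := intervalIntegral.integral_hasDerivAt_right
      ((continuous_extend (A p * Y)).intervalIntegrable 0 s)
      ((continuous_extend (A p * Y)).stronglyMeasurableAtFilter _ _)
      (continuous_extend (A p * Y)).continuousAt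
    rw [Set.IccExtend_of_mem zero_le_one _ s.2] at this
    exact this.const_add 1
  let Zf : ℝ → 𝔸 := fun t => RCLike.map 𝕜 ℂ a • ((t : ℂ) • (Q (ray c (p, t)) * G t))
  have hQray : ∀ s : I, HasDerivAt (fun t : ℝ => Q (ray c (p, t)))
      (RCLike.map 𝕜 ℂ (p.2 - c) • fderiv ℝ Q (ray c (p, s)) (0, 1)) s := by
    intro s
    rw [← hhol s]
    refine (hQd _).comp_hasDerivAt (s : ℝ) ?_
    have : HasDerivAt (fun t : ℝ => ((p.1, c + t • (p.2 - c)) : E × 𝕜)) (0, p.2 - c) s := by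
      refine (hasDerivAt_const _ _).prodMk ?_
      simpa using ((hasDerivAt_id (s : ℝ)).smul_const (p.2 - c)).const_add c
    exact this
  let Z : C(I, 𝔸) := ⟨fun s => RCLike.map 𝕜 ℂ a • (((s : ℝ) : ℂ) • (Q (ray c (p, s)) * Y s)), by
    have := hQ.continuous
    have h3 := (contDiff_ray (E := E) c).continuous
    fun_prop⟩
  -- The variation is characterised by the linearised Volterra equation. The candidate `Z` satisfies
  -- it because `Z' = A_a Y + A Z` with `Z = 0` at time `0`, where `A_a` is the derivative of `A` in
  -- the direction `a`; invertibility of the operator gives uniqueness.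
  have hZ : volterra primitive (A p) Z = primitive (fderiv ℝ A p (0, a) * Y) := by
    rw [volterra_apply, sub_eq_iff_eq_add, ← map_add]
    ext s
    rw [primitive_eq_of_hasDerivAt _ Zf]
    · simp [Zf, Z, hG]
    · intro s
      have h1 := ((hasDerivAt_id (s : ℝ)).ofReal_comp.smul
        ((hQray s).mul (hGd s))).const_smul (RCLike.map 𝕜 ℂ a)
      refine h1.congr_deriv ?_
      simp only [ContinuousMap.add_apply, ContinuousMap.mul_apply, hAa, hG, Z,
        ContinuousMap.coe_mk, id, Pi.mul_apply]
      have : A p s = RCLike.map 𝕜 ℂ (p.2 - c) • Q (ray c (p, s)) := rfl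
      rw [this]
      simp only [smul_add, add_mul, smul_mul_assoc, mul_smul_comm, mul_assoc, Complex.ofReal_one,
        one_smul, smul_smul]
      module
  have hfin : HasFDerivAt (localSol c Q hQ)
      (((ContinuousMap.evalCLM ℝ (1 : I) : C(I, 𝔸) →L[ℝ] 𝔸).comp D).comp (fderiv ℝ A p)) p :=
    ((ContinuousMap.evalCLM ℝ (1 : I) : C(I, 𝔸) →L[ℝ] 𝔸).hasFDerivAt.comp (A p) hD).comp p hAd
  rw [hfin.fderiv]
  change D (fderiv ℝ A p (0, a)) 1 = _
  rw [hDapp, ← eq_of_volterra hu hZ]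
  simp [Z, ray, localSol, Y, A]

/-- Near each point, the equation `∂U/∂w = Q U` has a smooth invertible solution. -/
theorem exists_local_solution [FiniteDimensional ℝ E] {Q : E × 𝕜 → 𝔸} {p₀ : E × 𝕜}
    (hQ : ∀ᶠ p in 𝓝 p₀, ContDiffAt ℝ ∞ Q p)
    (hhol : ∀ᶠ p in 𝓝 p₀, ∀ a, fderiv ℝ Q p (0, a) = RCLike.map 𝕜 ℂ a • fderiv ℝ Q p (0, 1)) :
    ∃ ε > 0, ∃ U : E × 𝕜 → 𝔸, (∀ p, p.2 = p₀.2 → U p = 1) ∧ ∀ p ∈ Metric.ball p₀ ε,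
      ContDiffAt ℝ ∞ U p ∧ IsUnit (U p) ∧
      ∀ a, fderiv ℝ U p (0, a) = RCLike.map 𝕜 ℂ a • (Q p * U p) := by
  have : FiniteDimensional ℝ 𝕜 := inferInstance
  obtain ⟨χ, -, hχ, hχQ⟩ := exists_contDiff_eventuallyEq hQ
  have heq : (fun p => χ p • Q p) =ᶠ[𝓝 p₀] Q := by
    filter_upwards [hχ] with p hp
    simp [hp]
  set Q' : E × 𝕜 → 𝔸 := fun p => χ p • Q p
  let A := curryI _ (contDiff_rayCoeff p₀.2 hχQ).continuous
  have hAc : ContDiff ℝ ∞ A := contDiff_curryI (contDiff_rayCoeff p₀.2 hχQ)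
  have hone : ∀ p, p.2 = p₀.2 → A p = 0 := by
    intro p hp
    ext s
    simp [A, curryI, rayCoeff, hp]
  have hvolt0 : volterra (primitive (F := 𝔸)) 0 = 1 := by ext; simp
  have hunit : ∀ᶠ p in 𝓝 p₀, IsUnit (volterra primitive (A p)) := by
    refine hAc.continuous.continuousAt.eventually_mem
      ((isOpen_isUnit_volterra (primitive (F := 𝔸))).mem_nhds ?_)
    change IsUnit (volterra primitive (A p₀))
    rw [hone p₀ rfl, hvolt0]
    exact isUnit_one
  have hsol1 : ∀ p, p.2 = p₀.2 → localSol p₀.2 Q' hχQ p = 1 := by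
    intro p hp
    change volterraSol primitive (A p) 1 = 1
    rw [hone p hp, volterraSol, hvolt0, Ring.inverse_one]
    rfl
  obtain ⟨ε, hε, hball⟩ := Metric.eventually_nhds_iff_ball.1
    (hunit.and (heq.eventuallyEq_nhds.and hhol))
  have hder : ∀ p ∈ Metric.ball p₀ ε, ContDiffAt ℝ ∞ (localSol p₀.2 Q' hχQ) p ∧
      ∀ a, fderiv ℝ (localSol p₀.2 Q' hχQ) p (0, a) =
        RCLike.map 𝕜 ℂ a • (Q p * localSol p₀.2 Q' hχQ p) := by
    intro p hp
    -- The whole segment stays in the ball on which the cut-off coefficient coincides with `Q` to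
    -- all orders.
    have := fderiv_localSol p₀.2 hχQ p (hball p hp).1 fun s a => by
      have h := hball _ (mem_ball_ray hp s.2.1 s.2.2)
      rw [h.2.1.fderiv_eq]
      exact h.2.2 a
    rwa [(hball p hp).2.1.self_of_nhds] at this
  have hU : ∀ᶠ p in 𝓝 p₀, IsUnit (localSol p₀.2 Q' hχQ p) := by
    refine (hder p₀ (Metric.mem_ball_self hε)).1.continuousAt.eventually_mem
      (Units.isOpen.mem_nhds ?_)
    change IsUnit (localSol p₀.2 Q' hχQ p₀)
    rw [hsol1 p₀ rfl]
    exact isUnit_one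
  obtain ⟨δ, hδ, hδball⟩ := Metric.eventually_nhds_iff_ball.1 hU
  refine ⟨min ε δ, lt_min hε hδ, localSol p₀.2 Q' hχQ, hsol1, fun p hp => ?_⟩
  have h1 := hder p (Metric.ball_subset_ball (min_le_left _ _) hp)
  exact ⟨h1.1, hδball p (Metric.ball_subset_ball (min_le_right _ _) hp), h1.2⟩

end LocalSolution

end SuperZCR
end

noncomputable section
set_option linter.unusedSectionVars false

namespace SuperZCR

open scoped ContDiff Topology TensorProduct unitInterval
open TopologicalSpace (Opens)

/-! ### Global solutions over a simply connected parameter domain -/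

section ParameterEquation

variable {𝕜 𝔸 : Type} [RCLike 𝕜] [NormedRing 𝔸] [NormedAlgebra ℂ 𝔸]

/-- At the point `w`, the function `f` satisfies the equation `∂f/∂w = q f`. -/
def SolvesAt (q f : 𝕜 → 𝔸) (w : 𝕜) : Prop :=
  DifferentiableAt ℝ f w ∧ ∀ v, fderiv ℝ f w v = RCLike.map 𝕜 ℂ v • (q w * f w)

theorem SolvesAt.congr {q f g : 𝕜 → 𝔸} {w : 𝕜} (hf : SolvesAt q f w) (h : g =ᶠ[𝓝 w] f) :
    SolvesAt q g w := by
  refine ⟨hf.1.congr_of_eventuallyEq h, fun v => ?_⟩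
  rw [h.fderiv_eq, hf.2, h.self_of_nhds]

theorem SolvesAt.mul_const {q f : 𝕜 → 𝔸} {w : 𝕜} (hf : SolvesAt q f w) (b : 𝔸) :
    SolvesAt q (fun w => f w * b) w := by
  refine ⟨hf.1.mul_const b, fun v => ?_⟩
  rw [fderiv_mul_const' hf.1]
  simp [hf.2, mul_assoc]

/-- The derivative of `f⁻¹ g` is `-f⁻¹ (q f) f⁻¹ g + f⁻¹ (q g) = 0`. This yields both the local
constancy of transition functions and all later comparisons of solutions. -/
theorem SolvesAt.inverse_mul_eq [CompleteSpace 𝔸] {q f g : 𝕜 → 𝔸} {B : Set 𝕜} (hB : IsOpen B)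
    (hc : Convex ℝ B) (hf : ∀ w ∈ B, SolvesAt q f w) (hu : ∀ w ∈ B, IsUnit (f w))
    (hg : ∀ w ∈ B, SolvesAt q g w) {w w' : 𝕜} (hw : w ∈ B) (hw' : w' ∈ B) :
    Ring.inverse (f w) * g w = Ring.inverse (f w') * g w' := by
  have key : ∀ z ∈ B, HasFDerivAt (fun w => Ring.inverse (f w) * g w) (0 : 𝕜 →L[ℝ] 𝔸) z := by
    intro z hz
    obtain ⟨u, hu⟩ := hu z hz
    have h1 := hasFDerivAt_ringInverse (𝕜 := ℝ) u
    rw [hu] at h1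
    have h2 := (h1.comp z (hf z hz).1.hasFDerivAt).mul' (hg z hz).1.hasFDerivAt
    refine h2.congr_fderiv ?_
    ext v
    simp [(hf z hz).2, (hg z hz).2, ContinuousLinearMap.mulLeftRight_apply, ← hu, mul_assoc]
  refine hc.is_const_of_fderivWithin_eq_zero (𝕜 := ℝ) (f := fun w => Ring.inverse (f w) * g w)
    (fun z hz => (key z hz).differentiableAt.differentiableWithinAt) (fun z hz => ?_) hw hw'
  rw [fderivWithin_of_isOpen hB hz, (key z hz).fderiv]

/-- A type with the discrete topology. -/
def Discrete (α : Type) : Type := α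

instance (α : Type) : TopologicalSpace (Discrete α) := ⊥
instance (α : Type) : DiscreteTopology (Discrete α) := ⟨rfl⟩

/-- Left multiplication on the discrete copy of a ring. -/
def leftAct (a : 𝔸) (v : Discrete 𝔸) : Discrete 𝔸 := @HMul.hMul 𝔸 𝔸 𝔸 _ a v

theorem leftAct_one (v : Discrete 𝔸) : leftAct 1 v = v := one_mul (M := 𝔸) v

theorem leftAct_leftAct (a b : 𝔸) (v : Discrete 𝔸) : leftAct a (leftAct b v) = leftAct (a * b) v :=
  (mul_assoc (G := 𝔸) a b v).symm

variable {𝓘 : Opens 𝕜}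

/-- The bundle over `𝓘` with discrete fibres whose continuous sections are the solutions of the
equation `∂f/∂w = q f`. -/
def solutionBundle [CompleteSpace 𝔸] (q : 𝕜 → 𝔸) (U : 𝓘 → 𝕜 → 𝔸) (ε : 𝓘 → ℝ)
    (hε : ∀ c, 0 < ε c)
    (hU : ∀ c, ∀ w ∈ Metric.ball c.1 (ε c), SolvesAt q (U c) w ∧ IsUnit (U c w)) :
    FiberBundleCore 𝓘 𝓘 (Discrete 𝔸) where
  baseSet c := {w | w.1 ∈ Metric.ball c.1 (ε c)}
  isOpen_baseSet c := Metric.isOpen_ball.preimage continuous_subtype_val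
  indexAt := id
  mem_baseSet_at c := Metric.mem_ball_self (hε c)
  coordChange i j w v := leftAct (Ring.inverse (U j w) * U i w) v
  coordChange_self i w hw v := by
    rw [Ring.inverse_mul_cancel _ (hU i w hw).2, leftAct_one]
  continuousOn_coordChange i j := by
    rintro ⟨w₀, v₀⟩ ⟨⟨hi, hj⟩, -⟩
    have hcont : Continuous fun p : 𝓘 × Discrete 𝔸 =>
        leftAct (Ring.inverse (U j w₀) * U i w₀) p.2 :=
      continuous_of_discreteTopology.comp continuous_snd
    -- The intersection of two balls is convex, so the transition function is constant on it; this
    -- is what continuity with discrete fibres requires.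
    refine (hcont.continuousOn.congr fun p hp => ?_) _ ⟨⟨hi, hj⟩, trivial⟩
    rw [SolvesAt.inverse_mul_eq (Metric.isOpen_ball.inter Metric.isOpen_ball)
      ((convex_ball _ _).inter (convex_ball _ _)) (fun w hw => (hU j w hw.2).1)
      (fun w hw => (hU j w hw.2).2) (fun w hw => (hU i w hw.1).1) hp.1 ⟨hi, hj⟩]
  coordChange_comp i j k w hw v := by
    rw [leftAct_leftAct, mul_assoc, ← mul_assoc (U j w),
      Ring.mul_inverse_cancel _ (hU j w hw.1.2).2, one_mul]

/-- Local solutions of `∂f/∂w = q f` on a simply connected domain give a global one. -/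
theorem exists_section_of_local [CompleteSpace 𝔸] [SimplyConnectedSpace 𝓘] (q : 𝕜 → 𝔸)
    (U : 𝓘 → 𝕜 → 𝔸) (ε : 𝓘 → ℝ) (hε : ∀ c, 0 < ε c)
    (hU : ∀ c, ∀ w ∈ Metric.ball c.1 (ε c), SolvesAt q (U c) w ∧ IsUnit (U c w))
    (hone : ∀ c, U c c = 1) (w₀ : 𝓘) :
    ∃ Z : 𝓘 → 𝔸, Z w₀ = 1 ∧ ∀ c, ∀ᶠ w in 𝓝 c, Z w = U c w * Z c := by
  have : LocallyPathConnectedSpace 𝓘 := 𝓘.isOpen.locallyPathConnectedSpace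
  let core := solutionBundle q U ε hε hU
  -- A bundle with discrete fibres is a covering, so the identity of the simply connected base lifts
  -- through the prescribed point over `w₀`. The lift is the global solution.
  have hcov : IsCoveringMap (Bundle.TotalSpace.proj : Bundle.TotalSpace (Discrete 𝔸) core.Fiber → 𝓘) :=
    FiberBundle.isCoveringMap
  obtain ⟨Φ, ⟨hΦ0, hΦ⟩, -⟩ := hcov.existsUnique_continuousMap_lifts (ContinuousMap.id 𝓘) w₀
    (⟨w₀, (1 : 𝔸)⟩ : Bundle.TotalSpace (Discrete 𝔸) core.Fiber) rfl
  have hproj : ∀ w, (Φ w).1 = w := fun w => congrFun hΦ w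
  let Z : 𝓘 → 𝔸 := fun w => (Φ w).2
  refine ⟨Z, ?_, fun c => ?_⟩
  · have : Z w₀ = (Φ w₀).2 := rfl
    rw [this, hΦ0]
  -- The fibre over `w` is read in the chart centred at `w`, where the local solution has value `1`.
  -- In the chart of `c` the lift therefore reads `U_c(w)⁻¹ Z(w)`, and a continuous discrete-valued
  -- function is locally constant.
  · have hloc : ∀ w, (core.localTriv c (Φ w)).2 = (Ring.inverse (U c w) * Z w : 𝔸) := by
      intro w
      have : (core.localTriv c (Φ w)).2 =
          (Ring.inverse (U c (Φ w).1) * U (Φ w).1 (Φ w).1 * Z w : 𝔸) := rfl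
      rw [this, hproj, hone, mul_one]
    have hmem : Φ c ∈ (core.localTriv c).source := by
      rw [(core.localTriv c).mem_source]
      change ((Φ c).1 : 𝕜) ∈ Metric.ball c.1 (ε c)
      rw [hproj]
      exact Metric.mem_ball_self (hε c)
    have hcont : ContinuousAt (fun w => (core.localTriv c (Φ w)).2) c :=
      continuous_snd.continuousAt.comp
        ((((core.localTriv c).continuousOn.continuousAt
          ((core.localTriv c).open_source.mem_nhds hmem))).comp Φ.continuous.continuousAt)
    have hev : ∀ᶠ w in 𝓝 c, (core.localTriv c (Φ w)).2 = (core.localTriv c (Φ c)).2 :=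
      hcont.eventually_mem (isOpen_discrete {_} |>.mem_nhds rfl)
    have hball : ∀ᶠ w : 𝓘 in 𝓝 c, w.1 ∈ Metric.ball c.1 (ε c) :=
      continuous_subtype_val.continuousAt.eventually_mem (Metric.ball_mem_nhds _ (hε c))
    filter_upwards [hev, hball] with w hw hwb
    rw [hloc, hloc, hone, Ring.inverse_one, one_mul] at hw
    have hw' : Ring.inverse (U c w) * Z w = Z c := hw
    rw [← hw', ← mul_assoc, Ring.mul_inverse_cancel _ (hU c w hwb).2, one_mul]

end ParameterEquation

/-- A locally constant truth value is constant on a connected space. In this form smoothness,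
factorization into exponentials and vanishing on `ℰ^∞` are each carried from the initial parameter
to all others. -/
theorem forall_of_locally_iff {X : Type} [TopologicalSpace X] [PreconnectedSpace X] {p : X → Prop}
    (h : ∀ x, ∀ᶠ y in 𝓝 x, (p x ↔ p y)) {x₀ : X} (h₀ : p x₀) (x : X) : p x := by
  have : Std.Symm fun a b => p a ↔ p b := ⟨fun _ _ h => h.symm⟩
  exact (PreconnectedSpace.induction₂ (fun a b => p a ↔ p b) h ⟨fun _ _ _ h h' => h.trans h'⟩
    x₀ x).1 h₀

section GlobalSolution

variable {E 𝕜 𝔸 : Type} [NormedAddCommGroup E] [NormedSpace ℝ E] [FiniteDimensional ℝ E]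
  [RCLike 𝕜] [NormedRing 𝔸] [NormedAlgebra ℂ 𝔸] [CompleteSpace 𝔸]

theorem solvesAt_slice {Q U : E × 𝕜 → 𝔸} {p : E × 𝕜} (hU : ContDiffAt ℝ ∞ U p)
    (h : ∀ a, fderiv ℝ U p (0, a) = RCLike.map 𝕜 ℂ a • (Q p * U p)) :
    SolvesAt (fun w => Q (p.1, w)) (fun w => U (p.1, w)) p.2 := by
  have h1 : HasFDerivAt U (fderiv ℝ U p) (p.1, p.2) :=
    (hU.differentiableAt (by simp)).hasFDerivAt
  have h2 := h1.comp p.2 (hasFDerivAt_prodMk_right (𝕜 := ℝ) p.1 p.2)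
  refine ⟨h2.differentiableAt, fun v => ?_⟩
  have h3 : fderiv ℝ (fun w => U (p.1, w)) p.2 = _ := h2.fderiv
  rw [h3]
  exact h v

/-- The equation `∂S/∂w = Q S`, `S = 1` for `w = w₀`, has a smooth invertible solution on the
product of an open set and a simply connected domain. -/
theorem exists_global_solution {V : Set E} (hV : IsOpen V) {𝓘 : Opens 𝕜} [SimplyConnectedSpace 𝓘]
    {Q : E × 𝕜 → 𝔸} (hQ : ∀ p : E × 𝕜, p.1 ∈ V → p.2 ∈ 𝓘 → ContDiffAt ℝ ∞ Q p)
    (hhol : ∀ p : E × 𝕜, p.1 ∈ V → p.2 ∈ 𝓘 → ∀ a,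
      fderiv ℝ Q p (0, a) = RCLike.map 𝕜 ℂ a • fderiv ℝ Q p (0, 1)) (w₀ : 𝓘) :
    ∃ S : E × 𝕜 → 𝔸, (∀ x ∈ V, S (x, w₀) = 1) ∧ ∀ p : E × 𝕜, p.1 ∈ V → p.2 ∈ 𝓘 →
      ContDiffAt ℝ ∞ S p ∧ IsUnit (S p) ∧
      ∀ a, fderiv ℝ S p (0, a) = RCLike.map 𝕜 ℂ a • (Q p * S p) := by
  classical
  have hopen : IsOpen {p : E × 𝕜 | p.1 ∈ V ∧ p.2 ∈ 𝓘} := hV.prod 𝓘.isOpen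
  -- local solutions in neighbourhoods contained in the domain
  have hloc : ∀ p : E × 𝕜, p.1 ∈ V → p.2 ∈ 𝓘 → ∃ ε > 0, ∃ U : E × 𝕜 → 𝔸,
      (∀ z, z.2 = p.2 → U z = 1) ∧ ∀ z ∈ Metric.ball p ε, (z.1 ∈ V ∧ z.2 ∈ 𝓘) ∧
      ContDiffAt ℝ ∞ U z ∧ IsUnit (U z) ∧
      ∀ a, fderiv ℝ U z (0, a) = RCLike.map 𝕜 ℂ a • (Q z * U z) := by
    intro p h1 h2
    have hev : ∀ᶠ z : E × 𝕜 in 𝓝 p, z.1 ∈ V ∧ z.2 ∈ 𝓘 := hopen.mem_nhds ⟨h1, h2⟩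
    obtain ⟨ε, hε, U, hU1, hU⟩ := exists_local_solution (hev.mono fun z hz => hQ z hz.1 hz.2)
      (hev.mono fun z hz => hhol z hz.1 hz.2)
    obtain ⟨δ, hδ, hball⟩ := Metric.eventually_nhds_iff_ball.1 hev
    exact ⟨min ε δ, lt_min hε hδ, U, hU1, fun z hz =>
      ⟨hball z (Metric.ball_subset_ball (min_le_right _ _) hz),
        hU z (Metric.ball_subset_ball (min_le_left _ _) hz)⟩⟩
  choose! ε hε U hU1 hU using hloc
  have hmemball : ∀ (x : E) (c w : 𝕜) (δ : ℝ), 0 < δ → w ∈ Metric.ball c δ →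
      ((x, w) : E × 𝕜) ∈ Metric.ball (x, c) δ := by
    intro x c w δ hδ hw
    rw [Metric.mem_ball, Prod.dist_eq]
    simpa [hδ] using hw
  -- The sections are chosen for each `x` independently; regularity in `x` is recovered afterwards
  -- from the comparison with the local solutions.
  have hsec : ∀ x ∈ V, ∃ Z : 𝓘 → 𝔸, Z w₀ = 1 ∧
      ∀ c : 𝓘, ∀ᶠ w in 𝓝 c, Z w = U (x, c.1) (x, w.1) * Z c := by
    intro x hx
    refine exists_section_of_local (fun w => Q (x, w)) (fun c w => U (x, c.1) (x, w))
      (fun c => ε (x, c.1)) (fun c => hε (x, c.1) hx c.2) (fun c w hw => ?_)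
      (fun c => hU1 (x, c.1) hx c.2 _ rfl) w₀
    have h := hU (x, c.1) hx c.2 (x, w) (hmemball x c w _ (hε (x, c.1) hx c.2) hw)
    exact ⟨solvesAt_slice h.2.1 h.2.2.2, h.2.2.1⟩
  choose! Z hZ1 hZ using hsec
  let S : E × 𝕜 → 𝔸 := fun p => if h : p.2 ∈ 𝓘 then Z p.1 ⟨p.2, h⟩ else 1
  have hS : ∀ x (w : 𝓘), S (x, w) = Z x w := fun x w => by simp [S]
  -- the restriction to a slice
  have hSloc : ∀ x ∈ V, ∀ c ∈ 𝓘, ∀ᶠ w in 𝓝 c, S (x, w) = U (x, c) (x, w) * S (x, c) := by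
    intro x hx c hc
    have h := hZ x hx ⟨c, hc⟩
    rw [nhds_subtype_eq_comap, Filter.eventually_comap] at h
    filter_upwards [h, 𝓘.isOpen.mem_nhds hc] with w hw hw'
    have := hw ⟨w, hw'⟩ rfl
    rwa [← hS, ← hS] at this
  have hslice : ∀ x ∈ V, ∀ c ∈ 𝓘, SolvesAt (fun w => Q (x, w)) (fun w => S (x, w)) c := by
    intro x hx c hc
    have h := hU (x, c) hx hc (x, c) (Metric.mem_ball_self (hε (x, c) hx hc))
    exact ((solvesAt_slice h.2.1 h.2.2.2).mul_const (S (x, c))).congr (hSloc x hx c hc)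
  -- the comparison with a local solution
  have hcomp : ∀ x₀ ∈ V, ∀ c ∈ 𝓘, ∀ z ∈ Metric.ball ((x₀, c) : E × 𝕜) (ε (x₀, c)),
      S z = U (x₀, c) z * S (z.1, c) := by
    intro x₀ hx₀ c hc z hz
    have hz' := hz
    rw [Metric.mem_ball, Prod.dist_eq, max_lt_iff] at hz'
    have hin : ∀ w ∈ Metric.ball c (ε (x₀, c)),
        ((z.1, w) : E × 𝕜) ∈ Metric.ball (x₀, c) (ε (x₀, c)) := by
      intro w hw
      rw [Metric.mem_ball, Prod.dist_eq, max_lt_iff]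
      exact ⟨hz'.1, hw⟩
    have hcb := Metric.mem_ball_self (x := c) (hε (x₀, c) hx₀ hc)
    have hzV : z.1 ∈ V := (hU (x₀, c) hx₀ hc z hz).1.1
    -- In the slice through `z` the local solution `U` is invertible and equals `1` over `c`, so the
    -- constant `U⁻¹ S` is the value of `S` over `c`.
    have := SolvesAt.inverse_mul_eq (q := fun w => Q (z.1, w)) (f := fun w => U (x₀, c) (z.1, w))
      (g := fun w => S (z.1, w)) Metric.isOpen_ball (convex_ball c (ε (x₀, c)))
      (fun w hw => by
        have h := hU (x₀, c) hx₀ hc _ (hin w hw)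
        exact solvesAt_slice h.2.1 h.2.2.2)
      (fun w hw => (hU (x₀, c) hx₀ hc _ (hin w hw)).2.2.1)
      (fun w hw => hslice z.1 hzV w (hU (x₀, c) hx₀ hc _ (hin w hw)).1.2) (w := z.2) (w' := c)
      hz'.2 hcb
    simp only [hU1 (x₀, c) hx₀ hc (z.1, c) rfl, Ring.inverse_one, one_mul] at this
    rw [← this, ← mul_assoc, Ring.mul_inverse_cancel _ (hU (x₀, c) hx₀ hc z hz).2.2.1, one_mul]
  -- propagation along the parameter
  have hprop : ∀ x₀ ∈ V, ∀ c : 𝓘, IsUnit (S (x₀, c.1)) ∧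
      ContDiffAt ℝ ∞ (fun x => S (x, c.1)) x₀ := by
    intro x₀ hx₀
    -- The slices of `S` over nearby parameters differ by a smooth invertible factor, so smoothness
    -- and invertibility pass in both directions; over `w₀` the slice is `1`.
    refine forall_of_locally_iff (x₀ := w₀) (fun c => ?_) ⟨?_, ?_⟩
    · have hball : ∀ᶠ w : 𝓘 in 𝓝 c, w.1 ∈ Metric.ball c.1 (ε (x₀, c.1)) :=
        continuous_subtype_val.continuousAt.eventually_mem
          (Metric.ball_mem_nhds _ (hε (x₀, c.1) hx₀ c.2))
      filter_upwards [hball] with w hw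
      have hin := hmemball x₀ c.1 w.1 _ (hε (x₀, c.1) hx₀ c.2) hw
      have hUw := hU (x₀, c.1) hx₀ c.2 _ hin
      have hpt := hcomp x₀ hx₀ c.1 c.2 _ hin
      have hslice' : Continuous fun x : E => ((x, w.1) : E × 𝕜) := by fun_prop
      have hnear : ∀ᶠ x in 𝓝 x₀, S (x, w.1) = U (x₀, c.1) (x, w.1) * S (x, c.1) ∧
          IsUnit (U (x₀, c.1) (x, w.1)) := by
        filter_upwards [hslice'.continuousAt.eventually_mem (Metric.isOpen_ball.mem_nhds hin)]
          with x hx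
        exact ⟨hcomp x₀ hx₀ c.1 c.2 _ hx, (hU (x₀, c.1) hx₀ c.2 _ hx).2.2.1⟩
      have hUs : ContDiffAt ℝ ∞ (fun x => U (x₀, c.1) (x, w.1)) x₀ :=
        ContDiffAt.comp x₀ (g := U (x₀, c.1)) hUw.2.1 (by fun_prop)
      constructor
      · rintro ⟨h1, h2⟩
        refine ⟨hpt ▸ hUw.2.2.1.mul h1, ?_⟩
        exact (hUs.mul h2).congr_of_eventuallyEq (hnear.mono fun x hx => hx.1)
      · rintro ⟨h1, h2⟩
        have hinv : ∀ᶠ x in 𝓝 x₀, S (x, c.1) = Ring.inverse (U (x₀, c.1) (x, w.1)) * S (x, w.1) := by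
          filter_upwards [hnear] with x hx
          rw [hx.1, ← mul_assoc, Ring.inverse_mul_cancel _ hx.2, one_mul]
        refine ⟨?_, ?_⟩
        · rw [hinv.self_of_nhds]
          exact hUw.2.2.1.ringInverse.mul h1
        · obtain ⟨u, hu⟩ := hUw.2.2.1
          have h3 := contDiffAt_ringInverse ℝ (n := ∞) u
          rw [hu] at h3
          exact ((h3.comp x₀ (f := fun x => U (x₀, c.1) (x, w.1)) hUs).mul h2).congr_of_eventuallyEq hinv
    · rw [hS, hZ1 x₀ hx₀]
      exact isUnit_one
    · refine (contDiffAt_const (c := (1 : 𝔸))).congr_of_eventuallyEq ?_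
      filter_upwards [hV.mem_nhds hx₀] with x hx
      rw [hS, hZ1 x hx]
  have hsmooth : ∀ p : E × 𝕜, p.1 ∈ V → p.2 ∈ 𝓘 → ContDiffAt ℝ ∞ S p := by
    rintro ⟨x₀, c⟩ hx₀ hc
    have hUc := hU (x₀, c) hx₀ hc _ (Metric.mem_ball_self (hε (x₀, c) hx₀ hc))
    have h1 : ContDiffAt ℝ ∞ (fun z : E × 𝕜 => S (z.1, c)) (x₀, c) :=
      ContDiffAt.comp (x₀, c) (g := fun x => S (x, c)) (f := Prod.fst)
        (hprop x₀ hx₀ ⟨c, hc⟩).2 contDiffAt_fst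
    refine (hUc.2.1.mul h1).congr_of_eventuallyEq ?_
    filter_upwards [Metric.ball_mem_nhds _ (hε (x₀, c) hx₀ hc)] with z hz
    exact hcomp x₀ hx₀ c hc z hz
  refine ⟨S, fun x hx => by rw [hS, hZ1 x hx], fun p h1 h2 =>
    ⟨hsmooth p h1 h2, (hprop p.1 h1 ⟨p.2, h2⟩).1, fun a => ?_⟩⟩
  have h3 : HasFDerivAt S (fderiv ℝ S p) (p.1, p.2) :=
    ((hsmooth p h1 h2).differentiableAt (by simp)).hasFDerivAt
  have h4 := h3.comp p.2 (hasFDerivAt_prodMk_right (𝕜 := ℝ) p.1 p.2)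
  have h5 := (hslice p.1 h1 p.2 h2).2 a
  have h6 : fderiv ℝ (fun w => S (p.1, w)) p.2 = _ := h4.fderiv
  rw [h6] at h5
  exact h5

end GlobalSolution

end SuperZCR
end

noncomputable section
set_option linter.unusedSectionVars false

namespace SuperZCR

open scoped ContDiff Topology TensorProduct unitInterval
open TopologicalSpace (Opens)
open NormedSpace (exp)

/-! ### The exponential and Lie subalgebras given as kernels -/

section Exponential

variable {𝔸 : Type} [NormedRing 𝔸] [NormedAlgebra ℂ 𝔸] [CompleteSpace 𝔸]

theorem contDiff_exp {n : WithTop ℕ∞} : ContDiff ℝ n (exp : 𝔸 → 𝔸) :=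
  contDiff_iff_contDiffAt.2 fun x => (NormedSpace.exp_analytic (𝕂 := ℝ) x).contDiffAt

theorem exp_neg_mul_exp (x : 𝔸) : exp (-x) * exp x = 1 := by
  let _ : NormedAlgebra ℚ 𝔸 := NormedAlgebra.restrictScalars ℚ ℂ 𝔸
  rw [← NormedSpace.exp_add_of_commute (Commute.refl x).neg_left, neg_add_cancel,
    NormedSpace.exp_zero]

theorem exp_mul_exp_neg (x : 𝔸) : exp x * exp (-x) = 1 := by
  simpa using exp_neg_mul_exp (-x)

theorem isUnit_exp (x : 𝔸) : IsUnit (exp x) :=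
  ⟨⟨exp x, exp (-x), exp_mul_exp_neg x, exp_neg_mul_exp x⟩, rfl⟩

/-- Each term of the exponential series stays in the kernel, and `π` is continuous. -/
theorem exp_apply_mem_ker {F : Type} [NormedAddCommGroup F] [NormedSpace ℝ F] [CompleteSpace F]
    (π A : F →L[ℝ] F) (hA : ∀ Y, π Y = 0 → π (A Y) = 0) {Y : F} (hY : π Y = 0) :
    π (exp A Y) = 0 := by
  have h1 := NormedSpace.exp_series_hasSum_exp' (𝕂 := ℝ) A
  have h2 := h1.mapL (π.comp (ContinuousLinearMap.apply ℝ F Y))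
  have h3 : ∀ n : ℕ, π ((A ^ n) Y) = 0 := by
    intro n
    induction n with
    | zero => simpa using hY
    | succ n ih => rw [pow_succ']; exact hA _ ih
  have h4 : (fun n : ℕ => (π.comp (ContinuousLinearMap.apply ℝ F Y))
      (((n.factorial : ℝ)⁻¹) • A ^ n)) = fun _ => 0 := by
    funext n
    have e : (π.comp (ContinuousLinearMap.apply ℝ F Y)) (((n.factorial : ℝ)⁻¹) • A ^ n) =
        π (((n.factorial : ℝ)⁻¹) • (A ^ n) Y) := rfl
    rw [e, map_smul, h3, smul_zero]
  rw [h4] at h2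
  exact h2.unique hasSum_zero

/-- A real subspace, given as the kernel of an operator, is closed under the commutator. -/
def KerIsLie (π : 𝔸 →L[ℝ] 𝔸) : Prop :=
  ∀ X Y, π X = 0 → π Y = 0 → π (X * Y - Y * X) = 0

theorem hasDerivAt_exp_line (X : 𝔸) (t : ℝ) :
    HasDerivAt (fun u : ℝ => exp (u • X)) (exp (t • X) * X) t :=
  hasDerivAt_exp_smul_const (𝕂 := ℝ) X t

theorem hasDerivAt_exp_line' (X : 𝔸) (t : ℝ) :
    HasDerivAt (fun u : ℝ => exp (u • X)) (X * exp (t • X)) t :=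
  hasDerivAt_exp_smul_const' (𝕂 := ℝ) X t

/-- Conjugation by `exp X` is the exponential of the operator `A = ad X`, because `exp (-tX) (exp
(tA) Y) exp (tX)` has zero derivative in `t`. The operator `A` preserves `ker π` by the Lie
property. -/
theorem KerIsLie.exp_conj {π : 𝔸 →L[ℝ] 𝔸} (h : KerIsLie π) {X Y : 𝔸} (hX : π X = 0)
    (hY : π Y = 0) : π (exp X * Y * exp (-X)) = 0 := by
  let A : 𝔸 →L[ℝ] 𝔸 := ContinuousLinearMap.mul ℝ 𝔸 X - (ContinuousLinearMap.mul ℝ 𝔸).flip X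
  have hA : ∀ Z, A Z = X * Z - Z * X := fun Z => by simp [A]
  let f : ℝ → 𝔸 := fun t => exp (t • (-X)) * exp (t • A) Y * exp (t • X)
  have hf : ∀ t, HasDerivAt f 0 t := by
    intro t
    have h1 : HasDerivAt (fun u : ℝ => exp (u • A) Y) (A (exp (t • A) Y)) t := by
      have := (ContinuousLinearMap.apply ℝ 𝔸 Y).hasFDerivAt.comp_hasDerivAt t
        (hasDerivAt_exp_smul_const' (𝕂 := ℝ) A t)
      exact this
    refine (((hasDerivAt_exp_line (-X) t).mul h1).mul (hasDerivAt_exp_line' X t)).congr_deriv ?_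
    simp only [Pi.mul_apply, hA]
    generalize exp (t • -X) = a
    noncomm_ring
  have hc : f 1 = f 0 := is_const_of_deriv_eq_zero (fun t => (hf t).differentiableAt)
    (fun t => (hf t).deriv) 1 0
  have h0 : f 0 = Y := by
    have e0 : (0 : ℝ) • A = 0 := by
      ext Z
      exact zero_smul ℝ (A Z)
    have e : exp ((0 : ℝ) • A) = 1 := by rw [e0, NormedSpace.exp_zero]
    simp [f, e, NormedSpace.exp_zero]
  have h1 : f 1 = exp (-X) * exp A Y * exp X := by simp [f]
  rw [h0, h1] at hc
  have key : exp X * (exp (-X) * exp A Y * exp X) * exp (-X) = exp A Y := by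
    simp only [← mul_assoc, exp_mul_exp_neg, one_mul]
    rw [mul_assoc, exp_mul_exp_neg, mul_one]
  rw [hc] at key
  rw [key]
  exact exp_apply_mem_ker π A (fun Z hZ => by rw [hA]; exact h X Z hX hZ) hY

/-- Duhamel's formula: integrate the derivative of `exp (sA) exp ((1 - s)B)` over the unit interval.
-/
theorem exp_sub_exp (A B : 𝔸) :
    exp A - exp B = ∫ s in (0 : ℝ)..1, exp (s • A) * (A - B) * exp ((1 - s) • B) := by
  have hd : ∀ s : ℝ, HasDerivAt (fun s : ℝ => exp (s • A) * exp ((1 - s) • B))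
      (exp (s • A) * (A - B) * exp ((1 - s) • B)) s := by
    intro s
    have h1 : HasDerivAt (fun s : ℝ => exp ((1 - s) • B)) (-(B * exp ((1 - s) • B))) s := by
      have := (hasDerivAt_exp_line' B (1 - s)).scomp s ((hasDerivAt_id s).const_sub 1)
      exact this.congr_deriv (by simp)
    refine ((hasDerivAt_exp_line A s).mul h1).congr_deriv ?_
    noncomm_ring
  have hcont : Continuous fun s : ℝ => exp (s • A) * (A - B) * exp ((1 - s) • B) := by
    have h1 := (contDiff_exp (𝔸 := 𝔸) (n := 0)).continuous
    fun_prop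
  rw [intervalIntegral.integral_eq_sub_of_hasDerivAt (fun s _ => hd s)
    (hcont.intervalIntegrable _ _)]
  simp [NormedSpace.exp_zero]

/-- By Duhamel's formula the difference quotient along `X + tB` is exactly a parametric integral `G
t`, and `G` is continuous at `0`. -/
theorem fderiv_exp (X B : 𝔸) :
    fderiv ℝ exp X B = ∫ s in (0 : ℝ)..1, exp (s • X) * B * exp ((1 - s) • X) := by
  have hexp := (contDiff_exp (𝔸 := 𝔸) (n := 0)).continuous
  let G : ℝ → 𝔸 := fun h => ∫ s in (0 : ℝ)..1, exp (s • (X + h • B)) * B * exp ((1 - s) • X)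
  have hG : Continuous G := by
    refine intervalIntegral.continuous_parametric_intervalIntegral_of_continuous' ?_ 0 1
    unfold Function.uncurry
    fun_prop
  have hline : HasDerivAt (fun t : ℝ => X + t • B) B 0 := by
    simpa using ((hasDerivAt_id (0 : ℝ)).smul_const B).const_add X
  have h1 : HasDerivAt (fun t : ℝ => exp (X + t • B)) (fderiv ℝ exp X B) 0 := by
    have h : HasFDerivAt (exp : 𝔸 → 𝔸) (fderiv ℝ exp X) (X + (0 : ℝ) • B) := by
      simpa using ((contDiff_exp (𝔸 := 𝔸) (n := 1)).differentiable (by simp) X).hasFDerivAt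
    exact h.comp_hasDerivAt (0 : ℝ) hline
  have h2 : HasDerivAt (fun t : ℝ => exp (X + t • B)) (G 0) 0 := by
    rw [hasDerivAt_iff_tendsto_slope]
    refine (hG.tendsto 0).mono_left nhdsWithin_le_nhds |>.congr' ?_
    filter_upwards [self_mem_nhdsWithin] with t ht
    have ht' : t ≠ 0 := ht
    rw [slope_def_module, zero_smul, add_zero, exp_sub_exp, sub_zero]
    simp only [add_sub_cancel_left, mul_smul_comm, smul_mul_assoc, intervalIntegral.integral_smul]
    rw [smul_smul, inv_mul_cancel₀ ht', one_smul]
  have := h1.unique h2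
  simpa [G] using this

/-- Multiplication by `exp (-X)` turns the integrand for the differential of `exp` into `exp (sX) B
exp (-sX)`, a conjugate of an element of the Lie algebra. -/
theorem KerIsLie.fderiv_exp_mul {π : 𝔸 →L[ℝ] 𝔸} (h : KerIsLie π) {X B : 𝔸} (hX : π X = 0)
    (hB : π B = 0) : π (fderiv ℝ exp X B * exp (-X)) = 0 := by
  have hexp := (contDiff_exp (𝔸 := 𝔸) (n := 0)).continuous
  have hcont : Continuous fun s : ℝ => exp (s • X) * B * exp ((1 - s) • X) := by fun_prop
  have h1 := (π.comp ((ContinuousLinearMap.mul ℝ 𝔸).flip (exp (-X)))).intervalIntegral_comp_comm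
    (hcont.intervalIntegrable (μ := MeasureTheory.volume) 0 1)
  rw [← fderiv_exp] at h1
  have h2 : ∀ s : ℝ, (π.comp ((ContinuousLinearMap.mul ℝ 𝔸).flip (exp (-X))))
      (exp (s • X) * B * exp ((1 - s) • X)) = 0 := by
    intro s
    let _ : NormedAlgebra ℚ 𝔸 := NormedAlgebra.restrictScalars ℚ ℂ 𝔸
    have e : exp ((1 - s) • X) * exp (-X) = exp (-(s • X)) := by
      rw [← NormedSpace.exp_add_of_commute (((Commute.refl X).smul_left _).neg_right)]
      congr 1
      module
    have := h.exp_conj (X := s • X) (Y := B) (by simp [hX]) hB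
    simpa [mul_assoc, e] using this
  simp only [h2, intervalIntegral.integral_zero] at h1
  simpa using h1.symm

theorem KerIsLie.mul_fderiv_exp {π : 𝔸 →L[ℝ] 𝔸} (h : KerIsLie π) {X B : 𝔸} (hX : π X = 0)
    (hB : π B = 0) : π (exp (-X) * fderiv ℝ exp X B) = 0 := by
  have := h.exp_conj (X := -X) (by simp [hX]) (h.fderiv_exp_mul hX hB)
  rw [neg_neg, mul_assoc, mul_assoc, exp_neg_mul_exp, mul_one] at this
  exact this

end Exponential

section Chart

variable {𝔸 : Type} [NormedRing 𝔸] [NormedAlgebra ℂ 𝔸] [CompleteSpace 𝔸]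

/-- Near `1`, each element is uniquely `exp (p₀ Y) exp (p₁ Y) (1 + π Y)`, with `Y` smooth. -/
theorem exists_exp_chart (p₀ p₁ π : 𝔸 →L[ℝ] 𝔸) (hsum : ∀ Y, p₀ Y + p₁ Y + π Y = Y) :
    ∃ Ψ : 𝔸 → 𝔸, Ψ 1 = 0 ∧ ∀ᶠ w in 𝓝 (1 : 𝔸), ContDiffAt ℝ ∞ Ψ w ∧
      exp (p₀ (Ψ w)) * exp (p₁ (Ψ w)) * (1 + π (Ψ w)) = w := by
  let Φ : 𝔸 → 𝔸 := fun Y => exp (p₀ Y) * exp (p₁ Y) * (1 + π Y)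
  -- Analyticity is used because it holds on a neighbourhood once it holds at a point; being `C^∞`
  -- at one point would not provide a common neighbourhood for all orders of the inverse.
  have hΦ : ContDiff ℝ ω Φ :=
    ((contDiff_exp.comp p₀.contDiff).mul (contDiff_exp.comp p₁.contDiff)).mul
      (contDiff_const.add π.contDiff)
  have hΦ0 : Φ 0 = 1 := by simp [Φ, NormedSpace.exp_zero]
  have hexp0 : ∀ p : 𝔸 →L[ℝ] 𝔸, HasFDerivAt (fun Y => exp (p Y)) p 0 := by
    intro p
    have h : HasFDerivAt (exp : 𝔸 → 𝔸) (1 : 𝔸 →L[ℝ] 𝔸) (p 0) := by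
      rw [map_zero]
      exact hasFDerivAt_exp_zero
    exact h.comp 0 p.hasFDerivAt
  have hd : HasFDerivAt Φ ((ContinuousLinearEquiv.refl ℝ 𝔸 : 𝔸 ≃L[ℝ] 𝔸) : 𝔸 →L[ℝ] 𝔸) 0 := by
    refine (((hexp0 p₀).mul' (hexp0 p₁)).mul' (π.hasFDerivAt.const_add 1)).congr_fderiv ?_
    ext Y
    simp only [map_zero, NormedSpace.exp_zero, add_zero]
    refine Eq.trans ?_ (hsum Y)
    simp
    abel
  have hC := hΦ.contDiffAt (x := 0)
  refine ⟨hC.localInverse hd (by simp), ?_, ?_⟩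
  · have := hC.localInverse_apply_image hd (by simp)
    rwa [hΦ0] at this
  · have h1 := hC.to_localInverse hd (by simp)
    rw [hΦ0] at h1
    have h2 := hC.hasStrictFDerivAt' hd (by simp) |>.eventually_right_inverse
    rw [hΦ0] at h2
    filter_upwards [h1.eventually (by simp), h2] with w hw hw'
    exact ⟨hw.of_le (by simp), hw'⟩

end Chart

end SuperZCR
end

noncomputable section
set_option linter.unusedSectionVars false

namespace SuperZCR

open scoped ContDiff Topology TensorProduct unitInterval
open TopologicalSpace (Opens)
open NormedSpace (exp)

/-! ### Solutions with coefficient in a Lie algebra stay in the group -/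

section Factorization

variable {E 𝕜 𝔸 : Type} [NormedAddCommGroup E] [NormedSpace ℝ E]
  [RCLike 𝕜] [NormedRing 𝔸] [NormedAlgebra ℂ 𝔸] [CompleteSpace 𝔸]

/-- A curve `exp (p₀ Y) exp (p₁ Y) (1 + π Y)` through `1` with logarithmic derivative in the
Lie subalgebra `ker π` has `π Y = 0`. -/
theorem chart_coord_eq_zero {p₀ p₁ π : 𝔸 →L[ℝ] 𝔸} (hLie : KerIsLie π)
    (h₀ : ∀ Y, π (p₀ Y) = 0) (h₁ : ∀ Y, π (p₁ Y) = 0) (hπ : ∀ Y, π (π Y) = π Y)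
    {y y' q : ℝ → 𝔸} (hy : ∀ s ∈ Set.Icc (0 : ℝ) 1, HasDerivAt y (y' s) s)
    (hy' : ContinuousOn y' (Set.Icc 0 1)) (hq : ContinuousOn q (Set.Icc 0 1))
    (hqπ : ∀ s ∈ Set.Icc (0 : ℝ) 1, π (q s) = 0)
    (hw : ∀ s ∈ Set.Icc (0 : ℝ) 1,
      HasDerivAt (fun s => exp (p₀ (y s)) * exp (p₁ (y s)) * (1 + π (y s)))
        (q s * (exp (p₀ (y s)) * exp (p₁ (y s)) * (1 + π (y s)))) s)
    (hy0 : y 0 = 0) : π (y 1) = 0 := by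
  have hexp := (contDiff_exp (𝔸 := 𝔸) (n := 0)).continuous
  have hfd : Continuous (fderiv ℝ (exp : 𝔸 → 𝔸)) :=
    (contDiff_exp (𝔸 := 𝔸) (n := 1)).continuous_fderiv (by simp)
  have hyc : ContinuousOn y (Set.Icc 0 1) := fun s hs => (hy s hs).continuousAt.continuousWithinAt
  have hexpd : ∀ p : 𝔸 →L[ℝ] 𝔸, ∀ s ∈ Set.Icc (0 : ℝ) 1,
      HasDerivAt (fun s => exp (p (y s))) (fderiv ℝ exp (p (y s)) (p (y' s))) s := by
    intro p s hs
    exact ((contDiff_exp (𝔸 := 𝔸) (n := 1)).differentiable (by simp) _).hasFDerivAt.comp_hasDerivAt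
      s (p.hasFDerivAt.comp_hasDerivAt s (hy s hs))
  -- Differentiate the product and solve `w' = q w` for the derivative of `π y`: the result is `π y'
  -- = R (1 + π y)`, where `R` consists of conjugates of `q` and of logarithmic derivatives of
  -- exponentials, all of them in `ker π`.
  let R : ℝ → 𝔸 := fun s =>
    exp (-p₁ (y s)) * (exp (-p₀ (y s)) * q s * exp (p₀ (y s))) * exp (p₁ (y s)) -
    exp (-p₁ (y s)) * (exp (-p₀ (y s)) * fderiv ℝ exp (p₀ (y s)) (p₀ (y' s))) * exp (p₁ (y s)) -
    exp (-p₁ (y s)) * fderiv ℝ exp (p₁ (y s)) (p₁ (y' s))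
  have hRπ : ∀ s ∈ Set.Icc (0 : ℝ) 1, π (R s) = 0 := by
    intro s hs
    have e1 := hLie.exp_conj (X := -p₀ (y s)) (by simp [h₀]) (hqπ s hs)
    have e2 := hLie.exp_conj (X := -p₁ (y s)) (by simp [h₁]) e1
    have e3 := hLie.mul_fderiv_exp (h₀ (y s)) (h₀ (y' s))
    have e4 := hLie.exp_conj (X := -p₁ (y s)) (by simp [h₁]) e3
    have e5 := hLie.mul_fderiv_exp (h₁ (y s)) (h₁ (y' s))
    rw [neg_neg] at e1 e2 e4
    rw [neg_neg] at e2
    simp only [R, map_sub, e2, e4, e5, sub_zero]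
  have hRc : ContinuousOn R (Set.Icc 0 1) := by
    have c1 : ∀ p : 𝔸 →L[ℝ] 𝔸, ContinuousOn (fun s => exp (p (y s))) (Set.Icc 0 1) := fun p =>
      hexp.comp_continuousOn (p.continuous.comp_continuousOn hyc)
    have c2 : ∀ p : 𝔸 →L[ℝ] 𝔸, ContinuousOn (fun s => exp (-p (y s))) (Set.Icc 0 1) := fun p =>
      hexp.comp_continuousOn (p.continuous.comp_continuousOn hyc).neg
    have c3 : ∀ p : 𝔸 →L[ℝ] 𝔸,
        ContinuousOn (fun s => fderiv ℝ exp (p (y s)) (p (y' s))) (Set.Icc 0 1) := fun p =>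
      (hfd.comp_continuousOn (p.continuous.comp_continuousOn hyc)).clm_apply
        (p.continuous.comp_continuousOn hy')
    exact ((((c2 p₁).mul (((c2 p₀).mul hq).mul (c1 p₀))).mul (c1 p₁)).sub
      (((c2 p₁).mul ((c2 p₀).mul (c3 p₀))).mul (c1 p₁))).sub ((c2 p₁).mul (c3 p₁))
  have hcd : ∀ s ∈ Set.Icc (0 : ℝ) 1,
      HasDerivAt (fun s => π (y s)) (π (R s * π (y s))) s := by
    intro s hs
    have d1 := π.hasFDerivAt.comp_hasDerivAt s (hy s hs)
    have d2 := ((hexpd p₀ s hs).mul (hexpd p₁ s hs)).mul (d1.const_add 1)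
    have d3 := d2.unique (hw s hs)
    have key : π (y' s) = R s * (1 + π (y s)) := by
      have i0 := exp_neg_mul_exp (p₀ (y s))
      have i1 := exp_neg_mul_exp (p₁ (y s))
      have i1' := exp_mul_exp_neg (p₁ (y s))
      have d4 := congrArg (fun z => exp (-p₁ (y s)) * (exp (-p₀ (y s)) * z)) d3
      simp only [R]
      simp only [Pi.mul_apply, Function.comp_apply] at d4
      set a := exp (p₀ (y s))
      set a' := exp (-p₀ (y s))
      set b := exp (p₁ (y s))
      set b' := exp (-p₁ (y s))
      set c := π (y s)
      set u := fderiv ℝ exp (p₀ (y s)) (p₀ (y' s))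
      set v := fderiv ℝ exp (p₁ (y s)) (p₁ (y' s))
      have f1 : b' * (a' * (a * b * π (y' s))) = π (y' s) := by
        rw [mul_assoc a, ← mul_assoc a', i0, one_mul, ← mul_assoc, i1, one_mul]
      have f2 : b' * (a' * ((u * b + a * v) * (1 + c))) =
          (b' * (a' * u) * b + b' * v) * (1 + c) := by
        have : b' * (a' * (a * v * (1 + c))) = b' * v * (1 + c) := by
          rw [mul_assoc a, ← mul_assoc a', i0, one_mul, mul_assoc]
        rw [add_mul, mul_add, mul_add, this]
        noncomm_ring
      rw [mul_add, mul_add, f1, f2] at d4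
      rw [eq_sub_of_add_eq' d4]
      noncomm_ring
    refine d1.congr_deriv ?_
    -- The map `π` is idempotent, so it may be applied once more; this kills the inhomogeneous term
    -- `R` and leaves `c' = π (R c)` for `c = π y`.
    have e : π (y' s) = π (π (y' s)) := by
      have := ((π.hasFDerivAt (x := π (y s))).comp_hasDerivAt s d1).unique
        (d1.congr_of_eventuallyEq (Filter.Eventually.of_forall fun t => hπ (y t)))
      exact this.symm
    rw [e, key, mul_add, mul_one, map_add, hRπ s hs, zero_add]
  -- Gronwall's inequality with zero initial value and zero inhomogeneity forces `c = 0`.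
  obtain ⟨M, hM⟩ := isCompact_Icc.exists_bound_of_continuousOn hRc
  have hg := norm_le_gronwallBound_of_norm_deriv_right_le (f := fun s => π (y s))
    (f' := fun s => π (R s * π (y s))) (δ := 0) (K := ‖π‖ * M) (ε := 0) (a := 0) (b := 1)
    (fun s hs => (hcd s hs).continuousAt.continuousWithinAt)
    (fun s hs => (hcd s ⟨hs.1, hs.2.le⟩).hasDerivWithinAt) (by simp [hy0]) (fun s hs => by
      rw [add_zero, mul_assoc]
      refine (π.le_opNorm _).trans (mul_le_mul_of_nonneg_left ?_ (norm_nonneg π))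
      exact (norm_mul_le _ _).trans
        (mul_le_mul_of_nonneg_right (hM s ⟨hs.1, hs.2.le⟩) (norm_nonneg _))) 1 (by simp)
  rw [gronwallBound_ε0_δ0] at hg
  exact norm_le_zero_iff.1 hg

/-- A solution of `∂S/∂w = Q S` with `Q` in a Lie algebra `ker π` differs, near each point, from
its slice over the point by a product of two exponentials of smooth functions. -/
theorem exists_exp_factorization {p₀ p₁ π : 𝔸 →L[ℝ] 𝔸} (hLie : KerIsLie π)
    (hsum : ∀ Y, p₀ Y + p₁ Y + π Y = Y)
    (h₀ : ∀ Y, π (p₀ Y) = 0) (h₁ : ∀ Y, π (p₁ Y) = 0) (hπ : ∀ Y, π (π Y) = π Y)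
    {Q S : E × 𝕜 → 𝔸} {z₀ : E × 𝕜} (hQ : ∀ᶠ p in 𝓝 z₀, ContinuousAt Q p)
    (hQπ : ∀ᶠ p in 𝓝 z₀, ∀ a : ℂ, π (a • Q p) = 0)
    (hS : ∀ᶠ p in 𝓝 z₀, ContDiffAt ℝ ∞ S p ∧ IsUnit (S p) ∧
      ∀ a, fderiv ℝ S p (0, a) = RCLike.map 𝕜 ℂ a • (Q p * S p)) :
    ∃ Y : E × 𝕜 → 𝔸, ∀ᶠ p in 𝓝 z₀, ContDiffAt ℝ ∞ Y p ∧
      S p = exp (p₀ (Y p)) * exp (p₁ (Y p)) * S (p.1, z₀.2) := by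
  obtain ⟨Ψ, hΨ0, hΨ⟩ := exists_exp_chart p₀ p₁ π hsum
  obtain ⟨ε, hε, hball⟩ := Metric.eventually_nhds_iff_ball.1 (hQ.and (hQπ.and hS))
  have hray0 : ∀ p : E × 𝕜, ray z₀.2 (p, 0) = (p.1, z₀.2) := fun p => by simp [ray]
  have hray1 : ∀ p : E × 𝕜, ray z₀.2 (p, 1) = p := fun p => by simp [ray]
  have hbase : ∀ p ∈ Metric.ball z₀ ε, ((p.1, z₀.2) : E × 𝕜) ∈ Metric.ball z₀ ε := by
    intro p hp
    have := mem_ball_ray hp (s := 0) le_rfl zero_le_one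
    rwa [hray0] at this
  -- Dividing by the slice over the base parameter keeps the equation `∂W = Q W`, since that slice
  -- is constant along the segment, and makes every segment start at `1`, the centre of the chart.
  let W : E × 𝕜 → 𝔸 := fun p => S p * Ring.inverse (S (p.1, z₀.2))
  have hWd : ∀ p ∈ Metric.ball z₀ ε, ContDiffAt ℝ ∞ W p := by
    intro p hp
    obtain ⟨u, hu⟩ := (hball _ (hbase p hp)).2.2.2.1
    have h3 := contDiffAt_ringInverse ℝ (n := ∞) u
    rw [hu] at h3
    have h4 : ContDiffAt ℝ ∞ (fun p : E × 𝕜 => S (p.1, z₀.2)) p :=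
      ContDiffAt.comp p (g := S) (f := fun p : E × 𝕜 => (p.1, z₀.2)) (hball _ (hbase p hp)).2.2.1
        (by fun_prop)
    exact (hball p hp).2.2.1.mul (h3.comp p (f := fun p : E × 𝕜 => S (p.1, z₀.2)) h4)
  have hW1 : ∀ p ∈ Metric.ball z₀ ε, W (p.1, z₀.2) = 1 := fun p hp =>
    Ring.mul_inverse_cancel _ (hball _ (hbase p hp)).2.2.2.1
  have hW0 : W z₀ = 1 := hW1 z₀ (Metric.mem_ball_self hε)
  have hev : ∀ᶠ p in 𝓝 z₀, ContDiffAt ℝ ∞ Ψ (W p) ∧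
      exp (p₀ (Ψ (W p))) * exp (p₁ (Ψ (W p))) * (1 + π (Ψ (W p))) = W p := by
    have := (hWd z₀ (Metric.mem_ball_self hε)).continuousAt
    rw [ContinuousAt, hW0] at this
    exact this.eventually hΨ
  obtain ⟨δ, hδ, hδball⟩ := Metric.eventually_nhds_iff_ball.1
    (hev.and (Metric.ball_mem_nhds z₀ hε))
  refine ⟨fun p => Ψ (W p), ?_⟩
  have hYd : ∀ p ∈ Metric.ball z₀ δ, ContDiffAt ℝ ∞ (fun p => Ψ (W p)) p := fun p hp =>
    (hδball p hp).1.1.comp p (hWd p (hδball p hp).2)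
  filter_upwards [Metric.ball_mem_nhds z₀ hδ] with p hp
  refine ⟨hYd p hp, ?_⟩
  have hin : ∀ s ∈ Set.Icc (0 : ℝ) 1, ray z₀.2 (p, s) ∈ Metric.ball z₀ δ := fun s hs =>
    mem_ball_ray hp hs.1 hs.2
  have hrayd : ∀ s : ℝ, HasDerivAt (fun s => ray z₀.2 (p, s)) ((0, p.2 - z₀.2) : E × 𝕜) s := by
    intro s
    have : HasDerivAt (fun t : ℝ => ((p.1, z₀.2 + t • (p.2 - z₀.2)) : E × 𝕜)) (0, p.2 - z₀.2) s := by
      refine (hasDerivAt_const _ _).prodMk ?_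
      simpa using ((hasDerivAt_id (s : ℝ)).smul_const (p.2 - z₀.2)).const_add z₀.2
    exact this
  have hrayc : Continuous fun s : ℝ => ray z₀.2 (p, s) :=
    (contDiff_ray z₀.2).continuous.comp (by fun_prop)
  have hzero : π (Ψ (W (ray z₀.2 (p, 1)))) = 0 := by
    refine chart_coord_eq_zero hLie h₀ h₁ hπ
      (y := fun s => Ψ (W (ray z₀.2 (p, s))))
      (y' := fun s => fderiv ℝ (fun p => Ψ (W p)) (ray z₀.2 (p, s)) (0, p.2 - z₀.2))
      (q := fun s => RCLike.map 𝕜 ℂ (p.2 - z₀.2) • Q (ray z₀.2 (p, s)))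
      (fun s hs => ?_) (fun s hs => ?_) (fun s hs => ?_) (fun s hs => ?_) (fun s hs => ?_) ?_
    · exact ((hYd _ (hin s hs)).differentiableAt (by simp)).hasFDerivAt.comp_hasDerivAt s (hrayd s)
    · refine ContinuousAt.continuousWithinAt (ContinuousAt.clm_apply ?_ continuousAt_const)
      exact ContinuousAt.comp (g := fderiv ℝ (fun p => Ψ (W p)))
        (((hYd _ (hin s hs)).fderiv_right (m := 0) (by simp)).continuousAt) hrayc.continuousAt
    · refine ContinuousAt.continuousWithinAt (ContinuousAt.const_smul ?_ _)
      exact ContinuousAt.comp (g := Q) (hball _ (hδball _ (hin s hs)).2).1 hrayc.continuousAt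
    · exact (hball _ (hδball _ (hin s hs)).2).2.1 _
    · have hWray : HasDerivAt (fun s => W (ray z₀.2 (p, s)))
          (RCLike.map 𝕜 ℂ (p.2 - z₀.2) • Q (ray z₀.2 (p, s)) * W (ray z₀.2 (p, s))) s := by
        have hb := hball _ (hδball _ (hin s hs)).2
        have h1 := (hb.2.2.1.differentiableAt (by simp)).hasFDerivAt.comp_hasDerivAt s (hrayd s)
        rw [hb.2.2.2.2] at h1
        have h2 := h1.mul_const (Ring.inverse (S (p.1, z₀.2)))
        refine h2.congr_deriv ?_
        simp only [W, smul_mul_assoc, mul_assoc]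
        rfl
      have hnear : ∀ᶠ t in 𝓝 s, ray z₀.2 (p, t) ∈ Metric.ball z₀ δ :=
        hrayc.continuousAt.eventually_mem (Metric.isOpen_ball.mem_nhds (hin s hs))
      have h3 := hWray.congr_of_eventuallyEq (f₁ := fun t => exp (p₀ (Ψ (W (ray z₀.2 (p, t))))) *
        exp (p₁ (Ψ (W (ray z₀.2 (p, t))))) * (1 + π (Ψ (W (ray z₀.2 (p, t))))))
        (hnear.mono fun t ht => (hδball _ ht).1.2)
      rwa [← (hδball _ (hin s hs)).1.2] at h3
    · simp only [hray0]
      rw [hW1 p (hδball p hp).2, hΨ0]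
  rw [hray1] at hzero
  have h1 := (hδball p hp).1.2
  rw [hzero, add_zero, mul_one] at h1
  rw [h1]
  simp only [W]
  rw [mul_assoc, Ring.inverse_mul_cancel _ (hball _ (hbase p (hδball p hp).2)).2.2.2.1, mul_one]

end Factorization

end SuperZCR
end

noncomputable section
set_option linter.unusedSectionVars false

namespace SuperZCR

open scoped ContDiff Topology TensorProduct
open TopologicalSpace (Opens)

/-! ### Supercommutative algebras and Grassmann algebras -/

section SuperAlgebra

variable {R : Type} [Ring R] [Algebra ℂ R]

/-- The algebra is supercommutative with respect to the parity automorphism `σ`. -/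
def SuperComm (σ : R →ₐ[ℂ] R) : Prop :=
  (∀ x, σ (σ x) = x) ∧
  ∀ x y, (x + σ x) * y = y * (x + σ x) ∧ (x - σ x) * y = σ y * (x - σ x)

theorem SuperComm.even_mul {σ : R →ₐ[ℂ] R} (h : SuperComm σ) {x : R} (hx : σ x = x) (y : R) :
    x * y = y * x := by
  have := (h.2 x y).1
  rw [hx, ← two_smul ℂ x, smul_mul_assoc, mul_smul_comm] at this
  exact smul_right_injective R (two_ne_zero (α := ℂ)) this

theorem SuperComm.odd_mul {σ : R →ₐ[ℂ] R} (h : SuperComm σ) {x : R} (hx : σ x = -x) (y : R) :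
    x * y = σ y * x := by
  have := (h.2 x y).2
  rw [hx, sub_neg_eq_add, ← two_smul ℂ x, smul_mul_assoc, mul_smul_comm] at this
  exact smul_right_injective R (two_ne_zero (α := ℂ)) this

end SuperAlgebra

section Grassmann

variable {o : Type}

theorem grassmann_ι_mul (v : o →₀ ℂ) (z : Grassmann o) :
    ExteriorAlgebra.ι ℂ v * z = CliffordAlgebra.involute z * ExteriorAlgebra.ι ℂ v := by
  induction z using CliffordAlgebra.induction with
  | algebraMap r => rw [AlgHom.commutes, Algebra.commutes]
  | ι w =>
    rw [CliffordAlgebra.involute_ι, neg_mul, eq_neg_iff_add_eq_zero]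
    exact ExteriorAlgebra.ι_add_mul_swap v w
  | mul a b ha hb => rw [← mul_assoc, ha, mul_assoc, hb, map_mul, mul_assoc]
  | add a b ha hb => rw [mul_add, ha, hb, map_add, add_mul]

/-- The elements `x ± σ x` are twice the even and the odd part of `x`. Left multiplication by a
generator exchanges the two, so each of the two commutation rules yields the other in the induction.
-/
theorem superComm_grassmann :
    SuperComm (CliffordAlgebra.involute : Grassmann o →ₐ[ℂ] Grassmann o) := by
  refine ⟨CliffordAlgebra.involute_involute, fun x => ?_⟩
  induction x using CliffordAlgebra.left_induction with
  | algebraMap r =>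
    intro y
    rw [AlgHom.commutes]
    constructor
    · rw [← map_add, Algebra.commutes]
    · simp
  | add a b ha hb =>
    intro y
    constructor
    · rw [map_add, add_add_add_comm, add_mul, mul_add, (ha y).1, (hb y).1]
    · rw [map_add, add_sub_add_comm, add_mul, mul_add, (ha y).2, (hb y).2]
  | ι_mul x v hx =>
    intro y
    have hz := grassmann_ι_mul v (CliffordAlgebra.involute y)
    rw [CliffordAlgebra.involute_involute] at hz
    have hz' : CliffordAlgebra.ι 0 v * y = CliffordAlgebra.involute y * CliffordAlgebra.ι 0 v :=
      grassmann_ι_mul v y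
    have hz'' : CliffordAlgebra.ι 0 v * CliffordAlgebra.involute y = y * CliffordAlgebra.ι 0 v := hz
    rw [map_mul, CliffordAlgebra.involute_ι, neg_mul, ← sub_eq_add_neg, sub_neg_eq_add,
      ← mul_sub, ← mul_add]
    constructor
    · rw [mul_assoc, (hx y).2, ← mul_assoc, hz'', mul_assoc]
    · rw [mul_assoc, (hx y).1, ← mul_assoc, hz', mul_assoc]

/-- The homomorphism of Grassmann algebras induced by a map of the sets of generators. -/
def grassmannMap {o' : Type} (e : o' → o) : Grassmann o' →ₐ[ℂ] Grassmann o :=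
  ExteriorAlgebra.map (Finsupp.lmapDomain ℂ ℂ e)

theorem grassmannMap_involute {o' : Type} (e : o' → o) (x : Grassmann o') :
    grassmannMap e (CliffordAlgebra.involute x) = CliffordAlgebra.involute (grassmannMap e x) := by
  induction x using CliffordAlgebra.induction with
  | algebraMap r => simp only [AlgHom.commutes]
  | ι w =>
    have : ∀ w, grassmannMap e (CliffordAlgebra.ι 0 w) =
        CliffordAlgebra.ι 0 (Finsupp.lmapDomain ℂ ℂ e w) :=
      fun w => ExteriorAlgebra.map_apply_ι _ w
    rw [CliffordAlgebra.involute_ι, map_neg, this, CliffordAlgebra.involute_ι]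
  | mul a b ha hb => simp only [map_mul, ha, hb]
  | add a b ha hb => simp only [map_add, ha, hb]

/-- Each element of a Grassmann algebra involves finitely many generators. -/
theorem exists_finset_grassmann (x : Grassmann o) :
    ∃ T : Finset o, ∀ T', T ⊆ T' → x ∈ (grassmannMap ((↑) : T' → o)).range := by
  classical
  induction x using CliffordAlgebra.induction with
  | algebraMap r => exact ⟨∅, fun T' _ => Subalgebra.algebraMap_mem _ r⟩
  | ι w =>
    refine ⟨w.support, fun T' hT => ⟨ExteriorAlgebra.ι ℂ (Finsupp.comapDomain (↑) w
      Subtype.val_injective.injOn), ?_⟩⟩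
    refine (ExteriorAlgebra.map_apply_ι _ _).trans ?_
    change ExteriorAlgebra.ι ℂ _ = ExteriorAlgebra.ι ℂ _
    congr 1
    rw [Finsupp.lmapDomain_apply]
    refine Finsupp.mapDomain_comapDomain _ Subtype.val_injective w ?_
    intro a ha
    exact ⟨⟨a, hT ha⟩, rfl⟩
  | mul a b ha hb =>
    obtain ⟨T, hT⟩ := ha
    obtain ⟨T', hT'⟩ := hb
    exact ⟨T ∪ T', fun S hS => mul_mem (hT S (Finset.union_subset_left hS))
      (hT' S (Finset.union_subset_right hS))⟩
  | add a b ha hb =>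
    obtain ⟨T, hT⟩ := ha
    obtain ⟨T', hT'⟩ := hb
    exact ⟨T ∪ T', fun S hS => add_mem (hT S (Finset.union_subset_left hS))
      (hT' S (Finset.union_subset_right hS))⟩

/-- The degree zero part of an element of a Grassmann algebra. -/
def body : Grassmann o →ₐ[ℂ] ℂ := ExteriorAlgebra.algebraMapInv

theorem body_involute (x : Grassmann o) : body (CliffordAlgebra.involute x) = body x := by
  induction x using CliffordAlgebra.induction with
  | algebraMap r => simp only [AlgHom.commutes]
  | ι w =>
    have : ∀ w : o →₀ ℂ, body (CliffordAlgebra.ι 0 w) = 0 := fun w => by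
      change ExteriorAlgebra.algebraMapInv (ExteriorAlgebra.ι ℂ w) = 0
      simp [ExteriorAlgebra.algebraMapInv]
    rw [CliffordAlgebra.involute_ι, map_neg, this, neg_zero]
  | mul a b ha hb => simp only [map_mul, ha, hb]
  | add a b ha hb => simp only [map_add, ha, hb]

theorem grassmann_finiteDimensional [Finite o] : FiniteDimensional ℂ (Grassmann o) := by
  classical
  have := Fintype.ofFinite o
  let _ : LinearOrder o := LinearOrder.lift' (Fintype.equivFin o) (Fintype.equivFin o).injective
  exact (Module.Basis.ExteriorAlgebra (Finsupp.basisSingleOne (R := ℂ) (ι := o))).finiteDimensional_of_finite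

/-- A filtration of a finitely generated Grassmann algebra. -/
theorem exists_filtration [Finite o] : ∃ (F : ℕ → Submodule ℂ (Grassmann o)) (n : ℕ),
    (∀ x, body x = 0 → x ∈ F 1) ∧ (∀ k, ∀ x ∈ F k, ∀ y ∈ F 1, x * y ∈ F (k + 1)) ∧
    F (n + 1) = ⊥ := by
  classical
  have := Fintype.ofFinite o
  let _ : LinearOrder o := LinearOrder.lift' (Fintype.equivFin o) (Fintype.equivFin o).injective
  let b := Module.Basis.ExteriorAlgebra (Finsupp.basisSingleOne (R := ℂ) (ι := o))
  -- The term `F k` is spanned by the products of at least `k` distinct generators, so it is zero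
  -- beyond the number of generators.
  refine ⟨fun k => Submodule.span ℂ (b '' {s | k ≤ s.card}), Fintype.card o,
    fun x hx => ?_, fun k x hx y hy => ?_, ?_⟩
  · have hbody : ∀ s : Finset o, s.Nonempty → body (b s) = 0 := by
      intro s hs
      have hcard : s.card ≠ 0 := by simpa [Finset.card_eq_zero] using hs.ne_empty
      have : b s = ExteriorAlgebra.ιMulti_family ℂ s.card (Finsupp.basisSingleOne (R := ℂ) (ι := o))
          (Set.powersetCard.ofCard rfl) := ExteriorAlgebra.basis_apply_ofCard _ rfl
      rw [this]
      change body (ExteriorAlgebra.ιMulti ℂ _ _) = 0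
      rw [ExteriorAlgebra.ιMulti_apply, map_list_prod]
      refine List.prod_eq_zero ?_
      have : 0 < s.card := Nat.pos_of_ne_zero hcard
      rw [List.mem_map]
      refine ⟨_, List.mem_ofFn.2 ⟨⟨0, this⟩, rfl⟩, ?_⟩
      change ExteriorAlgebra.algebraMapInv (ExteriorAlgebra.ι ℂ _) = 0
      simp [ExteriorAlgebra.algebraMapInv]
    have hb0 : b ∅ = 1 := by
      have := ExteriorAlgebra.basis_apply_ofCard (Finsupp.basisSingleOne (R := ℂ) (ι := o))
        (s := ∅) (n := 0) rfl
      exact this.trans (by simp [ExteriorAlgebra.ιMulti_family])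
    rw [← b.sum_repr x]
    -- All basis products but the empty one have zero body, so the coefficient of the empty product
    -- is the body of `x`.
    have hx0 : b.repr x ∅ = 0 := by
      have h := congrArg body (b.sum_repr x)
      rw [map_sum, hx, Finset.sum_eq_single ∅] at h
      · simpa [hb0] using h
      · intro s _ hs
        rw [map_smul, hbody s (Finset.nonempty_iff_ne_empty.2 hs), smul_zero]
      · simp
    refine Submodule.sum_mem _ fun s _ => ?_
    by_cases hs : s = ∅
    · rw [hs, hx0, zero_smul]
      exact Submodule.zero_mem _
    · refine Submodule.smul_mem _ _ (Submodule.subset_span ⟨s, ?_, rfl⟩)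
      exact Finset.card_pos.2 (Finset.nonempty_iff_ne_empty.2 hs)
  · induction hx, hy using Submodule.span_induction₂ with
    | mem_mem x y hx hy =>
      obtain ⟨s, hs, rfl⟩ := hx
      obtain ⟨t, ht, rfl⟩ := hy
      by_cases hd : Disjoint s t
      · have := ExteriorAlgebra.basis_mul_of_disjoint (Finsupp.basisSingleOne (R := ℂ) (ι := o))
          (Set.powersetCard.ofCard (n := s.card) rfl) (Set.powersetCard.ofCard (n := t.card) rfl) hd
        have h2 : b s * b t = _ := this
        rw [h2]
        have hm : b (Set.powersetCard.disjUnion (s := Set.powersetCard.ofCard (n := s.card) rfl)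
            (t := Set.powersetCard.ofCard (n := t.card) rfl) hd) ∈
            Submodule.span ℂ (b '' {s | k + 1 ≤ s.card}) := by
          refine Submodule.subset_span ⟨_, ?_, rfl⟩
          have : ((Set.powersetCard.disjUnion (s := Set.powersetCard.ofCard (n := s.card) rfl)
            (t := Set.powersetCard.ofCard (n := t.card) rfl) hd : Set.powersetCard o _) : Finset o).card
              = s.card + t.card := (Set.powersetCard.disjUnion _).2
          refine Set.mem_ofPred_eq ▸ ?_
          rw [this]
          exact Nat.add_le_add hs ht
        rw [Units.smul_def]
        exact zsmul_mem hm _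
      · have := ExteriorAlgebra.basis_mul_of_not_disjoint (Finsupp.basisSingleOne (R := ℂ) (ι := o))
          (Set.powersetCard.ofCard (n := s.card) rfl) (Set.powersetCard.ofCard (n := t.card) rfl) hd
        have h2 : b s * b t = 0 := this
        rw [h2]
        exact Submodule.zero_mem _
    | zero_left y _ => rw [zero_mul]; exact Submodule.zero_mem _
    | zero_right x _ => rw [mul_zero]; exact Submodule.zero_mem _
    | add_left x y z _ _ _ h1 h2 => rw [add_mul]; exact Submodule.add_mem _ h1 h2
    | add_right x y z _ _ _ h1 h2 => rw [mul_add]; exact Submodule.add_mem _ h1 h2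
    | smul_left r x y _ _ h => rw [smul_mul_assoc]; exact Submodule.smul_mem _ _ h
    | smul_right r x y _ _ h => rw [mul_smul_comm]; exact Submodule.smul_mem _ _ h
  · rw [Submodule.span_eq_bot]
    rintro _ ⟨s, hs, rfl⟩
    have h1 : Fintype.card o + 1 ≤ s.card := hs
    have h2 := Finset.card_le_univ s
    omega

end Grassmann

end SuperZCR
end

noncomputable section
set_option linter.unusedSectionVars false

namespace SuperZCR

open scoped ContDiff Topology TensorProduct
open TopologicalSpace (Opens)

/-! ### Matrices over a superalgebra and even `𝔤`-matrices -/

section SuperMatrix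

variable {p q : ℕ} {R R' : Type} [Ring R] [Algebra ℂ R] [Ring R'] [Algebra ℂ R']

/-- Square matrices of format `p|q`. -/
abbrev SqMat (p q : ℕ) (R : Type) : Type := Matrix (Fin p ⊕ Fin q) (Fin p ⊕ Fin q) R

/-- The power `σ^{|j|}` of the parity automorphism. -/
def twist (σ : R →ₐ[ℂ] R) (j : Fin p ⊕ Fin q) : R →ₐ[ℂ] R :=
  Sum.elim (fun _ => AlgHom.id ℂ R) (fun _ => σ) j

/-- The matrix `A ⊗ μ` over a superalgebra. -/
def superTens (σ : R →ₐ[ℂ] R) (A : SqMat p q ℂ) (μ : R) : SqMat p q R :=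
  Matrix.of fun i j => A i j • twist σ j μ

/-- The parity automorphism of matrices over a superalgebra. -/
def superParity (σ : R →ₐ[ℂ] R) (M : SqMat p q R) : SqMat p q R :=
  Matrix.of fun i j => (idxSign i * idxSign j) • σ (M i j)

/-- The matrices with values in `𝔤` over a superalgebra. -/
def gSpan (σ : R →ₐ[ℂ] R) (g : MatrixLieSuperalgebra p q) : Submodule ℂ (SqMat p q R) :=
  Submodule.span ℂ {M | ∃ A ∈ g.carrier, ∃ μ : R, M = superTens σ A μ}

/-- The extension of a linear operator on `gl(p|q)` to matrices over a superalgebra. -/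
def superExtend (σ : R →ₐ[ℂ] R) (π : SqMat p q ℂ →ₗ[ℂ] SqMat p q ℂ) :
    SqMat p q R →ₗ[ℂ] SqMat p q R where
  toFun M := ∑ i, ∑ j, superTens σ (π (Matrix.single i j 1)) (twist σ j (M i j))
  map_add' M N := by
    simp only [← Finset.sum_add_distrib]
    refine Finset.sum_congr rfl fun i _ => Finset.sum_congr rfl fun j _ => ?_
    ext k l
    simp [superTens, smul_add]
  map_smul' c M := by
    simp only [Finset.smul_sum, RingHom.id_apply]
    refine Finset.sum_congr rfl fun i _ => Finset.sum_congr rfl fun j _ => ?_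
    ext k l
    simp [superTens, smul_comm c]

theorem idxSign_mul_self (i : Fin p ⊕ Fin q) : idxSign i * idxSign i = 1 := by
  cases i <;> simp [idxSign]

theorem superTens_smul_left (σ : R →ₐ[ℂ] R) (c : ℂ) (A : SqMat p q ℂ) (μ : R) :
    superTens σ (c • A) μ = c • superTens σ A μ := by
  ext; simp [superTens, mul_smul]

theorem superTens_smul_right (σ : R →ₐ[ℂ] R) (c : ℂ) (A : SqMat p q ℂ) (μ : R) :
    superTens σ A (c • μ) = c • superTens σ A μ := by
  ext; simp [superTens, smul_comm c]

theorem superTens_sum_left (σ : R →ₐ[ℂ] R) {ι : Type} (s : Finset ι) (A : ι → SqMat p q ℂ) (μ : R) :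
    superTens σ (∑ i ∈ s, A i) μ = ∑ i ∈ s, superTens σ (A i) μ := by
  ext k l; simp [superTens, Matrix.sum_apply, Finset.sum_smul]

theorem twist_twist {σ : R →ₐ[ℂ] R} (hσ : ∀ x, σ (σ x) = x) (j : Fin p ⊕ Fin q) (x : R) :
    twist σ j (twist σ j x) = x := by
  cases j <;> simp [twist, hσ]

theorem twist_comm (σ : R →ₐ[ℂ] R) (j : Fin p ⊕ Fin q) (x : R) :
    σ (twist σ j x) = twist σ j (σ x) := by
  cases j <;> simp [twist]

theorem superParity_add (σ : R →ₐ[ℂ] R) (M N : SqMat p q R) :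
    superParity σ (M + N) = superParity σ M + superParity σ N := by
  ext; simp [superParity, smul_add]

theorem superParity_sub (σ : R →ₐ[ℂ] R) (M N : SqMat p q R) :
    superParity σ (M - N) = superParity σ M - superParity σ N := by
  ext; simp [superParity, smul_sub]

theorem superParity_smul (σ : R →ₐ[ℂ] R) (c : ℂ) (M : SqMat p q R) :
    superParity σ (c • M) = c • superParity σ M := by
  ext; simp [superParity, smul_comm c]

theorem superParity_superParity {σ : R →ₐ[ℂ] R} (hσ : ∀ x, σ (σ x) = x) (M : SqMat p q R) :
    superParity σ (superParity σ M) = M := by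
  ext i j
  simp only [superParity, Matrix.of_apply, map_smul, hσ, smul_smul]
  rw [mul_mul_mul_comm, idxSign_mul_self, idxSign_mul_self, one_mul, one_smul]

theorem superParity_mul (σ : R →ₐ[ℂ] R) (M N : SqMat p q R) :
    superParity σ (M * N) = superParity σ M * superParity σ N := by
  ext i j
  simp only [superParity, Matrix.of_apply, Matrix.mul_apply, map_sum, map_mul, Finset.smul_sum]
  refine Finset.sum_congr rfl fun k _ => ?_
  rw [smul_mul_smul_comm]
  congr 1
  linear_combination -(idxSign i * idxSign j) * idxSign_mul_self k

theorem superParity_one (σ : R →ₐ[ℂ] R) : superParity σ (1 : SqMat p q R) = 1 := by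
  ext i j
  by_cases h : i = j
  · subst h
    simp [superParity, idxSign_mul_self]
  · simp [superParity, Matrix.one_apply_ne h]

theorem superParity_tens (σ : R →ₐ[ℂ] R) (A : SqMat p q ℂ) (μ : R) :
    superParity σ (superTens σ A μ) = superTens σ (constParity A) (σ μ) := by
  ext i j
  simp [superParity, superTens, constParity, twist_comm, smul_smul]

theorem constParity_eq (A : SqMat p q ℂ) : constParity A = superParity (AlgHom.id ℂ ℂ) A := by
  ext; simp [constParity, superParity]

theorem constParity_constParity (A : SqMat p q ℂ) : constParity (constParity A) = A := by
  simp only [constParity_eq]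
  exact superParity_superParity (fun _ => rfl) A

theorem superExtend_tens {σ : R →ₐ[ℂ] R} (hσ : ∀ x, σ (σ x) = x)
    (π : SqMat p q ℂ →ₗ[ℂ] SqMat p q ℂ) (A : SqMat p q ℂ) (μ : R) :
    superExtend σ π (superTens σ A μ) = superTens σ (π A) μ := by
  have hA : π A = ∑ i, ∑ j, A i j • π (Matrix.single i j 1) := by
    conv_lhs => rw [Matrix.matrix_eq_sum_single A]
    simp only [map_sum]
    refine Finset.sum_congr rfl fun i _ => Finset.sum_congr rfl fun j _ => ?_
    rw [← map_smul, Matrix.smul_single, smul_eq_mul, mul_one]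
  rw [hA, superTens_sum_left]
  simp only [superTens_sum_left, superExtend, LinearMap.coe_mk, AddHom.coe_mk]
  refine Finset.sum_congr rfl fun i _ => Finset.sum_congr rfl fun j _ => ?_
  have : twist σ j (superTens σ A μ i j) = A i j • μ := by
    simp [superTens, twist_twist hσ]
  rw [this, superTens_smul_right, superTens_smul_left]

theorem superExtend_mem (σ : R →ₐ[ℂ] R) {g : MatrixLieSuperalgebra p q}
    {π : SqMat p q ℂ →ₗ[ℂ] SqMat p q ℂ} (hπ : ∀ A, π A ∈ g.carrier) (M : SqMat p q R) :
    superExtend σ π M ∈ gSpan σ g := by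
  simp only [superExtend, LinearMap.coe_mk, AddHom.coe_mk]
  exact sum_mem fun i _ => sum_mem fun j _ => Submodule.subset_span ⟨_, hπ _, _, rfl⟩

/-- Together with `superExtend_mem` this makes the extension of a projection onto `𝔤` a projection
onto `gSpan σ g`. Membership becomes a fixed-point equation, which can be tested pointwise and on
germs. -/
theorem superExtend_of_mem {σ : R →ₐ[ℂ] R} (hσ : ∀ x, σ (σ x) = x) {g : MatrixLieSuperalgebra p q}
    {π : SqMat p q ℂ →ₗ[ℂ] SqMat p q ℂ} (hπ : ∀ A ∈ g.carrier, π A = A) {M : SqMat p q R}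
    (hM : M ∈ gSpan σ g) : superExtend σ π M = M := by
  induction hM using Submodule.span_induction with
  | mem M hM =>
    obtain ⟨A, hA, μ, rfl⟩ := hM
    rw [superExtend_tens hσ, hπ A hA]
  | zero => exact map_zero _
  | add M N _ _ hM hN => rw [map_add, hM, hN]
  | smul c M _ hM => rw [map_smul, hM]

/-- Applying the twist of column `j` to the entry cancels the twist built into `superTens`, as the
parity is an involution. -/
theorem sum_superTens_single {σ : R →ₐ[ℂ] R} (hσ : ∀ x, σ (σ x) = x) (M : SqMat p q R) :
    M = ∑ i, ∑ j, superTens σ (Matrix.single i j 1) (twist σ j (M i j)) := by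
  ext k l
  simp only [Matrix.sum_apply, superTens, Matrix.of_apply]
  rw [Finset.sum_eq_single k, Finset.sum_eq_single l]
  · simp [twist_twist hσ]
  · intro j _ hj
    simp [Matrix.single_apply_of_ne, hj]
  · simp
  · intro i _ hi
    refine Finset.sum_eq_zero fun j _ => ?_
    simp [Matrix.single_apply_of_ne, hi]
  · simp

theorem superExtend_parity {σ : R →ₐ[ℂ] R} (hσ : ∀ x, σ (σ x) = x)
    {π : SqMat p q ℂ →ₗ[ℂ] SqMat p q ℂ} (hπ : ∀ A, π (constParity A) = constParity (π A))
    (M : SqMat p q R) : superExtend σ π (superParity σ M) = superParity σ (superExtend σ π M) := by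
  let L : SqMat p q R →ₗ[ℂ] SqMat p q R :=
    { toFun := superParity σ, map_add' := superParity_add σ, map_smul' := superParity_smul σ }
  change (superExtend σ π ∘ₗ L) M = (L ∘ₗ superExtend σ π) M
  rw [sum_superTens_single hσ M]
  simp only [map_sum]
  refine Finset.sum_congr rfl fun i _ => Finset.sum_congr rfl fun j _ => ?_
  change superExtend σ π (superParity σ _) = superParity σ (superExtend σ π _)
  rw [superParity_tens, superExtend_tens hσ, superExtend_tens hσ, superParity_tens, hπ]

/-- Functoriality of the operators with respect to the coefficients. -/
theorem superTens_map {σ : R →ₐ[ℂ] R} {σ' : R' →ₐ[ℂ] R'} {f : R →ₐ[ℂ] R'}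
    (hf : ∀ x, f (σ x) = σ' (f x)) (A : SqMat p q ℂ) (μ : R) :
    (superTens σ A μ).map f = superTens σ' A (f μ) := by
  ext i j
  cases j <;> simp [superTens, twist, hf]

theorem superParity_map {σ : R →ₐ[ℂ] R} {σ' : R' →ₐ[ℂ] R'} {f : R →ₐ[ℂ] R'}
    (hf : ∀ x, f (σ x) = σ' (f x)) (M : SqMat p q R) :
    (superParity σ M).map f = superParity σ' (M.map f) := by
  ext i j
  simp [superParity, hf]

theorem superExtend_map {σ : R →ₐ[ℂ] R} {σ' : R' →ₐ[ℂ] R'} {f : R →ₐ[ℂ] R'}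
    (hf : ∀ x, f (σ x) = σ' (f x)) (π : SqMat p q ℂ →ₗ[ℂ] SqMat p q ℂ) (M : SqMat p q R) :
    (superExtend σ π M).map f = superExtend σ' π (M.map f) := by
  ext k l
  have htw : ∀ (j : Fin p ⊕ Fin q) x, f (twist σ j x) = twist σ' j (f x) := by
    intro j x
    cases j <;> simp [twist, hf]
  simp [superExtend, Matrix.sum_apply, superTens, htw]

theorem gSpan_map {σ : R →ₐ[ℂ] R} {σ' : R' →ₐ[ℂ] R'} {f : R →ₐ[ℂ] R'}
    (hf : ∀ x, f (σ x) = σ' (f x)) {g : MatrixLieSuperalgebra p q} {M : SqMat p q R}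
    (hM : M ∈ gSpan σ g) : M.map f ∈ gSpan σ' g := by
  induction hM using Submodule.span_induction with
  | mem M hM =>
    obtain ⟨A, hA, μ, rfl⟩ := hM
    rw [superTens_map hf]
    exact Submodule.subset_span ⟨A, hA, _, rfl⟩
  | zero => rw [Matrix.map_zero _ (map_zero f)]; exact Submodule.zero_mem _
  | add M N _ _ hM hN => rw [Matrix.map_add _ (map_add f)]; exact Submodule.add_mem _ hM hN
  | smul c M _ hM =>
    rw [Matrix.map_smul _ _ (fun x => map_smul f c x)]
    exact Submodule.smul_mem _ _ hM

/-- The body map intertwines the parity with the trivial parity of `ℂ`, and over `ℂ` the matrix `A ⊗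
μ` is just `μ • A`. -/
theorem map_body_mem {σ : R →ₐ[ℂ] R} {β : R →ₐ[ℂ] ℂ} (hβ : ∀ x, β (σ x) = β x)
    {g : MatrixLieSuperalgebra p q} {M : SqMat p q R} (hM : M ∈ gSpan σ g) :
    M.map β ∈ g.carrier := by
  have h := gSpan_map (σ' := AlgHom.id ℂ ℂ) (f := β) hβ hM
  have hle : gSpan (AlgHom.id ℂ ℂ) g ≤ g.carrier := by
    refine Submodule.span_le.2 ?_
    rintro _ ⟨A, hA, μ, rfl⟩
    have : superTens (AlgHom.id ℂ ℂ) A μ = μ • A := by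
      ext i j
      cases j <;> simp [superTens, twist, mul_comm]
    rw [this]
    exact Submodule.smul_mem _ _ hA
  exact hle h

theorem map_algebraMap_mem (σ : R →ₐ[ℂ] R) {g : MatrixLieSuperalgebra p q} {A : SqMat p q ℂ}
    (hA : A ∈ g.carrier) : A.map (algebraMap ℂ R) ∈ gSpan σ g := by
  refine Submodule.subset_span ⟨A, hA, 1, ?_⟩
  ext i j
  simp [superTens, Algebra.algebraMap_eq_smul_one]

/-- Average an arbitrary projection onto `𝔤` with its conjugate by the parity. The grading of `𝔤`
keeps the average a projection onto `𝔤`. -/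
theorem exists_parity_projection (g : MatrixLieSuperalgebra p q) :
    ∃ π : SqMat p q ℂ →ₗ[ℂ] SqMat p q ℂ, (∀ A, π A ∈ g.carrier) ∧ (∀ A ∈ g.carrier, π A = A) ∧
      ∀ A, π (constParity A) = constParity (π A) := by
  obtain ⟨P, hP⟩ := g.carrier.exists_isCompl
  let P₀ := g.carrier.projectionOnto P hP
  let L : SqMat p q ℂ →ₗ[ℂ] SqMat p q ℂ :=
    { toFun := constParity
      map_add' := fun A B => by simp only [constParity_eq, superParity_add]
      map_smul' := fun c A => by simp only [constParity_eq, superParity_smul, RingHom.id_apply] }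
  have hL : ∀ A, L A = constParity A := fun A => rfl
  let π : SqMat p q ℂ →ₗ[ℂ] SqMat p q ℂ :=
    (2⁻¹ : ℂ) • (g.carrier.subtype ∘ₗ P₀ + L ∘ₗ g.carrier.subtype ∘ₗ P₀ ∘ₗ L)
  have hπ : ∀ A, π A = (2⁻¹ : ℂ) • ((P₀ A : SqMat p q ℂ) + constParity (P₀ (constParity A))) :=
    fun A => rfl
  refine ⟨π, fun A => ?_, fun A hA => ?_, fun A => ?_⟩
  · rw [hπ]
    exact Submodule.smul_mem _ _ (Submodule.add_mem _ (P₀ A).2 (g.graded _ (P₀ _).2))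
  · have h1 : (P₀ A : SqMat p q ℂ) = A := by
      have := Submodule.projectionOnto_apply_left hP ⟨A, hA⟩
      exact congrArg Subtype.val this
    have h2 : (P₀ (constParity A) : SqMat p q ℂ) = constParity A := by
      have := Submodule.projectionOnto_apply_left hP ⟨constParity A, g.graded A hA⟩
      exact congrArg Subtype.val this
    rw [hπ, h1, h2, constParity_constParity, ← two_smul ℂ A, smul_smul]
    norm_num
  · rw [hπ, hπ, constParity_constParity]
    rw [← hL ((2⁻¹ : ℂ) • _), map_smul, map_add, hL, hL, constParity_constParity, add_comm]

/-- The product of homogeneous matrices `A ⊗ μ` and `B ⊗ ν`. -/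
theorem superTens_mul {σ : R →ₐ[ℂ] R} {A B : SqMat p q ℂ} {μ ν : R} {s t c : ℂ}
    (hst : (s = 1 ∧ c = 1) ∨ (s = -1 ∧ t = 1 ∧ c = 1) ∨ (s = -1 ∧ t = -1 ∧ c = -1))
    (hB : constParity B = t • B) (hμ : σ μ = s • μ) :
    superTens σ A μ * superTens σ B ν = c • superTens σ (A * B) (μ * ν) := by
  -- A homogeneous `B` has non-zero entries only where `|k| + |j|` is its parity, and there the
  -- twists of `μ` by `k` and by `j` differ by the sign `c`.
  have key : ∀ k j, B k j • twist σ k μ = c • B k j • twist σ j μ := by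
    intro k j
    have hkj : (idxSign k * idxSign j) * B k j = t * B k j := by
      have := congrFun (congrFun hB k) j
      simpa [constParity] using this
    rcases hst with ⟨rfl, rfl⟩ | ⟨rfl, rfl, rfl⟩ | ⟨rfl, rfl, rfl⟩
    · rw [one_smul] at hμ
      cases k <;> cases j <;> simp [twist, hμ]
    · rw [neg_one_smul] at hμ
      cases k <;> cases j <;> simp [twist, hμ, idxSign] at hkj ⊢ <;>
        simp [self_eq_neg.1 hkj.symm]
    · rw [neg_one_smul] at hμ
      cases k <;> cases j <;> simp [twist, hμ, idxSign] at hkj ⊢ <;>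
        simp [self_eq_neg.1 hkj]
  ext i j
  simp only [Matrix.mul_apply, superTens, Matrix.of_apply, Matrix.smul_apply, Finset.sum_smul,
    Finset.smul_sum, map_mul]
  refine Finset.sum_congr rfl fun k _ => ?_
  have h := key k j
  calc A i k • twist σ k μ * B k j • twist σ j ν
      = A i k • ((B k j • twist σ k μ) * twist σ j ν) := by
        simp only [smul_mul_assoc, mul_smul_comm]
        rw [smul_comm]
    _ = c • (A i k * B k j) • (twist σ j μ * twist σ j ν) := by
        rw [h]
        simp only [smul_mul_assoc, smul_smul]
        congr 1
        ring

/-- An even matrix is half the sum of itself and its parity image. For `A ⊗ μ` this symmetrisation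
is a sum of an even-even and an odd-odd tensor, so even `𝔤`-matrices are generated by tensors whose
factors have equal parities. -/
theorem even_gSpan_induction {σ : R →ₐ[ℂ] R} (hσ : ∀ x, σ (σ x) = x)
    {g : MatrixLieSuperalgebra p q} {P : SqMat p q R → Prop} (h0 : P 0)
    (hadd : ∀ M N, P M → P N → P (M + N))
    (ht : ∀ A ∈ g.carrier, ∀ μ : R, ∀ s : ℂ, s = 1 ∨ s = -1 → constParity A = s • A →
      σ μ = s • μ → P (superTens σ A μ))
    {M : SqMat p q R} (hM : M ∈ gSpan σ g) (hp : superParity σ M = M) : P M := by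
  have key : ∀ M ∈ gSpan σ g, P (M + superParity σ M) := by
    intro M hM
    have aux : ∀ A ∈ g.carrier, ∀ μ : R, P (superTens σ A μ + superParity σ (superTens σ A μ)) := by
      intro A hA μ
      have hcA := constParity_constParity A
      have e : superTens σ A μ + superParity σ (superTens σ A μ) =
          superTens σ ((2⁻¹ : ℂ) • (A + constParity A)) (μ + σ μ) +
          superTens σ ((2⁻¹ : ℂ) • (A - constParity A)) (μ - σ μ) := by
        rw [superParity_tens]
        ext i j
        simp only [superTens, Matrix.add_apply, Matrix.of_apply, Matrix.smul_apply,
          Matrix.sub_apply, map_add, map_sub, smul_eq_mul]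
        module
      rw [e]
      refine hadd _ _ (ht _ ?_ _ 1 (Or.inl rfl) ?_ ?_) (ht _ ?_ _ (-1) (Or.inr rfl) ?_ ?_)
      · exact Submodule.smul_mem _ _ (Submodule.add_mem _ hA (g.graded A hA))
      · rw [constParity_eq, superParity_smul, superParity_add, ← constParity_eq, ← constParity_eq,
          hcA, one_smul, add_comm]
      · rw [map_add, hσ, one_smul, add_comm]
      · exact Submodule.smul_mem _ _ (Submodule.sub_mem _ hA (g.graded A hA))
      · rw [constParity_eq, superParity_smul, superParity_sub, ← constParity_eq, ← constParity_eq,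
          hcA, neg_one_smul, ← smul_neg, neg_sub]
      · rw [map_sub, hσ, neg_one_smul, neg_sub]
    induction hM using Submodule.closure_induction with
    | zero =>
      have : (0 : SqMat p q R) + superParity σ 0 = 0 := by ext; simp [superParity]
      rw [this]; exact h0
    | add M N _ _ h1 h2 =>
      rw [superParity_add, add_add_add_comm]
      exact hadd _ _ h1 h2
    | smul_mem c M hM =>
      obtain ⟨A, hA, μ, rfl⟩ := hM
      rw [← superTens_smul_left]
      exact aux _ (Submodule.smul_mem _ _ hA) μ
  have h := key ((2⁻¹ : ℂ) • M) (Submodule.smul_mem _ _ hM)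
  rwa [superParity_smul, hp, ← add_smul, show (2⁻¹ : ℂ) + 2⁻¹ = 1 by norm_num, one_smul] at h

/-- The even `𝔤`-matrices form a Lie algebra. -/
theorem commutator_mem_gSpan {σ : R →ₐ[ℂ] R} (hσ : SuperComm σ) {g : MatrixLieSuperalgebra p q}
    {M N : SqMat p q R} (hM : M ∈ gSpan σ g) (hM' : superParity σ M = M)
    (hN : N ∈ gSpan σ g) (hN' : superParity σ N = N) : M * N - N * M ∈ gSpan σ g := by
  refine even_gSpan_induction (P := fun M => M * N - N * M ∈ gSpan σ g) hσ.1 ?_ ?_ ?_ hM hM'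
  · simp
  · intro M M' h h'
    rw [add_mul, mul_add, add_sub_add_comm]
    exact Submodule.add_mem _ h h'
  intro A hA μ s hs hsA hsμ
  refine even_gSpan_induction (P := fun N => superTens σ A μ * N - N * superTens σ A μ ∈ gSpan σ g)
    hσ.1 ?_ ?_ ?_ hN hN'
  · simp
  · intro M M' h h'
    rw [add_mul, mul_add, add_sub_add_comm]
    exact Submodule.add_mem _ h h'
  intro B hB ν t ht htB htν
  -- The sign `c` is `-1` exactly when both tensors are odd-odd. It occurs in both matrix products,
  -- in `ν μ = c μ ν` and in the bracket, and as `c² = 1` the commutator is `c [A, B] ⊗ μ ν`.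
  obtain ⟨c, hc1, hc2, hcom, hbr⟩ : ∃ c : ℂ,
      ((s = 1 ∧ c = 1) ∨ (s = -1 ∧ t = 1 ∧ c = 1) ∨ (s = -1 ∧ t = -1 ∧ c = -1)) ∧
      ((t = 1 ∧ c = 1) ∨ (t = -1 ∧ s = 1 ∧ c = 1) ∨ (t = -1 ∧ s = -1 ∧ c = -1)) ∧
      ν * μ = c • (μ * ν) ∧ constBracket A B = A * B - c • (B * A) := by
    rcases hs with rfl | rfl
    · rw [one_smul] at hsA hsμ
      refine ⟨1, Or.inl ⟨rfl, rfl⟩, ?_, ?_, ?_⟩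
      · rcases ht with rfl | rfl <;> simp
      · rw [one_smul, hσ.even_mul hsμ]
      · rw [constBracket, hsA, one_smul, ← add_mul, ← smul_add]
        congr 2
        module
    · rw [neg_one_smul] at hsA hsμ
      rcases ht with rfl | rfl
      · rw [one_smul] at htB htν
        refine ⟨1, by simp, by simp, ?_, ?_⟩
        · rw [one_smul, hσ.even_mul htν]
        · rw [constBracket, htB, sub_self, smul_zero, zero_mul, add_zero, one_smul, ← two_smul ℂ B,
            smul_smul]
          norm_num
      · rw [neg_one_smul] at htB htν
        refine ⟨-1, by simp, by simp, ?_, ?_⟩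
        · rw [hσ.odd_mul htν, hsμ, neg_mul, neg_one_smul]
        · rw [constBracket, htB, hsA, add_neg_cancel, smul_zero, zero_mul, zero_add,
            sub_neg_eq_add, ← two_smul ℂ B, smul_smul]
          norm_num
  have e : superTens σ A μ * superTens σ B ν - superTens σ B ν * superTens σ A μ =
      superTens σ (c • constBracket A B) (μ * ν) := by
    rw [superTens_mul hc1 htB hsμ, superTens_mul hc2 hsA htν, hcom, superTens_smul_right, hbr,
      superTens_smul_left]
    rw [← smul_sub]
    congr 1
    ext i j
    simp [superTens, sub_smul, mul_smul]
  rw [e]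
  exact Submodule.subset_span ⟨_, Submodule.smul_mem _ _ (g.bracket_mem _ hA _ hB), _, rfl⟩

/-- The decomposition of matrices over a superalgebra into the body and the soul of an even
`𝔤`-matrix and a complement. -/
theorem exists_chart_projections {σ : R →ₐ[ℂ] R} (hσ : SuperComm σ) {β : R →ₐ[ℂ] ℂ}
    (hβ : ∀ x, β (σ x) = β x) (g : MatrixLieSuperalgebra p q) :
    ∃ (B : SqMat p q R →ₗ[ℂ] SqMat p q ℂ) (P₀ P₁ K : SqMat p q R →ₗ[ℂ] SqMat p q R),
      (∀ M, P₀ M = (B M).map (algebraMap ℂ R)) ∧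
      (∀ M, B M ∈ g.carrier ∧ constParity (B M) = B M) ∧ (∀ M, (P₁ M).map β = 0) ∧
      (∀ M, P₀ M + P₁ M + K M = M) ∧ (∀ M, K (P₀ M) = 0) ∧ (∀ M, K (P₁ M) = 0) ∧
      (∀ M, K (K M) = K M) ∧ ∀ M, K M = 0 ↔ M ∈ gSpan σ g ∧ superParity σ M = M := by
  obtain ⟨π, hπ1, hπ2, hπ3⟩ := exists_parity_projection g
  let L : SqMat p q R →ₗ[ℂ] SqMat p q R :=
    { toFun := superParity σ, map_add' := superParity_add σ, map_smul' := superParity_smul σ }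
  let Ev : SqMat p q R →ₗ[ℂ] SqMat p q R := (2⁻¹ : ℂ) • (LinearMap.id + L)
  have hEv : ∀ M, Ev M = (2⁻¹ : ℂ) • (M + superParity σ M) := fun M => rfl
  have hEv1 : ∀ M, superParity σ (Ev M) = Ev M := fun M => by
    rw [hEv, superParity_smul, superParity_add, superParity_superParity hσ.1, add_comm]
  have hEv2 : ∀ M, superParity σ M = M → Ev M = M := fun M hM => by
    rw [hEv, hM, ← two_smul ℂ M, smul_smul]; norm_num
  -- The even part followed by the extended projection: this projects onto the even `𝔤`-matrices.
  -- Its image is then split into body and soul, and `K` is the complementary projection.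
  let Pr : SqMat p q R →ₗ[ℂ] SqMat p q R := superExtend σ π ∘ₗ Ev
  have hPr1 : ∀ M, Pr M ∈ gSpan σ g := fun M => superExtend_mem σ hπ1 _
  have hPr2 : ∀ M, superParity σ (Pr M) = Pr M := fun M => by
    change superParity σ (superExtend σ π (Ev M)) = superExtend σ π (Ev M)
    rw [← superExtend_parity hσ.1 hπ3, hEv1]
  have hPr3 : ∀ M, M ∈ gSpan σ g → superParity σ M = M → Pr M = M := fun M h1 h2 => by
    change superExtend σ π (Ev M) = M
    rw [hEv2 M h2, superExtend_of_mem hσ.1 hπ2 h1]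
  let mb : SqMat p q R →ₗ[ℂ] SqMat p q ℂ := β.toLinearMap.mapMatrix
  let ma : SqMat p q ℂ →ₗ[ℂ] SqMat p q R := (Algebra.linearMap ℂ R).mapMatrix
  have hbe : ∀ M, constParity (mb (Pr M)) = mb (Pr M) := fun M => by
    have := superParity_map (σ' := AlgHom.id ℂ ℂ) (f := β) hβ (Pr M)
    rw [constParity_eq]
    exact this.symm.trans (by rw [hPr2]; rfl)
  have h0mem : ∀ M, ma (mb (Pr M)) ∈ gSpan σ g := fun M =>
    map_algebraMap_mem σ (map_body_mem hβ (hPr1 M))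
  have h0ev : ∀ M, superParity σ (ma (mb (Pr M))) = ma (mb (Pr M)) := fun M => by
    have := superParity_map (σ := AlgHom.id ℂ ℂ) (σ' := σ) (f := Algebra.ofId ℂ R)
      (fun x => by simp [Algebra.ofId_apply]) (mb (Pr M))
    rw [← constParity_eq, hbe] at this
    exact this.symm
  have hP0 : ∀ M, Pr (ma (mb (Pr M))) = ma (mb (Pr M)) := fun M => hPr3 _ (h0mem M) (h0ev M)
  have hPP : ∀ M, Pr (Pr M) = Pr M := fun M => hPr3 _ (hPr1 M) (hPr2 M)
  refine ⟨mb ∘ₗ Pr, ma ∘ₗ mb ∘ₗ Pr, Pr - ma ∘ₗ mb ∘ₗ Pr, LinearMap.id - Pr, fun M => rfl,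
    fun M => ⟨map_body_mem hβ (hPr1 M), hbe M⟩, fun M => ?_, fun M => ?_, fun M => ?_, fun M => ?_,
    fun M => ?_, fun M => ?_⟩
  · have : mb (ma (mb (Pr M))) = mb (Pr M) := by
      ext i j
      exact β.commutes _
    change mb (Pr M - ma (mb (Pr M))) = 0
    rw [map_sub, this, sub_self]
  · simp
  · simp [hP0]
  · simp [hP0, hPP]
  · simp [hPP]
  · constructor
    · intro h
      have h : M - Pr M = 0 := h
      rw [sub_eq_zero] at h
      rw [h]
      exact ⟨hPr1 M, hPr2 M⟩
    · rintro ⟨h1, h2⟩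
      change M - Pr M = 0
      rw [hPr3 M h1 h2, sub_self]

/-- Zero body puts the entries in `F 1`, and each further factor raises the filtration by one; in a
finitely generated Grassmann algebra the matrix is therefore nilpotent. -/
theorem map_body_pow_mem {ι : Type} [Fintype ι] [DecidableEq ι] {β : R →ₐ[ℂ] ℂ}
    {F : ℕ → Submodule ℂ R} (hF1 : ∀ x, β x = 0 → x ∈ F 1)
    (hF : ∀ k, ∀ x ∈ F k, ∀ y ∈ F 1, x * y ∈ F (k + 1)) {N : Matrix ι ι R} (hN : N.map β = 0)
    (k : ℕ) (i j : ι) : (N ^ (k + 1)) i j ∈ F (k + 1) := by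
  have h1 : ∀ i j, N i j ∈ F 1 := fun i j => hF1 _ (congrFun (congrFun hN i) j)
  induction k generalizing i j with
  | zero => simpa using h1 i j
  | succ k ih =>
    rw [pow_succ, Matrix.mul_apply]
    exact Submodule.sum_mem _ fun l _ => hF _ _ (ih i l) _ (h1 l j)

end SuperMatrix

end SuperZCR
end

noncomputable section
set_option linter.unusedSectionVars false

namespace SuperZCR

open scoped ContDiff Topology TensorProduct
open TopologicalSpace (Opens)

/-! ### Differential calculus of superfunctions -/

section Contraction

variable {o : Type}

theorem contractLeft_mul (d : (o →₀ ℂ) →ₗ[ℂ] ℂ) (x y : Grassmann o) :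
    CliffordAlgebra.contractLeft d (x * y) =
      CliffordAlgebra.contractLeft d x * y +
        CliffordAlgebra.involute x * CliffordAlgebra.contractLeft d y := by
  induction x using CliffordAlgebra.left_induction with
  | algebraMap r =>
    rw [CliffordAlgebra.contractLeft_algebraMap_mul, CliffordAlgebra.contractLeft_algebraMap,
      zero_mul, zero_add, AlgHom.commutes]
  | add a b ha hb => rw [add_mul, map_add, ha, hb, map_add, map_add, add_mul, add_mul]; abel
  | ι_mul x v hx =>
    rw [mul_assoc, CliffordAlgebra.contractLeft_ι_mul, hx, CliffordAlgebra.contractLeft_ι_mul,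
      map_mul, CliffordAlgebra.involute_ι, mul_add, sub_mul, smul_mul_assoc]
    simp only [mul_assoc, neg_mul]
    abel

theorem contractLeft_involute (d : (o →₀ ℂ) →ₗ[ℂ] ℂ) (x : Grassmann o) :
    CliffordAlgebra.involute (CliffordAlgebra.contractLeft d x) =
      -CliffordAlgebra.contractLeft d (CliffordAlgebra.involute x) := by
  induction x using CliffordAlgebra.left_induction with
  | algebraMap r => simp [CliffordAlgebra.contractLeft_algebraMap]
  | add a b ha hb => simp only [map_add, ha, hb, neg_add]
  | ι_mul x v hx =>
    rw [CliffordAlgebra.contractLeft_ι_mul, map_sub, map_mul, map_mul, CliffordAlgebra.involute_ι,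
      hx, neg_mul, neg_mul, map_neg, CliffordAlgebra.contractLeft_ι_mul, map_smul]
    simp

theorem contractLeft_grassmannMap [DecidableEq o] {T : Finset o} {v : o} (hv : v ∉ T)
    (x : Grassmann T) :
    CliffordAlgebra.contractLeft (Finsupp.lapply v : (o →₀ ℂ) →ₗ[ℂ] ℂ)
      (grassmannMap ((↑) : T → o) x) = 0 := by
  induction x using CliffordAlgebra.left_induction with
  | algebraMap r => rw [AlgHom.commutes, CliffordAlgebra.contractLeft_algebraMap]
  | add a b ha hb => rw [map_add, map_add, ha, hb, add_zero]
  | ι_mul x w hx =>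
    have : grassmannMap ((↑) : T → o) (CliffordAlgebra.ι 0 w) =
        CliffordAlgebra.ι 0 (Finsupp.lmapDomain ℂ ℂ ((↑) : T → o) w) :=
      ExteriorAlgebra.map_apply_ι _ w
    rw [map_mul, this, CliffordAlgebra.contractLeft_ι_mul, hx, mul_zero, sub_zero]
    have : (Finsupp.lapply v : (o →₀ ℂ) →ₗ[ℂ] ℂ) (Finsupp.lmapDomain ℂ ℂ ((↑) : T → o) w) = 0 := by
      rw [Finsupp.lmapDomain_apply, Finsupp.lapply_apply]
      exact Finsupp.mapDomain_of_notMem_range _ _ (by simpa using hv)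
    rw [this, zero_smul]

end Contraction

section Calculus

variable {κ o W : Type} [NormedAddCommGroup W] [NormedSpace ℝ W]
variable {𝒰 : Opens (κ → ℝ)} {𝓘 : Opens W}

/-- The domain of the superfunctions. -/
def domain (𝒰 : Opens (κ → ℝ)) (𝓘 : Opens W) : Set ((κ → ℝ) × W) := {P | P.1 ∈ 𝒰 ∧ P.2 ∈ 𝓘}

theorem isOpen_domain : IsOpen (domain 𝒰 𝓘) :=
  (𝒰.isOpen.preimage continuous_fst).inter (𝓘.isOpen.preimage continuous_snd)

/-- The product of a smooth function and an element of the Grassmann algebra. -/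
def superTmul (f : smoothFun 𝒰 𝓘) (x : Grassmann o) : SuperFun o 𝒰 𝓘 :=
  (f ⊗ₜ[ℂ] x : smoothFun 𝒰 𝓘 ⊗[ℂ] Grassmann o)

@[elab_as_elim]
theorem SuperFun.induction_on {P : SuperFun o 𝒰 𝓘 → Prop} (f : SuperFun o 𝒰 𝓘) (h0 : P 0)
    (ht : ∀ (f : smoothFun 𝒰 𝓘) (x : Grassmann o), P (superTmul f x))
    (ha : ∀ f g, P f → P g → P (f + g)) : P f :=
  TensorProduct.induction_on f h0 ht ha

theorem superTmul_mul (f g : smoothFun 𝒰 𝓘) (x y : Grassmann o) :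
    superTmul f x * superTmul g y = superTmul (f * g) (x * y) :=
  Algebra.TensorProduct.tmul_mul_tmul _ _ _ _

theorem superTmul_add_left (f g : smoothFun 𝒰 𝓘) (x : Grassmann o) :
    superTmul (f + g) x = superTmul f x + superTmul g x :=
  TensorProduct.add_tmul _ _ _

theorem superTmul_zero_left (x : Grassmann o) : superTmul (0 : smoothFun 𝒰 𝓘) x = 0 :=
  TensorProduct.zero_tmul _ _

theorem evenDeriv_superTmul (d : (κ → ℝ) × W) (f : smoothFun 𝒰 𝓘) (x : Grassmann o) :
    evenDeriv d (superTmul f x) = superTmul (dirDeriv d f) x := rfl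

theorem eval_superTmul (P : (κ → ℝ) × W) (f : smoothFun 𝒰 𝓘) (x : Grassmann o) :
    eval P (superTmul f x) = f.1 P • x := rfl

/-- The coefficient of a superfunction with respect to a linear functional. -/
def coefficient (φ : Grassmann o →ₗ[ℂ] ℂ) : SuperFun o 𝒰 𝓘 →ₗ[ℂ] smoothFun 𝒰 𝓘 :=
  (TensorProduct.rid ℂ _).toLinearMap ∘ₗ φ.lTensor (smoothFun 𝒰 𝓘)

theorem coefficient_apply (φ : Grassmann o →ₗ[ℂ] ℂ) (f : SuperFun o 𝒰 𝓘) (P : (κ → ℝ) × W) :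
    (coefficient φ f).1 P = φ (eval P f) := by
  induction f using SuperFun.induction_on with
  | h0 => simp
  | ht f x =>
    rw [eval_superTmul, map_smul, smul_eq_mul, mul_comm]
    rfl
  | ha f g hf hg =>
    rw [map_add, map_add, map_add, ← hf, ← hg]
    rfl

theorem coefficient_evenDeriv (φ : Grassmann o →ₗ[ℂ] ℂ) (d : (κ → ℝ) × W)
    (f : SuperFun o 𝒰 𝓘) : coefficient φ (evenDeriv d f) = dirDeriv d (coefficient φ f) := by
  induction f using SuperFun.induction_on with
  | h0 => simp
  | ht f x =>
    change φ x • dirDeriv d f = dirDeriv d (φ x • f)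
    rw [map_smul]
  | ha f g hf hg => simp only [map_add, hf, hg]

/-- The coefficients in a basis of the Grassmann algebra are ordinary functions. Identities between
superfunctions can therefore be checked on Grassmann numbers, at all points and not only those of
the domain. -/
theorem superFun_ext {f g : SuperFun o 𝒰 𝓘} (h : ∀ P, eval P f = eval P g) : f = g := by
  classical
  let b := Module.Basis.ofVectorSpace ℂ (Grassmann o)
  refine (TensorProduct.equivFinsuppOfBasisRight (M := smoothFun 𝒰 𝓘) b).injective ?_
  ext i P
  have key : ∀ f : SuperFun o 𝒰 𝓘,
      TensorProduct.equivFinsuppOfBasisRight (M := smoothFun 𝒰 𝓘) b f i =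
        coefficient (b.coord i) f := by
    intro f
    induction f using SuperFun.induction_on with
    | h0 => simp only [map_zero]; rfl
    | ht f x => exact TensorProduct.equivFinsuppOfBasisRight_apply_tmul_apply _ _ _ _
    | ha f g hf hg =>
      have := (TensorProduct.equivFinsuppOfBasisRight (M := smoothFun 𝒰 𝓘) b).map_add f g
      refine (congrArg (fun F => F i) this).trans ?_
      rw [map_add, Finsupp.add_apply, hf, hg]
  have h1 := congrArg (fun F : smoothFun 𝒰 𝓘 => F.1 P) (key f)
  have h2 := congrArg (fun F : smoothFun 𝒰 𝓘 => F.1 P) (key g)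
  exact h1.trans ((by simp only [coefficient_apply, h] : _ = _).trans h2.symm)

theorem eval_parity (P : (κ → ℝ) × W) (f : SuperFun o 𝒰 𝓘) :
    eval P (parity f) = CliffordAlgebra.involute (eval P f) := by
  induction f using SuperFun.induction_on with
  | h0 => simp
  | ht f x =>
    rw [eval_superTmul, map_smul]
    rfl
  | ha f g hf hg => simp only [map_add, hf, hg]

theorem superComm_parity : SuperComm (parity : SuperFun o 𝒰 𝓘 →ₐ[ℂ] SuperFun o 𝒰 𝓘) := by
  refine ⟨fun f => superFun_ext fun P => ?_, fun f g => ⟨superFun_ext fun P => ?_,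
    superFun_ext fun P => ?_⟩⟩
  · rw [eval_parity, eval_parity, superComm_grassmann.1]
  · simp only [map_mul, map_add, eval_parity]
    exact (superComm_grassmann.2 _ _).1
  · simp only [map_mul, map_sub, eval_parity]
    exact (superComm_grassmann.2 _ _).2

theorem dirDeriv_hasDerivAt (d : (κ → ℝ) × W) (f : smoothFun 𝒰 𝓘) {P : (κ → ℝ) × W}
    (hP : P ∈ domain 𝒰 𝓘) : HasDerivAt (fun t : ℝ => f.1 (P + t • d)) ((dirDeriv d f).1 P) 0 := by
  have h := (IsSmooth.differentiableAt_line f.2 d P hP.1 hP.2).hasDerivAt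
  have : (dirDeriv d f).1 P = deriv (fun t : ℝ => f.1 (P + t • d)) 0 := if_pos hP
  rw [this]
  exact h

theorem dirDeriv_of_notMem (d : (κ → ℝ) × W) (f : smoothFun 𝒰 𝓘) {P : (κ → ℝ) × W}
    (hP : P ∉ domain 𝒰 𝓘) : (dirDeriv d f).1 P = 0 :=
  if_neg hP

theorem dirDeriv_mul (d : (κ → ℝ) × W) (f g : smoothFun 𝒰 𝓘) :
    dirDeriv d (f * g) = dirDeriv d f * g + f * dirDeriv d g := by
  ext P
  change (dirDeriv d (f * g)).1 P = (dirDeriv d f).1 P * g.1 P + f.1 P * (dirDeriv d g).1 P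
  by_cases hP : P ∈ domain 𝒰 𝓘
  · have h1 := dirDeriv_hasDerivAt d (f * g) hP
    have h2 := (dirDeriv_hasDerivAt d f hP).mul (dirDeriv_hasDerivAt d g hP)
    have := h1.unique h2
    simpa using this
  · simp only [dirDeriv_of_notMem d _ hP, zero_mul, mul_zero, add_zero]

theorem evenDeriv_mul (d : (κ → ℝ) × W) (f g : SuperFun o 𝒰 𝓘) :
    evenDeriv d (f * g) = evenDeriv d f * g + f * evenDeriv d g := by
  induction f using SuperFun.induction_on with
  | h0 => simp
  | ha f f' hf hf' => simp only [add_mul, map_add, hf, hf']; abel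
  | ht f x =>
    induction g using SuperFun.induction_on with
    | h0 => simp
    | ha g g' hg hg' => simp only [mul_add, map_add, hg, hg']; abel
    | ht g y =>
      rw [superTmul_mul, evenDeriv_superTmul, evenDeriv_superTmul, evenDeriv_superTmul,
        superTmul_mul, superTmul_mul, dirDeriv_mul, superTmul_add_left]

theorem eval_oddDeriv (v : o) (P : (κ → ℝ) × W) (f : SuperFun o 𝒰 𝓘) :
    eval P (oddDeriv v f) =
      CliffordAlgebra.contractLeft (Finsupp.lapply v : (o →₀ ℂ) →ₗ[ℂ] ℂ) (eval P f) := by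
  induction f using SuperFun.induction_on with
  | h0 => simp
  | ht f x =>
    rw [eval_superTmul, map_smul]
    rfl
  | ha f g hf hg => simp only [map_add, hf, hg]

theorem oddDeriv_mul (v : o) (f g : SuperFun o 𝒰 𝓘) :
    oddDeriv v (f * g) = oddDeriv v f * g + parity f * oddDeriv v g :=
  superFun_ext fun P => by
    simp only [map_mul, map_add, eval_oddDeriv, eval_parity, contractLeft_mul]

theorem parity_oddDeriv (v : o) (f : SuperFun o 𝒰 𝓘) :
    parity (oddDeriv v f) = -oddDeriv v (parity f) :=
  superFun_ext fun P => by
    simp only [map_neg, eval_oddDeriv, eval_parity, contractLeft_involute]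

theorem parity_evenDeriv (d : (κ → ℝ) × W) (f : SuperFun o 𝒰 𝓘) :
    parity (evenDeriv d f) = evenDeriv d (parity f) := by
  induction f using SuperFun.induction_on with
  | h0 => simp
  | ht f x => rfl
  | ha f g hf hg => simp only [map_add, hf, hg]

theorem evenDeriv_oddDeriv (d : (κ → ℝ) × W) (v : o) (f : SuperFun o 𝒰 𝓘) :
    evenDeriv d (oddDeriv v f) = oddDeriv v (evenDeriv d f) := by
  induction f using SuperFun.induction_on with
  | h0 => simp
  | ht f x => rfl
  | ha f g hf hg => simp only [map_add, hf, hg]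

/-- The full Grassmann algebra carries no topology here, so derivatives are compared after applying
linear functionals, which separate points. -/
theorem grassmann_ext {x y : Grassmann o} (h : ∀ φ : Grassmann o →ₗ[ℂ] ℂ, φ x = φ y) : x = y := by
  rw [← sub_eq_zero]
  refine (Module.forall_dual_apply_eq_zero_iff ℂ _).1 fun φ => ?_
  rw [map_sub, h, sub_self]

theorem eval_evenDeriv_hasDerivAt (φ : Grassmann o →ₗ[ℂ] ℂ) (d : (κ → ℝ) × W)
    (f : SuperFun o 𝒰 𝓘) {P : (κ → ℝ) × W} (hP : P ∈ domain 𝒰 𝓘) :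
    HasDerivAt (fun t : ℝ => φ (eval (P + t • d) f)) (φ (eval P (evenDeriv d f))) 0 := by
  have h := dirDeriv_hasDerivAt d (coefficient φ f) hP
  rw [← coefficient_evenDeriv] at h
  simpa only [coefficient_apply] using h

theorem eval_evenDeriv_of_notMem (d : (κ → ℝ) × W)
    (f : SuperFun o 𝒰 𝓘) {P : (κ → ℝ) × W} (hP : P ∉ domain 𝒰 𝓘) :
    eval P (evenDeriv d f) = 0 := by
  refine grassmann_ext fun φ => ?_
  rw [← coefficient_apply, coefficient_evenDeriv, dirDeriv_of_notMem d _ hP, map_zero]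

theorem eval_evenDeriv_congr {f g : SuperFun o 𝒰 𝓘} {P : (κ → ℝ) × W}
    (hP : P ∈ domain 𝒰 𝓘) (h : ∀ᶠ P' in 𝓝 P, eval P' f = eval P' g) (d : (κ → ℝ) × W) :
    eval P (evenDeriv d f) = eval P (evenDeriv d g) := by
  refine grassmann_ext fun φ => ?_
  have h1 := eval_evenDeriv_hasDerivAt φ d f hP
  have h2 := eval_evenDeriv_hasDerivAt φ d g hP
  refine h1.unique (h2.congr_of_eventuallyEq ?_)
  have hc : Filter.Tendsto (fun t : ℝ => P + t • d) (𝓝 0) (𝓝 P) := by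
    have : Continuous (fun t : ℝ => P + t • d) := by fun_prop
    simpa using this.tendsto 0
  filter_upwards [hc.eventually h] with t ht
  rw [ht]

theorem IsSmooth.dirDeriv_representative {f : smoothFun 𝒰 𝓘} {T : Finset κ}
    {g : (T → ℝ) × W → ℂ} (hg : ∀ P : (κ → ℝ) × W, P.1 ∈ 𝒰 → P.2 ∈ 𝓘 →
      ContDiffAt ℝ ∞ g (restr T P) ∧ f.1 P = g (restr T P)) (d P : (κ → ℝ) × W)
    (h1 : P.1 ∈ 𝒰) (h2 : P.2 ∈ 𝓘) :
    ContDiffAt ℝ ∞ (fun z => fderiv ℝ g z (restr T d)) (restr T P) ∧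
      (dirDeriv d f).1 P = fderiv ℝ g (restr T P) (restr T d) :=
  ⟨((hg P h1 h2).1.fderiv_right (m := ∞) (by simp)).clm_apply contDiffAt_const,
    (dirDeriv_hasDerivAt d f (P := P) ⟨h1, h2⟩).unique (hasDerivAt_line hg d P h1 h2)⟩

/-- On the domain this is the symmetry of the second derivative of a representative in finitely many
variables; off the domain both sides are `0` by convention. -/
theorem dirDeriv_comm (d d' : (κ → ℝ) × W) (f : smoothFun 𝒰 𝓘) :
    dirDeriv d (dirDeriv d' f) = dirDeriv d' (dirDeriv d f) := by
  ext P
  by_cases hP : P ∈ domain 𝒰 𝓘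
  · obtain ⟨T, g, hg⟩ := f.2
    have hd : ∀ d, ∀ P : (κ → ℝ) × W, P.1 ∈ 𝒰 → P.2 ∈ 𝓘 → _ :=
      fun d P => IsSmooth.dirDeriv_representative (f := f) hg d P
    rw [(IsSmooth.dirDeriv_representative (hd d') d P hP.1 hP.2).2,
      (IsSmooth.dirDeriv_representative (hd d) d' P hP.1 hP.2).2]
    have hsm := (hg P hP.1 hP.2).1
    have hdf : DifferentiableAt ℝ (fderiv ℝ g) (restr T P) :=
      (hsm.fderiv_right (m := 1) (by norm_cast)).differentiableAt (by simp)
    have e : ∀ u v, fderiv ℝ (fun z => fderiv ℝ g z u) (restr T P) v =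
        fderiv ℝ (fderiv ℝ g) (restr T P) v u := by
      intro u v
      rw [fderiv_clm_apply hdf (differentiableAt_const u)]
      simp
    rw [e, e]
    have hs : IsSymmSndFDerivAt ℝ g (restr T P) :=
      hsm.isSymmSndFDerivAt (by simp only [minSmoothness_of_isRCLikeNormedField]; norm_cast)
    exact hs _ _
  · rw [dirDeriv_of_notMem d _ hP, dirDeriv_of_notMem d' _ hP]

theorem evenDeriv_comm (d d' : (κ → ℝ) × W) (f : SuperFun o 𝒰 𝓘) :
    evenDeriv d (evenDeriv d' f) = evenDeriv d' (evenDeriv d f) := by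
  induction f using SuperFun.induction_on with
  | h0 => simp
  | ht f x =>
    simp only [evenDeriv_superTmul, dirDeriv_comm d d']
  | ha f g hf hg => simp only [map_add, hf, hg]

theorem eval_freeze {W' : Type} [NormedAddCommGroup W'] [NormedSpace ℝ W'] (𝓙 : Opens W')
    (w₀ : 𝓘) (f : SuperFun o 𝒰 𝓘) (P : (κ → ℝ) × W') :
    eval P (freeze 𝓙 w₀ f) = eval (P.1, w₀.1) f := by
  induction f using SuperFun.induction_on with
  | h0 => simp
  | ht f x => rfl
  | ha f g hf hg => simp only [map_add, hf, hg]

theorem evenDeriv_freeze {W' : Type} [NormedAddCommGroup W'] [NormedSpace ℝ W'] (𝓙 : Opens W')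
    (w₀ : 𝓘) (f : SuperFun o 𝒰 𝓘) (a : W') : evenDeriv (0, a) (freeze 𝓙 w₀ f) = 0 := by
  refine superFun_ext fun P => ?_
  rw [map_zero]
  by_cases hP : P ∈ domain 𝒰 𝓙
  · refine grassmann_ext fun φ => ?_
    refine (eval_evenDeriv_hasDerivAt φ (0, a) _ hP).unique ?_
    simp only [eval_freeze, Prod.fst_add, Prod.smul_fst, smul_zero, add_zero, map_zero]
    exact hasDerivAt_const _ _
  · exact eval_evenDeriv_of_notMem _ _ hP

/-- The restriction to the domain is needed: for a parameter outside `𝓙` the left side is `0` by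
convention, while the right side is a derivative taken at `w₀`. -/
theorem eval_evenDeriv_freeze {W' : Type} [NormedAddCommGroup W'] [NormedSpace ℝ W'] (𝓙 : Opens W')
    (w₀ : 𝓘) (f : SuperFun o 𝒰 𝓘) (x : κ → ℝ) {P : (κ → ℝ) × W'} (hP : P ∈ domain 𝒰 𝓙) :
    eval P (evenDeriv (x, 0) (freeze 𝓙 w₀ f)) = eval P (freeze 𝓙 w₀ (evenDeriv (x, 0) f)) := by
  refine grassmann_ext fun φ => ?_
  rw [eval_freeze]
  refine (eval_evenDeriv_hasDerivAt φ (x, 0) _ hP).unique ?_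
  have := eval_evenDeriv_hasDerivAt φ (x, 0) f (P := (P.1, w₀.1)) ⟨hP.1, w₀.2⟩
  simpa [eval_freeze] using this

theorem exists_finset_even (f : SuperFun o 𝒰 𝓘) :
    ∃ T : Finset κ, ∀ d : (κ → ℝ) × W, restr T d = 0 → evenDeriv d f = 0 := by
  classical
  induction f using SuperFun.induction_on with
  | h0 => exact ⟨∅, fun d _ => map_zero _⟩
  | ht f x =>
    obtain ⟨T, g, hg⟩ := f.2
    refine ⟨T, fun d hd => ?_⟩
    have : dirDeriv d f = 0 := by
      ext P
      by_cases hP : P ∈ domain 𝒰 𝓘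
      · change (dirDeriv d f).1 P = 0
        rw [(IsSmooth.dirDeriv_representative hg d P hP.1 hP.2).2, hd, map_zero]
      · exact dirDeriv_of_notMem d f hP
    rw [evenDeriv_superTmul, this, superTmul_zero_left]
  | ha f g hf hg =>
    obtain ⟨T, hT⟩ := hf
    obtain ⟨T', hT'⟩ := hg
    refine ⟨T ∪ T', fun d hd => ?_⟩
    have h1 : ∀ c (hc : c ∈ T ∪ T'), d.1 c = 0 := fun c hc =>
      congrFun (congrArg Prod.fst hd) ⟨c, hc⟩
    have h2 : d.2 = 0 := congrArg Prod.snd hd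
    rw [map_add, hT d, hT' d, add_zero]
    · exact Prod.ext (funext fun c => h1 c (Finset.mem_union_right _ c.2)) h2
    · exact Prod.ext (funext fun c => h1 c (Finset.mem_union_left _ c.2)) h2

theorem exists_finset_odd (f : SuperFun o 𝒰 𝓘) :
    ∃ T : Finset o, ∀ v ∉ T, oddDeriv v f = 0 := by
  classical
  induction f using SuperFun.induction_on with
  | h0 => exact ⟨∅, fun d _ => map_zero _⟩
  | ht f x =>
    obtain ⟨T, hT⟩ := exists_finset_grassmann x
    obtain ⟨y, hy⟩ := hT T subset_rfl
    refine ⟨T, fun v hv => superFun_ext fun P => ?_⟩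
    rw [eval_oddDeriv, eval_superTmul, map_smul, map_zero]
    have hy : grassmannMap ((↑) : T → o) y = x := hy
    rw [← hy, contractLeft_grassmannMap hv, smul_zero]
  | ha f g hf hg =>
    obtain ⟨T, hT⟩ := hf
    obtain ⟨T', hT'⟩ := hg
    refine ⟨T ∪ T', fun v hv => ?_⟩
    rw [Finset.mem_union, not_or] at hv
    rw [map_add, hT v hv.1, hT' v hv.2, add_zero]

end Calculus

end SuperZCR
end

noncomputable section
set_option linter.unusedSectionVars false

namespace SuperZCR

open scoped ContDiff Topology TensorProduct
open TopologicalSpace (Opens)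

/-! ### Total derivatives as graded derivations -/

section TotalDerivative

variable {n₀ n₁ m₀ m₁ : ℕ} {W : Type} [NormedAddCommGroup W] [NormedSpace ℝ W]
variable {𝒰 : Opens (EvenIdx n₀ n₁ m₀ m₁ → ℝ)} {𝓘 : Opens W}

open Classical in
/-- The partial derivatives with respect to the base coordinates. -/
def baseDeriv (c : Fin n₀ ⊕ Fin n₁) : JetFun 𝒰 𝓘 →ₗ[ℂ] JetFun 𝒰 𝓘 :=
  match c with
  | .inl i => evenDeriv (Pi.single (.inl i) 1, 0)
  | .inr j => oddDeriv (.inl j)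

/-- The total derivative of a fibre coordinate. -/
def jetShift (c : Fin n₀ ⊕ Fin n₁) (v : JetVar n₀ n₁ m₀ m₁) : JetFun 𝒰 𝓘 :=
  match c with
  | .inl i => shiftX i v
  | .inr j => shiftθ j v

/-- The power of the parity automorphism given by the parity of a total derivative. -/
def baseParity (c : Fin n₀ ⊕ Fin n₁) : JetFun 𝒰 𝓘 →ₐ[ℂ] JetFun 𝒰 𝓘 :=
  Sum.elim (fun _ => AlgHom.id ℂ _) (fun _ => parity) c

/-- The power of the parity automorphism given by the parity of a fibre coordinate. -/
def jetParity (v : JetVar n₀ n₁ m₀ m₁) : JetFun 𝒰 𝓘 →ₐ[ℂ] JetFun 𝒰 𝓘 :=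
  if v.par = 0 then AlgHom.id ℂ _ else parity

/-- The sign of the parity of a total derivative. -/
def baseSign (c : Fin n₀ ⊕ Fin n₁) : ℂ := Sum.elim (fun _ => 1) (fun _ => -1) c

/-- The sign of the parity of a fibre coordinate. -/
def jetSign (v : JetVar n₀ n₁ m₀ m₁) : ℂ := if v.par = 0 then 1 else -1

theorem totalD_eq (c : Fin n₀ ⊕ Fin n₁) (f : JetFun 𝒰 𝓘) :
    totalD c f = baseDeriv c f + ∑ᶠ v, jetShift c v * jetDeriv v f := by
  cases c <;> rfl

/-- A superfunction involves finitely many coordinates. The sum in a total derivative can thus be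
taken over any sufficiently large finite set, in particular over one common to several functions. -/
theorem exists_finset_jetDeriv (f : JetFun 𝒰 𝓘) :
    ∃ s : Finset (JetVar n₀ n₁ m₀ m₁), ∀ v ∉ s, jetDeriv v f = 0 := by
  classical
  obtain ⟨T, hT⟩ := exists_finset_even f
  obtain ⟨T', hT'⟩ := exists_finset_odd f
  refine ⟨T.biUnion (fun c => Sum.elim (fun _ => ∅) (fun v => {v.1}) c) ∪
    T'.biUnion (fun c => Sum.elim (fun _ => ∅) (fun v => {v.1}) c), fun v hv => ?_⟩
  rw [Finset.mem_union, not_or, Finset.mem_biUnion, Finset.mem_biUnion] at hv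
  by_cases h : v.par = 0
  · rw [jetDeriv, dif_pos h]
    refine hT _ (Prod.ext (funext fun c => ?_) rfl)
    refine Pi.single_eq_of_ne ?_ _
    rintro hc
    exact hv.1 ⟨c, c.2, by rw [hc]; simp⟩
  · rw [jetDeriv, dif_neg h]
    refine hT' _ fun hc => hv.2 ⟨_, hc, by simp⟩

theorem totalD_eq_sum (c : Fin n₀ ⊕ Fin n₁) {f : JetFun 𝒰 𝓘} {s : Finset (JetVar n₀ n₁ m₀ m₁)}
    (hs : ∀ v ∉ s, jetDeriv v f = 0) :
    totalD c f = baseDeriv c f + ∑ v ∈ s, jetShift c v * jetDeriv v f := by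
  rw [totalD_eq, finsum_eq_sum_of_support_subset]
  intro v hv
  by_contra hvs
  exact hv (by simp only [hs v hvs, mul_zero])

theorem exists_totalD_eq_sum (c : Fin n₀ ⊕ Fin n₁) (f : JetFun 𝒰 𝓘) :
    ∃ s : Finset (JetVar n₀ n₁ m₀ m₁), ∀ s', s ⊆ s' →
      totalD c f = baseDeriv c f + ∑ v ∈ s', jetShift c v * jetDeriv v f := by
  obtain ⟨s, hs⟩ := exists_finset_jetDeriv f
  exact ⟨s, fun s' h => totalD_eq_sum c fun v hv => hs v fun hv' => hv (h hv')⟩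

theorem totalD_add (c : Fin n₀ ⊕ Fin n₁) (f g : JetFun 𝒰 𝓘) :
    totalD c (f + g) = totalD c f + totalD c g := by
  classical
  obtain ⟨s, hs⟩ := exists_totalD_eq_sum c f
  obtain ⟨t, ht⟩ := exists_totalD_eq_sum c g
  obtain ⟨u, hu⟩ := exists_totalD_eq_sum c (f + g)
  rw [hs (s ∪ (t ∪ u)) (by grind), ht (s ∪ (t ∪ u)) (by grind), hu (s ∪ (t ∪ u)) (by grind)]
  simp only [map_add, mul_add, Finset.sum_add_distrib]
  abel

theorem totalD_smul (c : Fin n₀ ⊕ Fin n₁) (a : ℂ) (f : JetFun 𝒰 𝓘) :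
    totalD c (a • f) = a • totalD c f := by
  classical
  obtain ⟨s, hs⟩ := exists_totalD_eq_sum c f
  obtain ⟨u, hu⟩ := exists_totalD_eq_sum c (a • f)
  rw [hs (s ∪ u) (by grind), hu (s ∪ u) (by grind)]
  simp only [map_smul, mul_smul_comm, Finset.smul_sum, smul_add]

/-- The total derivative as a linear operator. -/
def totalDₗ (c : Fin n₀ ⊕ Fin n₁) : JetFun 𝒰 𝓘 →ₗ[ℂ] JetFun 𝒰 𝓘 where
  toFun := totalD c
  map_add' := totalD_add c
  map_smul' := totalD_smul c

theorem totalDₗ_apply (c : Fin n₀ ⊕ Fin n₁) (f : JetFun 𝒰 𝓘) : totalDₗ c f = totalD c f := rfl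

theorem parity_evenCoord (c : EvenIdx n₀ n₁ m₀ m₁) :
    parity (evenCoord c : JetFun 𝒰 𝓘) = evenCoord c :=
  superFun_ext fun P => by
    rw [eval_parity]
    change CliffordAlgebra.involute ((P.1 c : ℂ) • (1 : Grassmann (OddIdx n₀ n₁ m₀ m₁))) =
      (P.1 c : ℂ) • 1
    rw [map_smul, map_one]

theorem parity_oddCoord (v : OddIdx n₀ n₁ m₀ m₁) :
    parity (oddCoord v : JetFun 𝒰 𝓘) = -oddCoord v :=
  superFun_ext fun P => by
    rw [eval_parity, map_neg]
    have hι := CliffordAlgebra.involute_ι (Q := (0 : QuadraticForm ℂ (OddIdx n₀ n₁ m₀ m₁ →₀ ℂ)))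
      (Finsupp.single v 1)
    change CliffordAlgebra.involute ((1 : ℂ) • CliffordAlgebra.ι
      (0 : QuadraticForm ℂ (OddIdx n₀ n₁ m₀ m₁ →₀ ℂ)) (Finsupp.single v 1)) =
      -((1 : ℂ) • CliffordAlgebra.ι
        (0 : QuadraticForm ℂ (OddIdx n₀ n₁ m₀ m₁ →₀ ℂ)) (Finsupp.single v 1))
    rw [map_smul, hι, smul_neg]

theorem parity_jetCoord (v : JetVar n₀ n₁ m₀ m₁) :
    parity (jetCoord v : JetFun 𝒰 𝓘) = jetSign v • jetCoord v := by
  rw [jetCoord, jetSign]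
  split_ifs
  · rw [parity_evenCoord, one_smul]
  · rw [parity_oddCoord, neg_one_smul]

theorem ZMod.two_cases (a : ZMod 2) : a = 0 ∨ a = 1 := by
  revert a
  decide

theorem parity_jetShift (c : Fin n₀ ⊕ Fin n₁) (v : JetVar n₀ n₁ m₀ m₁) :
    parity (jetShift c v : JetFun 𝒰 𝓘) = (baseSign c * jetSign v) • jetShift c v := by
  cases c with
  | inl i =>
    change parity (jetCoord _) = _ • jetCoord _
    rw [parity_jetCoord, baseSign, Sum.elim_inl, one_mul]
    rfl
  | inr j =>
    change parity (shiftθ j v) = _ • shiftθ j v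
    rw [shiftθ]
    split_ifs with h
    · rw [map_zero, smul_zero]
    · rw [map_smul, parity_jetCoord, smul_comm]
      congr 2
      have : JetVar.par ⟨v.field, v.I, insert j v.J⟩ = v.par + 1 := by
        simp only [JetVar.par, Finset.card_insert_of_notMem h]
        push_cast
        ring
      rw [jetSign, jetSign, this, baseSign, Sum.elim_inr]
      rcases ZMod.two_cases v.par with h0 | h0
      · rw [h0]
        norm_num
      · rw [h0, show (1 : ZMod 2) + 1 = 0 by decide]
        norm_num

/-- The total derivative of a coordinate `v` has the parity of `D_c` plus that of `v`. Moving it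
past the function twisted by the parity of `v` leaves the twist by the parity of `D_c`, the sign in
the Leibniz rule for `D_c`. -/
theorem jetShift_mul_jetParity (c : Fin n₀ ⊕ Fin n₁) (v : JetVar n₀ n₁ m₀ m₁)
    (f : JetFun 𝒰 𝓘) : jetShift c v * jetParity v f = baseParity c f * jetShift c v := by
  have h := parity_jetShift (𝒰 := 𝒰) (𝓘 := 𝓘) c v
  have hc := superComm_parity (o := OddIdx n₀ n₁ m₀ m₁) (𝒰 := 𝒰) (𝓘 := 𝓘)
  rw [jetSign, baseSign] at h
  rw [jetParity, baseParity]
  split_ifs at h ⊢ with h0 <;> cases c <;>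
    simp only [Sum.elim_inl, Sum.elim_inr, one_mul, mul_one, one_smul, neg_one_smul, neg_mul,
      neg_neg] at h ⊢
  · exact hc.even_mul h f
  · exact hc.odd_mul h f
  · rw [hc.odd_mul h, hc.1]
    rfl
  · exact hc.even_mul h _

theorem baseDeriv_mul (c : Fin n₀ ⊕ Fin n₁) (f g : JetFun 𝒰 𝓘) :
    baseDeriv c (f * g) = baseDeriv c f * g + baseParity c f * baseDeriv c g := by
  cases c with
  | inl i => exact evenDeriv_mul _ f g
  | inr j => exact oddDeriv_mul _ f g

theorem jetDeriv_mul (v : JetVar n₀ n₁ m₀ m₁) (f g : JetFun 𝒰 𝓘) :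
    jetDeriv v (f * g) = jetDeriv v f * g + jetParity v f * jetDeriv v g := by
  rw [jetDeriv, jetParity]
  split_ifs
  · exact evenDeriv_mul _ f g
  · exact oddDeriv_mul _ f g

theorem totalD_mul (c : Fin n₀ ⊕ Fin n₁) (f g : JetFun 𝒰 𝓘) :
    totalD c (f * g) = totalD c f * g + baseParity c f * totalD c g := by
  classical
  obtain ⟨s, hs⟩ := exists_totalD_eq_sum c f
  obtain ⟨t, ht⟩ := exists_totalD_eq_sum c g
  obtain ⟨u, hu⟩ := exists_totalD_eq_sum c (f * g)
  rw [hs (s ∪ (t ∪ u)) (by grind), ht (s ∪ (t ∪ u)) (by grind), hu (s ∪ (t ∪ u)) (by grind)]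
  simp only [baseDeriv_mul, jetDeriv_mul, mul_add, add_mul, Finset.sum_add_distrib,
    Finset.sum_mul, Finset.mul_sum, ← mul_assoc, jetShift_mul_jetParity]
  abel

theorem parity_baseDeriv (c : Fin n₀ ⊕ Fin n₁) (f : JetFun 𝒰 𝓘) :
    parity (baseDeriv c f) = baseSign c • baseDeriv c (parity f) := by
  cases c with
  | inl i => exact (parity_evenDeriv _ f).trans (one_smul ℂ _).symm
  | inr j => exact (parity_oddDeriv _ f).trans (neg_one_smul ℂ _).symm

theorem parity_jetDeriv (v : JetVar n₀ n₁ m₀ m₁) (f : JetFun 𝒰 𝓘) :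
    parity (jetDeriv v f) = jetSign v • jetDeriv v (parity f) := by
  rw [jetDeriv, jetSign]
  split_ifs
  · rw [parity_evenDeriv, one_smul]
  · rw [parity_oddDeriv, neg_one_smul]

theorem jetSign_mul_self (v : JetVar n₀ n₁ m₀ m₁) : jetSign v * jetSign v = 1 := by
  rw [jetSign]
  split_ifs <;> norm_num

theorem parity_totalD (c : Fin n₀ ⊕ Fin n₁) (f : JetFun 𝒰 𝓘) :
    parity (totalD c f) = baseSign c • totalD c (parity f) := by
  classical
  obtain ⟨s, hs⟩ := exists_totalD_eq_sum c f
  obtain ⟨u, hu⟩ := exists_totalD_eq_sum c (parity f)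
  rw [hs (s ∪ u) (by grind), hu (s ∪ u) (by grind), map_add, map_sum, smul_add, Finset.smul_sum,
    parity_baseDeriv]
  congr 1
  refine Finset.sum_congr rfl fun v _ => ?_
  rw [map_mul, parity_jetShift, parity_jetDeriv, smul_mul_smul_comm, mul_assoc, jetSign_mul_self,
    mul_one]

theorem evenDeriv_evenCoord (a : W) (c : EvenIdx n₀ n₁ m₀ m₁) :
    evenDeriv (0, a) (evenCoord c : JetFun 𝒰 𝓘) = 0 := by
  refine superFun_ext fun P => ?_
  rw [map_zero]
  by_cases hP : P ∈ domain 𝒰 𝓘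
  · refine grassmann_ext fun φ => (eval_evenDeriv_hasDerivAt φ (0, a) _ hP).unique ?_
    have : ∀ t : ℝ, φ (eval (P + t • ((0, a) : (EvenIdx n₀ n₁ m₀ m₁ → ℝ) × W))
        (evenCoord c : JetFun 𝒰 𝓘)) = φ ((P.1 c : ℂ) • 1) := by
      intro t
      change φ (((P.1 c + t • (0 : ℝ) : ℝ) : ℂ) • 1) = _
      rw [smul_zero, add_zero]
    simp only [this, map_zero]
    exact hasDerivAt_const _ _
  · exact eval_evenDeriv_of_notMem _ _ hP

theorem evenDeriv_oddCoord (a : W) (c : OddIdx n₀ n₁ m₀ m₁) :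
    evenDeriv (0, a) (oddCoord c : JetFun 𝒰 𝓘) = 0 := by
  refine superFun_ext fun P => ?_
  rw [map_zero]
  by_cases hP : P ∈ domain 𝒰 𝓘
  · refine grassmann_ext fun φ => (eval_evenDeriv_hasDerivAt φ (0, a) _ hP).unique ?_
    rw [map_zero]
    exact hasDerivAt_const (0 : ℝ) (φ ((1 : ℂ) • ExteriorAlgebra.ι ℂ (Finsupp.single c 1)))
  · exact eval_evenDeriv_of_notMem _ _ hP

theorem evenDeriv_jetShift (a : W) (c : Fin n₀ ⊕ Fin n₁) (v : JetVar n₀ n₁ m₀ m₁) :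
    evenDeriv (0, a) (jetShift c v : JetFun 𝒰 𝓘) = 0 := by
  have h : ∀ v, evenDeriv (0, a) (jetCoord v : JetFun 𝒰 𝓘) = 0 := by
    intro v
    rw [jetCoord]
    split_ifs
    · exact evenDeriv_evenCoord a _
    · exact evenDeriv_oddCoord a _
  cases c with
  | inl i => exact h _
  | inr j =>
    change evenDeriv (0, a) (shiftθ j v) = 0
    rw [shiftθ]
    split_ifs
    · exact map_zero _
    · rw [map_smul, h, smul_zero]

/-- The coefficients of a total derivative do not involve the parameter, and the parameter
derivative commutes with every partial derivative. -/
theorem evenDeriv_totalD (a : W) (c : Fin n₀ ⊕ Fin n₁) (f : JetFun 𝒰 𝓘) :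
    evenDeriv (0, a) (totalD c f) = totalD c (evenDeriv (0, a) f) := by
  classical
  obtain ⟨s, hs⟩ := exists_totalD_eq_sum c f
  obtain ⟨u, hu⟩ := exists_totalD_eq_sum c (evenDeriv (0, a) f)
  rw [hs (s ∪ u) (by grind), hu (s ∪ u) (by grind), map_add, map_sum]
  congr 1
  · cases c with
    | inl i => exact evenDeriv_comm _ _ _
    | inr j => exact evenDeriv_oddDeriv _ _ _
  · refine Finset.sum_congr rfl fun v _ => ?_
    rw [evenDeriv_mul, evenDeriv_jetShift, zero_mul, zero_add, jetDeriv]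
    split_ifs
    · rw [evenDeriv_comm]
    · rw [evenDeriv_oddDeriv]

theorem eval_totalD_congr (c : Fin n₀ ⊕ Fin n₁) {f g : JetFun 𝒰 𝓘}
    {P : (EvenIdx n₀ n₁ m₀ m₁ → ℝ) × W} (hP : P ∈ domain 𝒰 𝓘)
    (h : ∀ᶠ P' in 𝓝 P, eval P' f = eval P' g) : eval P (totalD c f) = eval P (totalD c g) := by
  classical
  obtain ⟨s, hs⟩ := exists_totalD_eq_sum c f
  obtain ⟨u, hu⟩ := exists_totalD_eq_sum c g
  rw [hs (s ∪ u) (by grind), hu (s ∪ u) (by grind), map_add, map_add, map_sum, map_sum]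
  have hodd : ∀ v, eval P (oddDeriv v f) = eval P (oddDeriv v g) := by
    intro v
    rw [eval_oddDeriv, eval_oddDeriv, h.self_of_nhds]
  congr 1
  · cases c with
    | inl i => exact eval_evenDeriv_congr hP h _
    | inr j => exact hodd _
  · refine Finset.sum_congr rfl fun v _ => ?_
    rw [map_mul, map_mul, jetDeriv]
    split_ifs
    · rw [eval_evenDeriv_congr hP h]
    · rw [hodd]

theorem eval_totalD_freeze {W' : Type} [NormedAddCommGroup W'] [NormedSpace ℝ W'] (𝓙 : Opens W')
    (w₀ : 𝓘) (c : Fin n₀ ⊕ Fin n₁) (f : JetFun 𝒰 𝓘) {P : (EvenIdx n₀ n₁ m₀ m₁ → ℝ) × W'}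
    (hP : P ∈ domain 𝒰 𝓙) :
    eval P (totalD c (freeze 𝓙 w₀ f)) = eval P (freeze 𝓙 w₀ (totalD c f)) := by
  classical
  obtain ⟨s, hs⟩ := exists_totalD_eq_sum c f
  obtain ⟨u, hu⟩ := exists_totalD_eq_sum c (freeze 𝓙 w₀ f)
  rw [hs (s ∪ u) (by grind), hu (s ∪ u) (by grind), map_add, map_add, map_add, map_sum, map_sum,
    map_sum]
  have hodd : ∀ v, eval P (oddDeriv v (freeze 𝓙 w₀ f)) = eval P (freeze 𝓙 w₀ (oddDeriv v f)) := by
    intro v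
    rw [eval_oddDeriv, eval_freeze, eval_freeze, eval_oddDeriv]
  have hcoord : ∀ v, eval P (jetCoord v : JetFun 𝒰 𝓙) = eval P (freeze 𝓙 w₀ (jetCoord v : JetFun 𝒰 𝓘)) := by
    intro v
    rw [eval_freeze, jetCoord, jetCoord]
    split_ifs <;> rfl
  have hshift : ∀ v, eval P (jetShift c v : JetFun 𝒰 𝓙) = 
      eval P (freeze 𝓙 w₀ (jetShift c v : JetFun 𝒰 𝓘)) := by
    intro v
    cases c with
    | inl i => exact hcoord _
    | inr j =>
      change eval P (shiftθ j v) = eval P (freeze 𝓙 w₀ (shiftθ j v : JetFun 𝒰 𝓘))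
      rw [shiftθ, shiftθ]
      split_ifs
      · simp only [map_zero]
      · simp only [map_smul, hcoord]
  congr 1
  · cases c with
    | inl i => exact eval_evenDeriv_freeze 𝓙 w₀ f _ hP
    | inr j => exact hodd _
  · refine Finset.sum_congr rfl fun v _ => ?_
    rw [map_mul, map_mul, map_mul, hshift, jetDeriv, jetDeriv]
    split_ifs
    · rw [eval_evenDeriv_freeze 𝓙 w₀ f _ hP]
    · rw [hodd]

end TotalDerivative

end SuperZCR
end

noncomputable section
set_option linter.unusedSectionVars false

namespace SuperZCR

open scoped ContDiff Topology TensorProduct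
open TopologicalSpace (Opens)

/-! ### The ideal of the infinite prolongation and its stability -/

section Ideal

variable {n₀ n₁ m₀ m₁ r : ℕ} {W : Type} [NormedAddCommGroup W] [NormedSpace ℝ W]
variable {𝒰 : Opens (EvenIdx n₀ n₁ m₀ m₁ → ℝ)} {𝓘 : Opens W} (E : SuperPDE 𝒰 r)

theorem parity_freeze {W' : Type} [NormedAddCommGroup W'] [NormedSpace ℝ W'] (𝓙 : Opens W')
    (w₀ : 𝓘) (f : JetFun 𝒰 𝓘) : parity (freeze 𝓙 w₀ f) = freeze 𝓙 w₀ (parity f) :=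
  superFun_ext fun P => by simp only [eval_parity, eval_freeze]

variable {E} in
theorem SuperPDE.Consequence.homogeneous {f : JetFun 𝒰 (⊤ : Opens PUnit)} (hf : E.Consequence f) :
    parity f = f ∨ parity f = -f := by
  induction hf with
  | eqn l => exact E.homogeneous l
  | diff c f _ ih =>
    rw [parity_totalD]
    have hneg : totalD c (-f) = -totalD c f := map_neg (totalDₗ c) f
    rcases ih with ih | ih <;> rw [ih] <;> cases c <;> simp [baseSign, hneg]

variable {E} in
theorem SuperPDE.Consequence.mem_ideal {f : JetFun 𝒰 (⊤ : Opens PUnit)} (hf : E.Consequence f) :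
    freeze 𝓘 ⟨PUnit.unit, TopologicalSpace.Opens.mem_top _⟩ f ∈ E.ideal 𝓘 :=
  Ideal.subset_span ⟨f, hf, rfl⟩

@[elab_as_elim]
theorem SuperPDE.ideal_induction {P : ∀ f : JetFun 𝒰 𝓘, f ∈ E.ideal 𝓘 → Prop}
    (hgen : ∀ f (hf : E.Consequence f), P _ hf.mem_ideal)
    (h0 : P 0 (Submodule.zero_mem _))
    (hadd : ∀ f g hf hg, P f hf → P g hg → P (f + g) (Submodule.add_mem _ hf hg))
    (hmul : ∀ a f hf, P f hf → P (a * f) (Ideal.mul_mem_left _ a hf)) {f : JetFun 𝒰 𝓘}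
    (hf : f ∈ E.ideal 𝓘) : P f hf := by
  induction hf using Submodule.span_induction with
  | mem x hx =>
    obtain ⟨f, hf, rfl⟩ := hx
    exact hgen f hf
  | zero => exact h0
  | add x y _ _ hx hy => exact hadd x y _ _ hx hy
  | smul a x hx h => exact hmul a x hx h

/-- The generators are homogeneous, so each of them moves past a factor at the cost of a parity
twist of that factor; the left ideal is two-sided. -/
theorem SuperPDE.ideal_mul_right {f : JetFun 𝒰 𝓘} (hf : f ∈ E.ideal 𝓘) (g : JetFun 𝒰 𝓘) :
    f * g ∈ E.ideal 𝓘 := by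
  induction hf using E.ideal_induction with
  | hgen f hf =>
    rcases hf.homogeneous with h | h
    · rw [superComm_parity.even_mul (by rw [parity_freeze, h])]
      exact Ideal.mul_mem_left _ _ hf.mem_ideal
    · rw [superComm_parity.odd_mul (by rw [parity_freeze, h, map_neg])]
      exact Ideal.mul_mem_left _ _ hf.mem_ideal
  | h0 => rw [zero_mul]; exact Submodule.zero_mem _
  | hadd f f' _ _ h h' => rw [add_mul]; exact Submodule.add_mem _ h h'
  | hmul a f _ h => rw [mul_assoc]; exact Ideal.mul_mem_left _ _ h

theorem SuperPDE.ideal_parity {f : JetFun 𝒰 𝓘} (hf : f ∈ E.ideal 𝓘) : parity f ∈ E.ideal 𝓘 := by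
  induction hf using E.ideal_induction with
  | hgen f hf =>
    rw [parity_freeze]
    rcases hf.homogeneous with h | h <;> rw [h]
    · exact hf.mem_ideal
    · rw [map_neg]
      exact Submodule.neg_mem _ hf.mem_ideal
  | h0 => rw [map_zero]; exact Submodule.zero_mem _
  | hadd f f' _ _ h h' => rw [map_add]; exact Submodule.add_mem _ h h'
  | hmul a f _ h => rw [map_mul]; exact Ideal.mul_mem_left _ _ h

/-- The generators do not depend on the parameter, so only coefficients are differentiated. -/
theorem SuperPDE.ideal_evenDeriv {f : JetFun 𝒰 𝓘} (hf : f ∈ E.ideal 𝓘) (a : W) :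
    evenDeriv (0, a) f ∈ E.ideal 𝓘 := by
  induction hf using E.ideal_induction with
  | hgen f hf => rw [evenDeriv_freeze]; exact Submodule.zero_mem _
  | h0 => rw [map_zero]; exact Submodule.zero_mem _
  | hadd f f' _ _ h h' => rw [map_add]; exact Submodule.add_mem _ h h'
  | hmul b f hf h =>
    rw [evenDeriv_mul]
    exact Submodule.add_mem _ (Ideal.mul_mem_left _ _ hf) (Ideal.mul_mem_left _ _ h)

/-- Total derivatives send generators to generators. Equality is claimed on the domain only, since
freezing commutes with total derivatives only there. -/
theorem SuperPDE.ideal_totalD (c : Fin n₀ ⊕ Fin n₁) {f : JetFun 𝒰 𝓘} (hf : f ∈ E.ideal 𝓘) :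
    ∃ g ∈ E.ideal 𝓘, ∀ P ∈ domain 𝒰 𝓘, eval P (totalD c f) = eval P g := by
  induction hf using E.ideal_induction with
  | hgen f hf =>
    exact ⟨_, (hf.diff c f).mem_ideal, fun P hP => eval_totalD_freeze _ _ c f hP⟩
  | h0 => exact ⟨0, Submodule.zero_mem _, fun P _ => by rw [← totalDₗ_apply, map_zero]⟩
  | hadd f f' _ _ h h' =>
    obtain ⟨g, hg, hg'⟩ := h
    obtain ⟨k, hk, hk'⟩ := h'
    exact ⟨g + k, Submodule.add_mem _ hg hk, fun P hP => by
      rw [totalD_add, map_add, map_add, hg' P hP, hk' P hP]⟩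
  | hmul a f hf h =>
    obtain ⟨g, hg, hg'⟩ := h
    exact ⟨totalD c a * f + baseParity c a * g, Submodule.add_mem _ (Ideal.mul_mem_left _ _ hf)
      (Ideal.mul_mem_left _ _ hg), fun P hP => by
      rw [totalD_mul, map_add, map_add, map_mul _ (baseParity c a), map_mul _ (baseParity c a),
        hg' P hP]⟩

/-- The superfunctions that vanish on `ℰ^∞ × 𝓘` near the point `P`. -/
def SuperPDE.vanishing (𝓘 : Opens W) (P : (EvenIdx n₀ n₁ m₀ m₁ → ℝ) × W) : Ideal (JetFun 𝒰 𝓘) where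
  carrier := {f | E.VanishesNear f P}
  zero_mem' := ⟨0, Submodule.zero_mem _, Filter.Eventually.of_forall fun _ => rfl⟩
  add_mem' := by
    rintro f f' ⟨g, hg, h⟩ ⟨g', hg', h'⟩
    refine ⟨g + g', Submodule.add_mem _ hg hg', ?_⟩
    filter_upwards [h, h'] with P' h h'
    rw [map_add, map_add, h, h']
  smul_mem' := by
    rintro a f ⟨g, hg, h⟩
    refine ⟨a * g, Ideal.mul_mem_left _ _ hg, ?_⟩
    filter_upwards [h] with P' h
    rw [smul_eq_mul, map_mul, map_mul, h]

variable {E} {P : (EvenIdx n₀ n₁ m₀ m₁ → ℝ) × W}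

/-- Two-sidedness makes the quotient a ring, so that computations on `ℰ^∞` near a point become
identities in a matrix ring. -/
instance : (E.vanishing 𝓘 P).IsTwoSided where
  mul_mem_of_left := by
    rintro f a ⟨g, hg, h⟩
    refine ⟨g * a, E.ideal_mul_right hg a, ?_⟩
    filter_upwards [h] with P' h
    rw [map_mul, map_mul, h]

theorem SuperPDE.vanishing_congr {f g : JetFun 𝒰 𝓘} (h : ∀ᶠ P' in 𝓝 P, eval P' f = eval P' g) :
    f - g ∈ E.vanishing 𝓘 P := by
  refine ⟨0, Submodule.zero_mem _, ?_⟩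
  filter_upwards [h] with P' h
  rw [map_sub, h, sub_self, map_zero]

theorem SuperPDE.vanishing_parity {f : JetFun 𝒰 𝓘} (hf : f ∈ E.vanishing 𝓘 P) :
    parity f ∈ E.vanishing 𝓘 P := by
  obtain ⟨g, hg, h⟩ := hf
  refine ⟨parity g, E.ideal_parity hg, ?_⟩
  filter_upwards [h] with P' h
  rw [eval_parity, eval_parity, h]

theorem SuperPDE.vanishing_smul {f : JetFun 𝒰 𝓘} (hf : f ∈ E.vanishing 𝓘 P) (a : ℂ) :
    a • f ∈ E.vanishing 𝓘 P := by
  rw [← algebraMap_smul (JetFun 𝒰 𝓘) a f]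
  exact Submodule.smul_mem _ _ hf

theorem SuperPDE.vanishing_evenDeriv (hP : P ∈ domain 𝒰 𝓘) {f : JetFun 𝒰 𝓘}
    (hf : f ∈ E.vanishing 𝓘 P) (a : W) : evenDeriv (0, a) f ∈ E.vanishing 𝓘 P := by
  obtain ⟨g, hg, h⟩ := hf
  refine ⟨_, E.ideal_evenDeriv hg a, ?_⟩
  filter_upwards [h.eventually_nhds, isOpen_domain.mem_nhds hP] with P' h hP'
  exact eval_evenDeriv_congr hP' h _

theorem SuperPDE.vanishing_totalD (hP : P ∈ domain 𝒰 𝓘) (c : Fin n₀ ⊕ Fin n₁) {f : JetFun 𝒰 𝓘}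
    (hf : f ∈ E.vanishing 𝓘 P) : totalD c f ∈ E.vanishing 𝓘 P := by
  obtain ⟨g, hg, h⟩ := hf
  obtain ⟨g', hg', h'⟩ := E.ideal_totalD c hg
  refine ⟨g', hg', ?_⟩
  filter_upwards [h.eventually_nhds, isOpen_domain.mem_nhds hP] with P' h hP'
  rw [← h' P' hP']
  exact eval_totalD_congr c hP' h

end Ideal

/-! ### Matrix derivatives and the disappearance of signs for even matrices -/

section Matrices

variable {n₀ n₁ m₀ m₁ p q r : ℕ} {W : Type} [NormedAddCommGroup W] [NormedSpace ℝ W]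
variable {𝒰 : Opens (EvenIdx n₀ n₁ m₀ m₁ → ℝ)} {𝓘 : Opens W}

theorem tens_eq_superTens (A : SqMat p q ℂ) (μ : JetFun 𝒰 𝓘) :
    tens A μ = superTens parity A μ := by
  ext i j
  cases j <;> rfl

theorem matParity_eq (M : SMat p q 𝒰 𝓘) : matParity M = superParity parity M := rfl

theorem gMat_eq (g : MatrixLieSuperalgebra p q) : gMat g 𝒰 𝓘 = gSpan parity g := by
  simp only [gMat, gSpan, tens_eq_superTens]

theorem evenPart_of_even {M : SMat p q 𝒰 𝓘} (hM : matParity M = M) : evenPart M = M := by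
  rw [evenPart, hM, ← two_smul ℂ M, smul_smul]
  norm_num

theorem oddPart_of_even {M : SMat p q 𝒰 𝓘} (hM : matParity M = M) : oddPart M = 0 := by
  rw [oddPart, hM, sub_self, smul_zero]

theorem passThrough_of_even {M : SMat p q 𝒰 𝓘} (hM : matParity M = M) (c : Fin n₀ ⊕ Fin n₁) :
    passThrough c M = M := by
  cases c
  · rfl
  · exact hM

theorem bracketFormMat_of_even (α : OneForm p q 𝒰 𝓘) {Q : SMat p q 𝒰 𝓘} (hQ : matParity Q = Q)
    (c : Fin n₀ ⊕ Fin n₁) : bracketFormMat α Q c = α c * Q - Q * α c := by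
  have h0 : matParity (0 : SMat p q 𝒰 𝓘) = 0 := by
    rw [matParity_eq]; ext; simp [superParity]
  rw [bracketFormMat, evenPart_of_even hQ, oddPart_of_even hQ]
  change α c * Q - (passThrough c Q * α c + passThrough c 0 * formParity α c) = _
  rw [passThrough_of_even hQ, passThrough_of_even h0, zero_mul, add_zero]

theorem gauge_of_even {S : SMat p q 𝒰 𝓘} (hS : matParity S = S) (T : SMat p q 𝒰 𝓘)
    (α : OneForm p q 𝒰 𝓘) (c : Fin n₀ ⊕ Fin n₁) :
    gauge S T α c = matD c S * T + S * α c * T := by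
  change matD c S * T + passThrough c S * α c * T = _
  rw [passThrough_of_even hS]

theorem matD_apply (c : Fin n₀ ⊕ Fin n₁) (M : SMat p q 𝒰 𝓘) (i j : Fin p ⊕ Fin q) :
    matD c M i j = Sum.elim (fun _ => (1 : ℂ)) (fun _ => idxSign i) c • totalD c (M i j) := rfl

theorem matD_sub (c : Fin n₀ ⊕ Fin n₁) (M N : SMat p q 𝒰 𝓘) :
    matD c (M - N) = matD c M - matD c N := by
  ext i j
  rw [Matrix.sub_apply, matD_apply, matD_apply, matD_apply, Matrix.sub_apply, ← totalDₗ_apply,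
    map_sub, smul_sub]
  rfl

/-- The total derivative of an even matrix obeys the unsigned Leibniz rule: the row sign in `matD`
compensates the sign from moving `D_θ` past an entry. -/
theorem matD_mul (c : Fin n₀ ⊕ Fin n₁) {M : SMat p q 𝒰 𝓘} (hM : matParity M = M)
    (N : SMat p q 𝒰 𝓘) : matD c (M * N) = matD c M * N + M * matD c N := by
  ext i j
  rw [Matrix.add_apply, matD_apply, Matrix.mul_apply, Matrix.mul_apply, Matrix.mul_apply,
    ← totalDₗ_apply, map_sum, Finset.smul_sum, ← Finset.sum_add_distrib]
  refine Finset.sum_congr rfl fun k _ => ?_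
  rw [totalDₗ_apply, totalD_mul, matD_apply, matD_apply, smul_add, smul_mul_assoc]
  congr 1
  cases c with
  | inl a => rw [Sum.elim_inl, Sum.elim_inl, one_smul, one_smul]; rfl
  | inr a =>
    have h : (idxSign i * idxSign k) • parity (M i k) = M i k := congrFun (congrFun hM i) k
    -- Evenness turns the parity twist of the entry `(i, k)` into the product of the two index
    -- signs, which exchanges the row sign `i` for the row sign `k` of the second factor.
    have h' : idxSign i • parity (M i k) = idxSign k • M i k := by
      conv_rhs => rw [← h, smul_smul]
      congr 1
      linear_combination -idxSign i * idxSign_mul_self k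
    rw [Sum.elim_inr, Sum.elim_inr]
    change idxSign i • (parity (M i k) * _) = _
    rw [← smul_mul_assoc, h', smul_mul_assoc, mul_smul_comm]

theorem matD_one (c : Fin n₀ ⊕ Fin n₁) : matD c (1 : SMat p q 𝒰 𝓘) = 0 := by
  have h := matD_mul (p := p) (q := q) (𝒰 := 𝒰) (𝓘 := 𝓘) c
    (by rw [matParity_eq, superParity_one] : matParity (1 : SMat p q 𝒰 𝓘) = 1) 1
  rw [mul_one, mul_one, one_mul] at h
  exact left_eq_add.1 h

/-- The derivative of a matrix along an even direction. -/
def matDeriv (d : (EvenIdx n₀ n₁ m₀ m₁ → ℝ) × W) (M : SMat p q 𝒰 𝓘) : SMat p q 𝒰 𝓘 :=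
  M.map (evenDeriv d)

theorem matDeriv_mul (d : (EvenIdx n₀ n₁ m₀ m₁ → ℝ) × W) (M N : SMat p q 𝒰 𝓘) :
    matDeriv d (M * N) = matDeriv d M * N + M * matDeriv d N := by
  ext i j
  simp only [matDeriv, Matrix.map_apply, Matrix.mul_apply, Matrix.add_apply, map_sum,
    evenDeriv_mul, Finset.sum_add_distrib]

theorem matDeriv_add (d : (EvenIdx n₀ n₁ m₀ m₁ → ℝ) × W) (M N : SMat p q 𝒰 𝓘) :
    matDeriv d (M + N) = matDeriv d M + matDeriv d N := by
  ext i j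
  simp only [matDeriv, Matrix.map_apply, Matrix.add_apply, map_add]

theorem matDeriv_sub (d : (EvenIdx n₀ n₁ m₀ m₁ → ℝ) × W) (M N : SMat p q 𝒰 𝓘) :
    matDeriv d (M - N) = matDeriv d M - matDeriv d N := by
  ext i j
  simp only [matDeriv, Matrix.map_apply, Matrix.sub_apply, map_sub]

theorem matDeriv_one (d : (EvenIdx n₀ n₁ m₀ m₁ → ℝ) × W) :
    matDeriv d (1 : SMat p q 𝒰 𝓘) = 0 := by
  have h := matDeriv_mul (p := p) (q := q) (𝒰 := 𝒰) (𝓘 := 𝓘) d 1 1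
  rw [mul_one, mul_one, one_mul] at h
  exact left_eq_add.1 h

theorem matDeriv_freezeMat {W' : Type} [NormedAddCommGroup W'] [NormedSpace ℝ W'] (𝓙 : Opens W')
    (w₀ : 𝓘) (M : SMat p q 𝒰 𝓘) (a : W') : matDeriv (0, a) (freezeMat 𝓙 w₀ M) = 0 := by
  ext i j
  exact evenDeriv_freeze _ _ _ _

theorem matDeriv_matD (a : W) (c : Fin n₀ ⊕ Fin n₁) (M : SMat p q 𝒰 𝓘) :
    matDeriv (0, a) (matD c M) = matD c (matDeriv (0, a) M) := by
  ext i j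
  rw [matDeriv, Matrix.map_apply, matD_apply, map_smul, evenDeriv_totalD]
  rfl

theorem matParity_matDeriv (d : (EvenIdx n₀ n₁ m₀ m₁ → ℝ) × W) (M : SMat p q 𝒰 𝓘) :
    matParity (matDeriv d M) = matDeriv d (matParity M) := by
  ext i j
  simp only [matParity, matDeriv, Matrix.map_apply, Matrix.of_apply, parity_evenDeriv, map_smul]

end Matrices

/-! ### Germs of matrices on the infinite prolongation -/

section Reduction

variable {n₀ n₁ m₀ m₁ p q r : ℕ} {W : Type} [NormedAddCommGroup W] [NormedSpace ℝ W]
variable {𝒰 : Opens (EvenIdx n₀ n₁ m₀ m₁ → ℝ)} {𝓘 : Opens W} (E : SuperPDE 𝒰 r)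

/-- The restriction of matrices to `ℰ^∞ × 𝓘` near the point `P`. -/
def SuperPDE.germ (P : (EvenIdx n₀ n₁ m₀ m₁ → ℝ) × W) :
    SMat p q 𝒰 𝓘 →+* SqMat p q (JetFun 𝒰 𝓘 ⧸ E.vanishing 𝓘 P) :=
  (Ideal.Quotient.mk (E.vanishing 𝓘 P)).mapMatrix

variable {E} {P : (EvenIdx n₀ n₁ m₀ m₁ → ℝ) × W}

theorem SuperPDE.germ_eq_zero {M : SMat p q 𝒰 𝓘} :
    E.germ P M = 0 ↔ ∀ i j, M i j ∈ E.vanishing 𝓘 P := by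
  rw [← Matrix.ext_iff]
  exact forall₂_congr fun i j => Ideal.Quotient.eq_zero_iff_mem

theorem SuperPDE.germ_eq {M N : SMat p q 𝒰 𝓘} :
    E.germ P M = E.germ P N ↔ ∀ i j, E.VanishesNear (M i j - N i j) P := by
  rw [← sub_eq_zero, ← map_sub, SuperPDE.germ_eq_zero]
  rfl

theorem SuperPDE.matEq_iff {M N : SMat p q 𝒰 𝓘} :
    E.MatEq M N ↔ ∀ P ∈ domain 𝒰 𝓘, E.germ P M = E.germ P N := by
  simp only [SuperPDE.germ_eq]
  exact ⟨fun h P hP i j => h i j P hP.1 hP.2, fun h i j P h1 h2 => h P ⟨h1, h2⟩ i j⟩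

theorem SuperPDE.germ_congr {M N : SMat p q 𝒰 𝓘}
    (h : ∀ᶠ P' in 𝓝 P, M.map (eval P') = N.map (eval P')) : E.germ P M = E.germ P N :=
  SuperPDE.germ_eq.2 fun i j => SuperPDE.vanishing_congr (h.mono fun _ h =>
    congrFun (congrFun h i) j)

theorem SuperPDE.germ_matD (hP : P ∈ domain 𝒰 𝓘) (c : Fin n₀ ⊕ Fin n₁) {M N : SMat p q 𝒰 𝓘}
    (h : E.germ P M = E.germ P N) : E.germ P (matD c M) = E.germ P (matD c N) := by
  rw [← sub_eq_zero, ← map_sub, SuperPDE.germ_eq_zero] at h ⊢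
  intro i j
  rw [← matD_sub, matD_apply]
  exact SuperPDE.vanishing_smul (SuperPDE.vanishing_totalD hP c (h i j)) _

theorem SuperPDE.germ_matDeriv (hP : P ∈ domain 𝒰 𝓘) (a : W) {M N : SMat p q 𝒰 𝓘}
    (h : E.germ P M = E.germ P N) : E.germ P (matDeriv (0, a) M) = E.germ P (matDeriv (0, a) N) := by
  rw [← sub_eq_zero, ← map_sub, SuperPDE.germ_eq_zero] at h ⊢
  intro i j
  rw [← matDeriv_sub]
  exact SuperPDE.vanishing_evenDeriv hP (h i j) a

/-- The extension acts on entries through parity twists and complex combinations, which preserve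
vanishing. The projection onto `𝔤` can therefore be applied to equalities that hold on `ℰ^∞` only.
-/
theorem SuperPDE.germ_superExtend (π : SqMat p q ℂ →ₗ[ℂ] SqMat p q ℂ) {M N : SMat p q 𝒰 𝓘}
    (h : E.germ P M = E.germ P N) :
    E.germ P (superExtend parity π M) = E.germ P (superExtend parity π N) := by
  rw [← sub_eq_zero, ← map_sub, SuperPDE.germ_eq_zero] at h ⊢
  intro k l
  have htw : ∀ (j : Fin p ⊕ Fin q) (f : JetFun 𝒰 𝓘), f ∈ E.vanishing 𝓘 P →
      twist parity j f ∈ E.vanishing 𝓘 P := by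
    intro j f hf
    cases j
    · exact hf
    · exact SuperPDE.vanishing_parity hf
  rw [← map_sub]
  simp only [superExtend, LinearMap.coe_mk, AddHom.coe_mk, Matrix.sum_apply, superTens,
    Matrix.of_apply]
  exact Submodule.sum_mem _ fun i _ => Submodule.sum_mem _ fun j _ =>
    SuperPDE.vanishing_smul (htw _ _ (htw _ _ (h i j))) _

end Reduction

end SuperZCR
end

noncomputable section
set_option linter.unusedSectionVars false

namespace SuperZCR

open scoped ContDiff Topology TensorProduct
open TopologicalSpace (Opens)

/-! ### Finite-dimensional models and representatives -/

section Model

variable {p q : ℕ} {o : Type}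

/-- Matrices over the Grassmann algebra with finitely many generators, as a normed algebra. -/
def Model (p q : ℕ) (T : Finset o) : Type := SqMat p q (Grassmann T)

instance (T : Finset o) : Ring (Model p q T) := inferInstanceAs (Ring (SqMat p q (Grassmann T)))

instance (T : Finset o) : Algebra ℂ (Model p q T) :=
  inferInstanceAs (Algebra ℂ (SqMat p q (Grassmann T)))

instance (T : Finset o) : FiniteDimensional ℂ (Model p q T) := by
  have := grassmann_finiteDimensional (o := T)
  exact inferInstanceAs (FiniteDimensional ℂ (SqMat p q (Grassmann T)))

-- The left regular representation is faithful, so the operator norm of complex matrices pulls back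
-- to a submultiplicative norm.
open scoped Matrix.Norms.Operator in
instance (T : Finset o) : NormedRing (Model p q T) :=
  NormedRing.induced _ _ (Algebra.leftMulMatrix (Module.finBasis ℂ (Model p q T)))
    (Algebra.leftMulMatrix_injective _)

open scoped Matrix.Norms.Operator in
instance (T : Finset o) : NormedAlgebra ℂ (Model p q T) :=
  NormedAlgebra.induced ℂ _ _ (Algebra.leftMulMatrix (Module.finBasis ℂ (Model p q T)))

instance (T : Finset o) : CompleteSpace (Model p q T) := FiniteDimensional.complete ℂ _

/-- The matrix of Grassmann numbers given by an element of the model. -/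
def Model.toMat (T : Finset o) : Model p q T ≃ₐ[ℂ] SqMat p q (Grassmann T) := AlgEquiv.refl

/-- The inclusion of the matrices that involve only finitely many generators. -/
def incl (T : Finset o) : Model p q T →ₐ[ℂ] SqMat p q (Grassmann o) :=
  (grassmannMap ((↑) : T → o)).mapMatrix.comp (Model.toMat T).toAlgHom

theorem incl_apply (T : Finset o) (X : Model p q T) :
    incl T X = (Model.toMat T X).map (grassmannMap ((↑) : T → o)) := rfl

/-- The retraction onto the Grassmann algebra with finitely many generators. -/
def grassmannRetract (T : Finset o) : Grassmann o →ₐ[ℂ] Grassmann T :=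
  ExteriorAlgebra.map (Finsupp.lcomapDomain ((↑) : T → o) Subtype.val_injective)

theorem grassmannRetract_map (T : Finset o) (x : Grassmann T) :
    grassmannRetract T (grassmannMap ((↑) : T → o) x) = x :=
  ExteriorAlgebra.leftInverse_map_iff.2
    (Finsupp.leftInverse_lcomapDomain_mapDomain ((↑) : T → o) Subtype.val_injective) x

theorem grassmannRetract_involute (T : Finset o) (x : Grassmann o) :
    grassmannRetract T (CliffordAlgebra.involute x) =
      CliffordAlgebra.involute (grassmannRetract T x) := by
  induction x using CliffordAlgebra.induction with
  | algebraMap r => simp only [AlgHom.commutes]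
  | ι w =>
    have : ∀ w, grassmannRetract T (CliffordAlgebra.ι 0 w) =
        CliffordAlgebra.ι 0 (Finsupp.lcomapDomain ((↑) : T → o) Subtype.val_injective w) :=
      fun w => ExteriorAlgebra.map_apply_ι _ w
    rw [CliffordAlgebra.involute_ι, map_neg, this, CliffordAlgebra.involute_ι]
  | mul a b ha hb => simp only [map_mul, ha, hb]
  | add a b ha hb => simp only [map_add, ha, hb]

theorem incl_injective (T : Finset o) :
    Function.Injective (incl T : Model p q T → SqMat p q (Grassmann o)) := by
  intro X Y h
  refine (Model.toMat T).injective ?_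
  have := congrArg (fun M => M.map (grassmannRetract T)) h
  simpa [incl_apply, Matrix.map_map, Function.comp_def, grassmannRetract_map] using this

/-- The even `𝔤`-matrices over a Grassmann algebra. -/
def IsEvenG (g : MatrixLieSuperalgebra p q) (X : SqMat p q (Grassmann o)) : Prop :=
  X ∈ gSpan CliffordAlgebra.involute g ∧ superParity CliffordAlgebra.involute X = X

/-- Both the inclusion of finitely many generators and the retraction that kills the others commute
with parity, and so preserve even `𝔤`-matrices. -/
theorem isEvenG_incl {g : MatrixLieSuperalgebra p q} {T : Finset o} {X : Model p q T} :
    IsEvenG g (incl T X) ↔ IsEvenG g (Model.toMat T X) := by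
  constructor
  · rintro ⟨h1, h2⟩
    have e : (incl T X).map (grassmannRetract T) = Model.toMat T X := by
      simp [incl_apply, Matrix.map_map, Function.comp_def, grassmannRetract_map]
    rw [← e]
    refine ⟨gSpan_map (grassmannRetract_involute T) h1, ?_⟩
    rw [← superParity_map (grassmannRetract_involute T), h2]
  · rintro ⟨h1, h2⟩
    refine ⟨gSpan_map (grassmannMap_involute _) h1, ?_⟩
    rw [incl_apply, ← superParity_map (grassmannMap_involute _), h2]

/-- The decomposition of the model into the bodies and the souls of even `𝔤`-matrices and a
complement. -/
theorem exists_model_projections (g : MatrixLieSuperalgebra p q) (T : Finset o) :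
    ∃ (B : Model p q T →L[ℝ] SqMat p q ℂ) (p₀ p₁ π : Model p q T →L[ℝ] Model p q T),
      (∀ X, incl T (p₀ X) = (B X).map (algebraMap ℂ (Grassmann o))) ∧
      (∀ X, B X ∈ g.carrier ∧ constParity (B X) = B X) ∧
      (∃ n, ∀ X, p₁ X ^ n = 0) ∧
      (∀ X, p₀ X + p₁ X + π X = X) ∧ (∀ X, π (p₀ X) = 0) ∧ (∀ X, π (p₁ X) = 0) ∧
      (∀ X, π (π X) = π X) ∧ (∀ X, π X = 0 ↔ IsEvenG g (incl T X)) ∧ KerIsLie π := by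
  obtain ⟨B, P₀, P₁, K, h0, hB, h1, hsum, hK0, hK1, hKK, hK⟩ := exists_chart_projections
    (p := p) (q := q) (superComm_grassmann (o := T)) (β := body) body_involute g
  obtain ⟨F, n, hF1, hF, hFn⟩ := exists_filtration (o := T)
  let e := (Model.toMat (p := p) (q := q) T).toLinearMap
  let e' := (Model.toMat (p := p) (q := q) T).symm.toLinearMap
  let c : (SqMat p q (Grassmann T) →ₗ[ℂ] SqMat p q (Grassmann T)) →
      (Model p q T →L[ℝ] Model p q T) :=
    fun A => (LinearMap.toContinuousLinearMap (e' ∘ₗ A ∘ₗ e)).restrictScalars ℝ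
  have hc : ∀ A X, c A X = (Model.toMat T).symm (A (Model.toMat T X)) := fun A X => rfl
  have hK' : ∀ X, c K X = 0 ↔ IsEvenG g (Model.toMat T X) := by
    intro X
    rw [hc, map_eq_zero_iff _ (Model.toMat T).symm.injective]
    exact hK _
  refine ⟨(LinearMap.toContinuousLinearMap (B ∘ₗ e)).restrictScalars ℝ, c P₀, c P₁, c K,
    fun X => ?_, fun X => hB _, ⟨n + 1, fun X => ?_⟩, fun X => hsum _, fun X => hK0 _, fun X => hK1 _,
    fun X => hKK _, fun X => by rw [hK', isEvenG_incl], fun X Y hX hY => ?_⟩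
  · rw [hc, incl_apply, AlgEquiv.apply_symm_apply, h0]
    ext i j
    exact AlgHom.commutes _ _
  · rw [hc, ← map_pow, map_eq_zero_iff _ (Model.toMat T).symm.injective]
    refine Matrix.ext fun i j => ?_
    have := map_body_pow_mem hF1 hF (h1 (Model.toMat T X)) n i j
    rwa [hFn, Submodule.mem_bot] at this
  · rw [hK'] at hX hY ⊢
    rw [map_sub, map_mul, map_mul]
    refine ⟨commutator_mem_gSpan superComm_grassmann hX.1 hX.2 hY.1 hY.2, ?_⟩
    rw [superParity_sub, superParity_mul, superParity_mul, hX.2, hY.2]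

end Model

section Representatives

variable {κ o W : Type} [NormedAddCommGroup W] [NormedSpace ℝ W]
variable {𝒰 : Opens (κ → ℝ)} {𝓘 : Opens W}

theorem restr_add_smul (T : Finset κ) (P d : (κ → ℝ) × W) (t : ℝ) :
    restr T (P + t • d) = restr T P + t • restr T d := rfl

theorem continuous_restr (T : Finset κ) :
    Continuous (restr T : (κ → ℝ) × W → (T → ℝ) × W) := by
  unfold restr
  fun_prop

/-- The map `s`, which fills the missing coordinates with those of `P`, is a continuous section
through `P`. Hence local statements about finitely many coordinates may be made either on the jet
space or in the finite-dimensional space. -/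
theorem map_nhds_restr (T : Finset κ) (P : (κ → ℝ) × W) :
    Filter.map (restr T) (𝓝 P) = 𝓝 (restr T P) := by
  classical
  let s : (T → ℝ) × W → (κ → ℝ) × W :=
    fun z => (fun c => if h : c ∈ T then z.1 ⟨c, h⟩ else P.1 c, z.2)
  have hs : Continuous s := by
    refine Continuous.prodMk (continuous_pi fun c => ?_) continuous_snd
    by_cases h : c ∈ T
    · simp only [h, dif_pos]
      fun_prop
    · simp only [h, dif_neg, not_false_eq_true]
      fun_prop
  have hsP : s (restr T P) = P := by
    refine Prod.ext (funext fun c => ?_) rfl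
    by_cases h : c ∈ T <;> simp [s, restr, h]
  have hrs : ∀ z, restr T (s z) = z := fun z => by
    refine Prod.ext (funext fun c => ?_) rfl
    simp [s, restr]
  refine le_antisymm ((continuous_restr T).tendsto P) ?_
  have h1 := hs.tendsto (restr T P)
  rw [hsP] at h1
  calc 𝓝 (restr T P) = Filter.map (restr T) (Filter.map s (𝓝 (restr T P))) := by
        rw [Filter.map_map]
        simp [Function.comp_def, hrs]
    _ ≤ _ := Filter.map_mono h1

theorem eventually_restr {T : Finset κ} {P : (κ → ℝ) × W} {Q : (T → ℝ) × W → Prop} :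
    (∀ᶠ P' in 𝓝 P, Q (restr T P')) ↔ ∀ᶠ z in 𝓝 (restr T P), Q z := by
  rw [← map_nhds_restr, Filter.eventually_map]

theorem isOpenMap_restr (T : Finset κ) :
    IsOpenMap (restr T : (κ → ℝ) × W → (T → ℝ) × W) :=
  IsOpenMap.of_nhds_le fun P => (map_nhds_restr T P).ge

/-- The smooth function with a given representative. -/
def smoothOf (𝒰 : Opens (κ → ℝ)) (𝓘 : Opens W) (T : Finset κ) (g : (T → ℝ) × W → ℂ)
    (hg : ∀ P ∈ domain 𝒰 𝓘, ContDiffAt ℝ ∞ g (restr T P)) : smoothFun 𝒰 𝓘 :=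
  ⟨fun P => g (restr T P), T, g, fun P h1 h2 => ⟨hg P ⟨h1, h2⟩, rfl⟩⟩

theorem exists_superFun_representative (f : SuperFun o 𝒰 𝓘) :
    ∃ (S : Finset κ) (T : Finset o), ∀ S' T', S ⊆ S' → T ⊆ T' →
      ∃ G : (S' → ℝ) × W → Grassmann T', ∀ P ∈ domain 𝒰 𝓘,
        (∀ φ : Grassmann T' →ₗ[ℂ] ℂ, ContDiffAt ℝ ∞ (fun z => φ (G z)) (restr S' P)) ∧
        eval P f = grassmannMap ((↑) : T' → o) (G (restr S' P)) := by
  classical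
  induction f using SuperFun.induction_on with
  | h0 => exact ⟨∅, ∅, fun S' T' _ _ => ⟨fun _ => 0, fun P _ => ⟨fun φ => contDiffAt_const, by simp⟩⟩⟩
  | ht f x =>
    obtain ⟨S, g, hg⟩ := f.2
    obtain ⟨T, hT⟩ := exists_finset_grassmann x
    refine ⟨S, T, fun S' T' hS' hT' => ?_⟩
    obtain ⟨g', hg'⟩ := IsSmooth.enlarge hS' hg
    obtain ⟨y, hy⟩ := hT T' hT'
    have hy : grassmannMap ((↑) : T' → o) y = x := hy
    refine ⟨fun z => g' z • y, fun P hP => ⟨fun φ => ?_, ?_⟩⟩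
    · simp only [map_smul, smul_eq_mul]
      exact (hg' P hP.1 hP.2).1.mul contDiffAt_const
    · rw [eval_superTmul, map_smul, hy, (hg' P hP.1 hP.2).2]
  | ha f g hf hg =>
    obtain ⟨S, T, h⟩ := hf
    obtain ⟨S₁, T₁, h₁⟩ := hg
    refine ⟨S ∪ S₁, T ∪ T₁, fun S' T' hS' hT' => ?_⟩
    obtain ⟨G, hG⟩ := h S' T' (Finset.union_subset_left hS') (Finset.union_subset_left hT')
    obtain ⟨G₁, hG₁⟩ := h₁ S' T' (Finset.union_subset_right hS') (Finset.union_subset_right hT')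
    refine ⟨fun z => G z + G₁ z, fun P hP => ⟨fun φ => ?_, ?_⟩⟩
    · simp only [map_add]
      exact ((hG P hP).1 φ).add ((hG₁ P hP).1 φ)
    · rw [map_add, map_add, (hG P hP).2, (hG₁ P hP).2]

end Representatives

section MatrixRepresentatives

variable {n₀ n₁ m₀ m₁ p q : ℕ} {W : Type} [NormedAddCommGroup W] [NormedSpace ℝ W]
variable {𝒰 : Opens (EvenIdx n₀ n₁ m₀ m₁ → ℝ)} {𝓘 : Opens W}

theorem contDiffAt_model {o : Type} {T : Finset o} {Z : Type} [NormedAddCommGroup Z]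
    [NormedSpace ℝ Z] {G : Z → Model p q T} {z : Z}
    (h : ∀ φ : Model p q T →ₗ[ℂ] ℂ, ContDiffAt ℝ ∞ (fun z => φ (G z)) z) : ContDiffAt ℝ ∞ G z := by
  let b := Module.finBasis ℂ (Model p q T)
  have : G = fun z => ∑ i, b.coord i (G z) • b i := by
    funext z
    simp [b.sum_repr]
  rw [this]
  exact ContDiffAt.sum fun i _ => (h _).smul contDiffAt_const

/-- The function `G` represents the matrix `M` on `𝒰 × 𝓘`. -/
def Represents {S : Finset (EvenIdx n₀ n₁ m₀ m₁)} {T : Finset (OddIdx n₀ n₁ m₀ m₁)}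
    (G : (S → ℝ) × W → Model p q T) (M : SMat p q 𝒰 𝓘) : Prop :=
  ∀ P ∈ domain 𝒰 𝓘, ContDiffAt ℝ ∞ G (restr S P) ∧ M.map (eval P) = incl T (G (restr S P))

theorem exists_represents (M : SMat p q 𝒰 𝓘) :
    ∃ (S : Finset (EvenIdx n₀ n₁ m₀ m₁)) (T : Finset (OddIdx n₀ n₁ m₀ m₁)), ∀ S' T', S ⊆ S' →
      T ⊆ T' → ∃ G : (S' → ℝ) × W → Model p q T', Represents G M := by
  classical
  choose S T h using fun i j => exists_superFun_representative (M i j)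
  refine ⟨Finset.univ.biUnion fun i => Finset.univ.biUnion fun j => S i j,
    Finset.univ.biUnion fun i => Finset.univ.biUnion fun j => T i j, fun S' T' hS hT => ?_⟩
  have hS' : ∀ i j, S i j ⊆ S' := fun i j => (Finset.subset_biUnion_of_mem
    (fun j => S i j) (Finset.mem_univ j)).trans ((Finset.subset_biUnion_of_mem
    (fun i => Finset.univ.biUnion fun j => S i j) (Finset.mem_univ i)).trans hS)
  have hT' : ∀ i j, T i j ⊆ T' := fun i j => (Finset.subset_biUnion_of_mem
    (fun j => T i j) (Finset.mem_univ j)).trans ((Finset.subset_biUnion_of_mem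
    (fun i => Finset.univ.biUnion fun j => T i j) (Finset.mem_univ i)).trans hT)
  choose G hG using fun i j => h i j S' T' (hS' i j) (hT' i j)
  refine ⟨fun z => (Model.toMat T').symm (Matrix.of fun i j => G i j z), fun P hP => ⟨?_, ?_⟩⟩
  · refine contDiffAt_model fun φ => ?_
    have : (fun z => φ ((Model.toMat T').symm (Matrix.of fun i j => G i j z))) = fun z =>
        ∑ i, ∑ j, (φ ∘ₗ (Model.toMat T').symm.toLinearMap ∘ₗ
          Matrix.singleLinearMap ℂ i j) (G i j z) := by
      funext z
      conv_lhs => rw [Matrix.matrix_eq_sum_single (Matrix.of fun i j => G i j z)]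
      simp only [map_sum]
      rfl
    rw [this]
    exact ContDiffAt.sum fun i _ => ContDiffAt.sum fun j _ => (hG i j P hP).1 _
  · ext i j
    rw [Matrix.map_apply, (hG i j P hP).2]
    rfl

/-- Every function into the model that is smooth on `𝒰 × 𝓘` represents a matrix of
superfunctions. -/
theorem exists_of_represents {S : Finset (EvenIdx n₀ n₁ m₀ m₁)}
    {T : Finset (OddIdx n₀ n₁ m₀ m₁)} {G : (S → ℝ) × W → Model p q T}
    (hG : ∀ P ∈ domain 𝒰 𝓘, ContDiffAt ℝ ∞ G (restr S P)) :
    ∃ M : SMat p q 𝒰 𝓘, ∀ P, M.map (eval P) = incl T (G (restr S P)) := by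
  let b := Module.finBasis ℂ (Model p q T)
  have hb : ∀ i, ∀ P ∈ domain 𝒰 𝓘, ContDiffAt ℝ ∞ (fun z => b.coord i (G z)) (restr S P) := by
    intro i P hP
    exact ((LinearMap.toContinuousLinearMap (b.coord i)).restrictScalars ℝ).contDiff.contDiffAt.comp
      _ (hG P hP)
  refine ⟨Matrix.of fun k l => ∑ i, superTmul (smoothOf 𝒰 𝓘 S _ (hb i)) (incl T (b i) k l),
    fun P => ?_⟩
  ext k l
  rw [Matrix.map_apply, Matrix.of_apply, map_sum]
  conv_rhs => rw [← b.sum_repr (G (restr S P)), map_sum, Matrix.sum_apply]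
  refine Finset.sum_congr rfl fun i _ => ?_
  rw [eval_superTmul, map_smul, Matrix.smul_apply]
  rfl

/-- Derivatives of superfunction matrices become Fréchet derivatives of representatives. Only local
agreement is asked, since it is applied to products of exponentials that are represented near a
point. -/
theorem map_eval_matDeriv {S : Finset (EvenIdx n₀ n₁ m₀ m₁)}
    {T : Finset (OddIdx n₀ n₁ m₀ m₁)} {G : (S → ℝ) × W → Model p q T} {M : SMat p q 𝒰 𝓘}
    {P : (EvenIdx n₀ n₁ m₀ m₁ → ℝ) × W} (hP : P ∈ domain 𝒰 𝓘)
    (hG : DifferentiableAt ℝ G (restr S P))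
    (hM : ∀ᶠ P' in 𝓝 P, M.map (eval P') = incl T (G (restr S P')))
    (d : (EvenIdx n₀ n₁ m₀ m₁ → ℝ) × W) :
    (matDeriv d M).map (eval P) = incl T (fderiv ℝ G (restr S P) (restr S d)) := by
  ext i j
  refine grassmann_ext fun φ => ?_
  have h1 := eval_evenDeriv_hasDerivAt φ d (M i j) hP
  let A : Model p q T →L[ℝ] ℂ := (LinearMap.toContinuousLinearMap
    (φ ∘ₗ Matrix.entryLinearMap ℂ (Grassmann (OddIdx n₀ n₁ m₀ m₁)) i j ∘ₗ
      (incl T).toLinearMap)).restrictScalars ℝ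
  have hA : ∀ X, A X = φ (incl T X i j) := fun X => rfl
  have hline : HasDerivAt (fun t : ℝ => restr S P + t • restr S d) (restr S d) 0 := by
    simpa using ((hasDerivAt_id (0 : ℝ)).smul_const (restr S d)).const_add (restr S P)
  have hGd : HasFDerivAt G (fderiv ℝ G (restr S P)) (restr S P + (0 : ℝ) • restr S d) := by
    simpa using hG.hasFDerivAt
  have h2 : HasDerivAt (fun t : ℝ => A (G (restr S P + t • restr S d)))
      (A (fderiv ℝ G (restr S P) (restr S d))) 0 :=
    A.hasFDerivAt.comp_hasDerivAt 0 (hGd.comp_hasDerivAt 0 hline)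
  refine h1.unique (h2.congr_of_eventuallyEq ?_)
  have hc : Filter.Tendsto (fun t : ℝ => P + t • d) (𝓝 0) (𝓝 P) := by
    have : Continuous (fun t : ℝ => P + t • d) := by fun_prop
    simpa using this.tendsto 0
  filter_upwards [hc.eventually hM] with t ht
  rw [hA, ← restr_add_smul, ← ht]
  rfl

end MatrixRepresentatives

end SuperZCR
end

noncomputable section
set_option linter.unusedSectionVars false

namespace SuperZCR

open scoped ContDiff Topology TensorProduct
open TopologicalSpace (Opens)

/-! ### Logarithmic derivatives of products of exponentials -/

section ExpModel

variable {p q : ℕ} {o : Type}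

/-- Nilpotency descends along the injective inclusion, and the exponential series in the model
stops. -/
theorem incl_exp_of_pow_eq_zero {T : Finset o} {X : Model p q T} {n : ℕ} (h : incl T X ^ n = 0) :
    incl T (NormedSpace.exp X) =
      ∑ k ∈ Finset.range n, ((k.factorial : ℂ)⁻¹) • incl T X ^ k := by
  have hX : X ^ n = 0 := incl_injective T (by rw [map_pow, h, map_zero])
  rw [NormedSpace.exp_eq_tsum ℂ]
  change incl T (∑' k : ℕ, ((k.factorial : ℂ)⁻¹) • X ^ k) = _
  rw [tsum_eq_sum (s := Finset.range n)]
  · rw [map_sum]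
    exact Finset.sum_congr rfl fun k _ => by rw [map_smul, map_pow]
  · intro k hk
    rw [Finset.mem_range, not_lt] at hk
    rw [pow_eq_zero_of_le hk hX, smul_zero]

/-- Constant matrices embed into the model by a continuous algebra homomorphism, which commutes with
`exp`. -/
theorem incl_exp_of_body {T : Finset o} {X : Model p q T} {A : SqMat p q ℂ}
    (h : incl T X = A.map (algebraMap ℂ (Grassmann o))) :
    incl T (NormedSpace.exp X) = (NormedSpace.exp A).map (algebraMap ℂ (Grassmann o)) := by
  let c : SqMat p q ℂ →ₐ[ℂ] Model p q T :=
    (Model.toMat T).symm.toAlgHom.comp (Algebra.ofId ℂ (Grassmann T)).mapMatrix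
  have hc : ∀ A, incl T (c A) = A.map (algebraMap ℂ (Grassmann o)) := by
    intro A
    ext i j
    exact AlgHom.commutes _ _
  have hcont : Continuous c := LinearMap.continuous_of_finiteDimensional c.toLinearMap
  have hX : X = c A := incl_injective T (by rw [h, hc])
  have hexp : c (NormedSpace.exp A) = NormedSpace.exp (c A) := by
    let _ : NormedRing (SqMat p q ℂ) := Matrix.linftyOpNormedRing
    let _ : NormedAlgebra ℂ (SqMat p q ℂ) := Matrix.linftyOpNormedAlgebra
    let _ : NormedAlgebra ℚ (SqMat p q ℂ) := NormedAlgebra.restrictScalars ℚ ℂ _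
    let _ : NormedAlgebra ℚ (Model p q T) := NormedAlgebra.restrictScalars ℚ ℂ _
    exact NormedSpace.map_exp c hcont A
  rw [← hc, hX, hexp]

end ExpModel

section LogarithmicDerivative

variable {n₀ n₁ m₀ m₁ p q r : ℕ} {W : Type} [NormedAddCommGroup W] [NormedSpace ℝ W]
variable {𝒰 : Opens (EvenIdx n₀ n₁ m₀ m₁ → ℝ)} {𝓘 : Opens W}

theorem isEvenG_eval {g : MatrixLieSuperalgebra p q} {N : SMat p q 𝒰 𝓘} (hN : N ∈ gMat g 𝒰 𝓘)
    (hN' : matParity N = N) (P : (EvenIdx n₀ n₁ m₀ m₁ → ℝ) × W) :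
    IsEvenG g (N.map (eval P)) := by
  rw [gMat_eq] at hN
  refine ⟨gSpan_map (eval_parity P) hN, ?_⟩
  rw [← superParity_map (eval_parity P), ← matParity_eq, hN']

theorem map_eval_pow (N : SMat p q 𝒰 𝓘) (P : (EvenIdx n₀ n₁ m₀ m₁ → ℝ) × W) (k : ℕ) :
    (N ^ k).map (eval P) = N.map (eval P) ^ k :=
  map_pow (eval P).mapMatrix N k

theorem map_eval_mul (M N : SMat p q 𝒰 𝓘) (P : (EvenIdx n₀ n₁ m₀ m₁ → ℝ) × W) :
    (M * N).map (eval P) = M.map (eval P) * N.map (eval P) :=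
  map_mul (eval P).mapMatrix M N

theorem map_eval_one (P : (EvenIdx n₀ n₁ m₀ m₁ → ℝ) × W) :
    (1 : SMat p q 𝒰 𝓘).map (eval P) = 1 :=
  map_one (eval P).mapMatrix

theorem map_eval_nilExp (n : ℕ) (N : SMat p q 𝒰 𝓘) (P : (EvenIdx n₀ n₁ m₀ m₁ → ℝ) × W) :
    (nilExp n N).map (eval P) =
      ∑ k ∈ Finset.range n, ((k.factorial : ℂ)⁻¹) • N.map (eval P) ^ k := by
  change (eval P).mapMatrix (nilExp n N) = _
  rw [nilExp, map_sum]
  exact Finset.sum_congr rfl fun k _ => by rw [map_smul, map_pow]; rfl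

/-- Both kinds of exponentials become the exponential of the normed model applied to an even
`𝔤`-matrix, and need not be distinguished afterwards. -/
theorem IsExpNear.exists_log {g : MatrixLieSuperalgebra p q}
    {P : (EvenIdx n₀ n₁ m₀ m₁ → ℝ) × W} {M : SMat p q 𝒰 𝓘} (h : IsExpNear g P M) :
    ∃ N : SMat p q 𝒰 𝓘, ∀ᶠ P' in 𝓝 P, IsEvenG g (N.map (eval P')) ∧
      ∀ (T : Finset (OddIdx n₀ n₁ m₀ m₁)) (X : Model p q T), N.map (eval P') = incl T X →
        M.map (eval P') = incl T (NormedSpace.exp X) := by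
  rcases h with ⟨N, hN, hN', n, hn, rfl⟩ | ⟨X, hX⟩
  · refine ⟨N, Filter.Eventually.of_forall fun P' => ⟨isEvenG_eval hN hN' P', fun T X h => ?_⟩⟩
    rw [map_eval_nilExp, h, incl_exp_of_pow_eq_zero]
    rw [← h, ← map_eval_pow, hn]
    exact map_zero (eval P').mapMatrix
  · refine ⟨X.map fun f => superTmul f 1, ?_⟩
    filter_upwards [hX] with P' hX
    have e : (X.map fun f => superTmul f (1 : Grassmann (OddIdx n₀ n₁ m₀ m₁))).map (eval P') =
        (X.map (evalFun P')).map (algebraMap ℂ (Grassmann (OddIdx n₀ n₁ m₀ m₁))) := by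
      ext i j
      simp only [Matrix.map_apply, eval_superTmul, Algebra.algebraMap_eq_smul_one]
      rfl
    refine ⟨?_, fun T Y hY => ?_⟩
    · rw [e]
      refine ⟨map_algebraMap_mem _ hX.1, ?_⟩
      have := superParity_map (σ := AlgHom.id ℂ ℂ) (σ' := CliffordAlgebra.involute)
        (f := Algebra.ofId ℂ (Grassmann (OddIdx n₀ n₁ m₀ m₁)))
        (fun x => by simp [Algebra.ofId_apply]) (X.map (evalFun P'))
      rw [← constParity_eq, hX.2.1] at this
      exact this.symm
    · rw [hX.2.2, incl_exp_of_body (hY.symm.trans e)]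

/-- For `exp G · H` the logarithmic derivative is that of `exp G` plus the conjugate by `exp G` of
that of `H`; both terms stay in the Lie algebra `ker π`, and conjugations compose. The
representative `H` is invertible on the whole domain so that its logarithmic derivative represents a
matrix there. -/
theorem exists_represents_prod {g : MatrixLieSuperalgebra p q}
    {P : (EvenIdx n₀ n₁ m₀ m₁ → ℝ) × W} (hP : P ∈ domain 𝒰 𝓘) (L : List (SMat p q 𝒰 𝓘))
    (hL : ∀ M ∈ L, IsExpNear g P M) :
    ∃ (S : Finset (EvenIdx n₀ n₁ m₀ m₁)) (T : Finset (OddIdx n₀ n₁ m₀ m₁)), ∀ S' T', S ⊆ S' →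
      T ⊆ T' → ∃ H : (S' → ℝ) × W → Model p q T',
        (∀ P ∈ domain 𝒰 𝓘, ContDiffAt ℝ ∞ H (restr S' P) ∧ IsUnit (H (restr S' P))) ∧
        (∀ᶠ P' in 𝓝 P, L.prod.map (eval P') = incl T' (H (restr S' P'))) ∧
        ∀ π : Model p q T' →L[ℝ] Model p q T', KerIsLie π →
          (∀ X, π X = 0 ↔ IsEvenG g (incl T' X)) → ∀ᶠ z in 𝓝 (restr S' P),
            (∀ X, π X = 0 → π (H z * X * Ring.inverse (H z)) = 0) ∧
            ∀ d, π (fderiv ℝ H z d * Ring.inverse (H z)) = 0 := by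
  classical
  induction L with
  | nil =>
    refine ⟨∅, ∅, fun S' T' _ _ => ⟨fun _ => 1, fun P _ => ⟨contDiffAt_const, isUnit_one⟩,
      Filter.Eventually.of_forall fun P' => ?_, fun π _ _ => Filter.Eventually.of_forall fun z =>
        ⟨fun X hX => by simpa using hX, fun d => by simp⟩⟩⟩
    rw [List.prod_nil, map_eval_one, map_one]
  | cons M L ih =>
    obtain ⟨S, T, hST⟩ := ih fun M hM => hL M (List.mem_cons_of_mem _ hM)
    obtain ⟨N, hN⟩ := (hL M List.mem_cons_self).exists_log
    obtain ⟨S₁, T₁, hST₁⟩ := exists_represents N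
    refine ⟨S ∪ S₁, T ∪ T₁, fun S' T' hS' hT' => ?_⟩
    obtain ⟨H, hH, hHL, hHπ⟩ := hST S' T' (Finset.union_subset_left hS')
      (Finset.union_subset_left hT')
    obtain ⟨G, hG⟩ := hST₁ S' T' (Finset.union_subset_right hS') (Finset.union_subset_right hT')
    have hdom : ∀ᶠ P' in 𝓝 P, P' ∈ domain 𝒰 𝓘 := isOpen_domain.mem_nhds hP
    have hsm : ∀ᶠ z in 𝓝 (restr S' P), ContDiffAt ℝ ∞ G z ∧ ContDiffAt ℝ ∞ H z ∧ IsUnit (H z) :=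
      eventually_restr.1 (hdom.mono fun P' hP' => ⟨(hG P' hP').1, hH P' hP'⟩)
    refine ⟨fun z => NormedSpace.exp (G z) * H z, fun P' hP' => ⟨?_, ?_⟩, ?_, fun π hπ hker => ?_⟩
    · exact (contDiff_exp.contDiffAt.comp _ (hG P' hP').1).mul (hH P' hP').1
    · exact (isUnit_exp _).mul (hH P' hP').2
    · filter_upwards [hdom, hN, hHL] with P' hP' hN hHL
      rw [List.prod_cons, map_eval_mul, hHL, hN.2 T' _ (hG P' hP').2, map_mul]
    · have hGπ : ∀ᶠ z in 𝓝 (restr S' P), π (G z) = 0 := by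
        refine eventually_restr.1 ?_
        filter_upwards [hdom, hN] with P' hP' hN
        rw [hker, ← (hG P' hP').2]
        exact hN.1
      filter_upwards [hsm, hGπ.eventually_nhds, hHπ π hπ hker] with z hz hGz hHz
      obtain ⟨u, hu⟩ := hz.2.2
      have hinv : Ring.inverse (NormedSpace.exp (G z) * H z) =
          Ring.inverse (H z) * NormedSpace.exp (-G z) := by
        let v : (Model p q T')ˣ := ⟨NormedSpace.exp (G z), NormedSpace.exp (-G z),
          exp_mul_exp_neg _, exp_neg_mul_exp _⟩
        change Ring.inverse ((v : Model p q T') * H z) = _ * ((v⁻¹ : (Model p q T')ˣ) : Model p q T')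
        rw [← hu, ← Units.val_mul, Ring.inverse_unit, Ring.inverse_unit, mul_inv_rev, Units.val_mul]
      have hG0 : π (G z) = 0 := hGz.self_of_nhds
      have hdG : DifferentiableAt ℝ G z := hz.1.differentiableAt (by simp)
      have hdH : DifferentiableAt ℝ H z := hz.2.1.differentiableAt (by simp)
      -- Since `π G` is zero on a neighbourhood, its derivative is zero, so `G` moves inside the Lie
      -- algebra.
      have hdGπ : ∀ d, π (fderiv ℝ G z d) = 0 := by
        intro d
        have h1 : HasFDerivAt (fun z => π (G z)) (π ∘L fderiv ℝ G z) z :=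
          π.hasFDerivAt.comp z hdG.hasFDerivAt
        have h2 : HasFDerivAt (fun z => π (G z)) (0 : _ →L[ℝ] _) z :=
          (hasFDerivAt_const (0 : Model p q T') z).congr_of_eventuallyEq hGz
        exact congrArg (fun A => A d) (h1.unique h2)
      refine ⟨fun X hX => ?_, fun d => ?_⟩
      · rw [hinv]
        have := hπ.exp_conj hG0 (hHz.1 X hX)
        simpa only [mul_assoc] using this
      · have hdE : HasFDerivAt (fun z => NormedSpace.exp (G z))
            (fderiv ℝ NormedSpace.exp (G z) ∘L fderiv ℝ G z) z :=
          (((contDiff_exp (n := 1)).differentiable (by simp)) (G z)).hasFDerivAt.comp z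
            hdG.hasFDerivAt
        have hd : fderiv ℝ (fun z => NormedSpace.exp (G z) * H z) z = _ :=
          (hdE.mul' hdH.hasFDerivAt).fderiv
        rw [hd, hinv]
        have h1 := hπ.fderiv_exp_mul hG0 (hdGπ d)
        have h2 := hπ.exp_conj hG0 (hHz.2 d)
        have h3 : H z * Ring.inverse (H z) = 1 := Ring.mul_inverse_cancel _ hz.2.2
        have e : ∀ A B C D F G : Model p q T', C * D = 1 →
            (A * B + F * C) * (D * G) = A * (B * D) * G + F * G := by
          intro A B C D F G h
          calc _ = A * (B * D) * G + F * (C * D) * G := by noncomm_ring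
            _ = _ := by rw [h, mul_one]
        change π ((NormedSpace.exp (G z) * fderiv ℝ H z d +
          fderiv ℝ NormedSpace.exp (G z) (fderiv ℝ G z d) * H z) * _) = 0
        rw [e _ _ _ _ _ _ h3, map_add, h1, h2, add_zero]

/-- The logarithmic derivative of a `G`-matrix is an even `𝔤`-matrix. -/
theorem SuperPDE.IsGMatrix.exists_log_deriv {E : SuperPDE 𝒰 r} {g : MatrixLieSuperalgebra p q}
    {S T : SMat p q 𝒰 𝓘} (h : E.IsGMatrix g S T) {P : (EvenIdx n₀ n₁ m₀ m₁ → ℝ) × W}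
    (hP : P ∈ domain 𝒰 𝓘) (a : W) :
    ∃ B : SMat p q 𝒰 𝓘, E.germ P (matDeriv (0, a) S * T) = E.germ P B ∧
      ∀ᶠ P' in 𝓝 P, IsEvenG g (B.map (eval P')) := by
  obtain ⟨-, -, hST, -, hL⟩ := h
  obtain ⟨L, hL, hSL⟩ := hL P hP.1 hP.2
  obtain ⟨S₀, T₀, hrep⟩ := exists_represents_prod hP L hL
  obtain ⟨H, hH, hHL, hHπ⟩ := hrep S₀ T₀ subset_rfl subset_rfl
  obtain ⟨_, _, _, π, -, -, -, -, -, -, -, hker, hLie⟩ := exists_model_projections g T₀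
  have hsm : ∀ P ∈ domain 𝒰 𝓘, ContDiffAt ℝ ∞ (fun z => fderiv ℝ H z (restr S₀ (0, a)) *
      Ring.inverse (H z)) (restr S₀ P) := by
    intro P hP
    obtain ⟨u, hu⟩ := (hH P hP).2
    refine (((hH P hP).1.fderiv_right (m := ∞) (by simp)).clm_apply contDiffAt_const).mul ?_
    have : ContDiffAt ℝ ∞ (Ring.inverse : Model p q T₀ → Model p q T₀) (H (restr S₀ P)) := by
      rw [← hu]
      exact contDiffAt_ringInverse ℝ u
    exact this.comp _ (hH P hP).1
  obtain ⟨B, hB⟩ := exists_of_represents hsm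
  have hdom : ∀ᶠ P' in 𝓝 P, P' ∈ domain 𝒰 𝓘 := isOpen_domain.mem_nhds hP
  have hgerm : E.germ P S = E.germ P L.prod := SuperPDE.germ_eq.2 hSL
  refine ⟨B, ?_, ?_⟩
  · have h1 : E.germ P (matDeriv (0, a) L.prod) = E.germ P (B * L.prod) := by
      refine SuperPDE.germ_congr ?_
      filter_upwards [hdom, hHL.eventually_nhds] with P' hP' hHL
      rw [map_eval_matDeriv hP' ((hH P' hP').1.differentiableAt (by simp)) hHL, map_eval_mul, hB,
        hHL.self_of_nhds, ← map_mul, mul_assoc, Ring.inverse_mul_cancel _ (hH P' hP').2, mul_one]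
    -- On `ℰ^∞` near `P` the product of exponentials may replace `S`: `∂S · T = B L T = B S T = B`.
    rw [map_mul, SuperPDE.germ_matDeriv hP a hgerm, h1, map_mul, ← hgerm, mul_assoc, ← map_mul,
      SuperPDE.matEq_iff.1 hST P hP, map_one, mul_one]
  · filter_upwards [eventually_restr.2 (hHπ π hLie hker)] with P' hP'
    rw [hB, ← hker]
    exact hP'.2 _

end LogarithmicDerivative

end SuperZCR
end

noncomputable section
set_option linter.unusedSectionVars false

namespace SuperZCR

open scoped ContDiff Topology TensorProduct
open TopologicalSpace (Opens)

/-! ### From gauge transformations to the infinitesimal generator -/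

section Families

variable {n₀ n₁ m₀ m₁ p q r : ℕ} {𝕜 : Type} [RCLike 𝕜]
variable {𝒰 : Opens (EvenIdx n₀ n₁ m₀ m₁ → ℝ)} {𝓘 : Opens 𝕜}

theorem paramDeriv_eq (M : SMat p q 𝒰 𝓘) : paramDeriv M = matDeriv (0, (1 : 𝕜)) M := rfl

theorem isFamily_iff {M : SMat p q 𝒰 𝓘} : IsFamily M ↔ ∀ (a : 𝕜), ∀ P ∈ domain 𝒰 𝓘,
    (matDeriv (0, a) M).map (eval P) =
      RCLike.map 𝕜 ℂ a • (matDeriv (0, (1 : 𝕜)) M).map (eval P) := by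
  simp only [← Matrix.ext_iff]
  exact ⟨fun h a P hP i j => h a P hP.1 hP.2 i j, fun h a P h1 h2 i j => h a P ⟨h1, h2⟩ i j⟩

theorem map_eval_add (M N : SMat p q 𝒰 𝓘) (P : (EvenIdx n₀ n₁ m₀ m₁ → ℝ) × 𝕜) :
    (M + N).map (eval P) = M.map (eval P) + N.map (eval P) :=
  map_add (eval P).mapMatrix M N

theorem IsFamily.mul {M N : SMat p q 𝒰 𝓘} (hM : IsFamily M) (hN : IsFamily N) :
    IsFamily (M * N) := by
  rw [isFamily_iff] at *
  intro a P hP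
  rw [matDeriv_mul, matDeriv_mul, map_eval_add, map_eval_add, map_eval_mul, map_eval_mul,
    map_eval_mul, map_eval_mul, hM a P hP, hN a P hP, smul_mul_assoc, mul_smul_comm, smul_add]

theorem IsFamily.paramDeriv {M : SMat p q 𝒰 𝓘} (hM : IsFamily M) : IsFamily (paramDeriv M) := by
  intro a P h1 h2 i j
  change eval P (evenDeriv (0, a) (evenDeriv (0, 1) (M i j))) =
    _ • eval P (evenDeriv (0, 1) (evenDeriv (0, 1) (M i j)))
  rw [evenDeriv_comm, ← map_smul, ← map_smul]
  refine eval_evenDeriv_congr ⟨h1, h2⟩ ?_ _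
  filter_upwards [isOpen_domain.mem_nhds (show P ∈ domain 𝒰 𝓘 from ⟨h1, h2⟩)] with P' hP'
  rw [map_smul]
  exact hM a P' hP'.1 hP'.2 i j

theorem matDeriv_superExtend (d : (EvenIdx n₀ n₁ m₀ m₁ → ℝ) × 𝕜)
    (π : SqMat p q ℂ →ₗ[ℂ] SqMat p q ℂ) (M : SMat p q 𝒰 𝓘) :
    matDeriv d (superExtend parity π M) = superExtend parity π (matDeriv d M) := by
  have htw : ∀ (j : Fin p ⊕ Fin q) (f : JetFun 𝒰 𝓘),
      evenDeriv d (twist parity j f) = twist parity j (evenDeriv d f) := by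
    intro j f
    cases j
    · rfl
    · exact (parity_evenDeriv d f).symm
  ext k l
  simp only [matDeriv, superExtend, LinearMap.coe_mk, AddHom.coe_mk, Matrix.map_apply,
    Matrix.sum_apply, superTens, Matrix.of_apply, map_sum, map_smul, htw]

theorem IsFamily.superExtend {M : SMat p q 𝒰 𝓘} (hM : IsFamily M)
    (π : SqMat p q ℂ →ₗ[ℂ] SqMat p q ℂ) : IsFamily (superExtend parity π M) := by
  rw [isFamily_iff] at *
  intro a P hP
  rw [matDeriv_superExtend, matDeriv_superExtend, superExtend_map (eval_parity P),
    superExtend_map (eval_parity P), hM a P hP, map_smul]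

/-- Here `D` stands for the parameter derivative, `d` for a total derivative, and `Q = Ds · t`. The
two sides are `∂α` and `d Q - [α, Q]` for `α = ds · t + s a t`; the derivatives of the inverse are
eliminated by `Dt = -t Ds t` and `dt = -t ds t`. -/
theorem gauge_deriv_identity {R : Type} [Ring R] {s t a ds dt Ds Dt dDs : R} (hts : t * s = 1)
    (hst : s * t = 1) (hD : Dt * s + t * Ds = 0) (hd : dt * s + t * ds = 0) :
    dDs * t + ds * Dt + (Ds * a * t + s * a * Dt) =
      dDs * t + Ds * dt - ((ds * t + s * a * t) * (Ds * t) - Ds * t * (ds * t + s * a * t)) := by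
  have h1 : t * Ds * t = -Dt := by
    have := congrArg (· * t) hD
    simp only [add_mul, mul_assoc, hst, mul_one, zero_mul] at this
    rw [mul_assoc, eq_neg_iff_add_eq_zero, add_comm]
    exact this
  have h2 : t * ds * t = -dt := by
    have := congrArg (· * t) hd
    simp only [add_mul, mul_assoc, hst, mul_one, zero_mul] at this
    rw [mul_assoc, eq_neg_iff_add_eq_zero, add_comm]
    exact this
  calc _ = dDs * t + Ds * dt - (ds * -Dt + s * a * -Dt - Ds * -dt - Ds * 1 * a * t) := by
        noncomm_ring
    _ = _ := by
        rw [← h1, ← h2, ← hts]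
        noncomm_ring

/-- The logarithmic derivative of a family of gauge transformations generates the family of
zero-curvature representations. -/
theorem SuperPDE.IsRemovable.exists_generator {E : SuperPDE 𝒰 r} {g : MatrixLieSuperalgebra p q}
    [Nonempty 𝓘] {α : OneForm p q 𝒰 𝓘} (h : E.IsRemovable g α) :
    ∃ Q : SMat p q 𝒰 𝓘, Q ∈ gMat g 𝒰 𝓘 ∧ IsFamily Q ∧ matParity Q = Q ∧
      E.FormEq (fun c => SuperZCR.paramDeriv (α c)) (dhMat Q - bracketFormMat α Q) := by
  obtain ⟨S, T, hS, hT, hG, -, hα⟩ := h (Classical.arbitrary 𝓘)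
  obtain ⟨π, hπ1, hπ2, hπ3⟩ := exists_parity_projection g
  have hSe := hG.1
  have hTe := hG.2.1
  have hDSe : matParity (matDeriv (0, (1 : 𝕜)) S) = matDeriv (0, (1 : 𝕜)) S := by
    rw [matParity_matDeriv, hSe]
  have hQe : matParity (SuperZCR.superExtend parity π (SuperZCR.paramDeriv S * T)) =
      SuperZCR.superExtend parity π (SuperZCR.paramDeriv S * T) := by
    rw [matParity_eq, ← superExtend_parity superComm_parity.1 hπ3, superParity_mul,
      ← matParity_eq, ← matParity_eq, paramDeriv_eq, hDSe, hTe]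
  -- The logarithmic derivative is `𝔤`-valued on `ℰ^∞` only. Projecting it onto `𝔤` gives a
  -- `𝔤`-matrix on all of `𝒰 × 𝓘` with the same restriction to `ℰ^∞`.
  refine ⟨SuperZCR.superExtend parity π (SuperZCR.paramDeriv S * T), ?_,
    (hS.paramDeriv.mul hT).superExtend π, hQe, fun c => SuperPDE.matEq_iff.2 fun P hP => ?_⟩
  · rw [gMat_eq]
    exact superExtend_mem parity hπ1 _
  have hQ : E.germ P (SuperZCR.superExtend parity π (SuperZCR.paramDeriv S * T)) =
      E.germ P (matDeriv (0, (1 : 𝕜)) S * T) := by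
    obtain ⟨B, hB1, hB2⟩ := hG.exists_log_deriv hP (1 : 𝕜)
    rw [paramDeriv_eq, SuperPDE.germ_superExtend π hB1, hB1]
    refine SuperPDE.germ_congr ?_
    filter_upwards [hB2] with P' h
    rw [superExtend_map (eval_parity P'), superExtend_of_mem superComm_grassmann.1 hπ2 h.1]
  change E.germ P (matDeriv (0, 1) (α c)) = E.germ P (matD c _ - bracketFormMat α _ c)
  have hα' : E.germ P (α c) = E.germ P (matD c S * T +
      S * freezeForm 𝓘 (Classical.arbitrary 𝓘) α c * T) := by
    have := SuperPDE.matEq_iff.1 (hα c) P hP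
    rwa [gauge_of_even hSe] at this
  have hfr : matDeriv (0, (1 : 𝕜)) (freezeForm 𝓘 (Classical.arbitrary 𝓘) α c) = 0 :=
    matDeriv_freezeMat _ _ _ _
  have hst := SuperPDE.matEq_iff.1 hG.2.2.1 P hP
  have hts := SuperPDE.matEq_iff.1 hG.2.2.2.1 P hP
  have hDts := SuperPDE.germ_matDeriv hP (1 : 𝕜) hts
  have hdts := SuperPDE.germ_matD hP c hts
  rw [matDeriv_mul, matDeriv_one, map_zero, map_add, map_mul, map_mul] at hDts
  rw [matD_mul c hTe, matD_one, map_zero, map_add, map_mul, map_mul] at hdts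
  rw [map_mul, map_one] at hst hts
  rw [SuperPDE.germ_matDeriv hP 1 hα', bracketFormMat_of_even _ hQe]
  simp only [map_sub, map_mul]
  rw [SuperPDE.germ_matD hP c hQ, hQ, hα', matD_mul c hDSe, matDeriv_add, matDeriv_mul,
    matDeriv_mul, matDeriv_mul, hfr, mul_zero, add_zero, matDeriv_matD]
  simp only [map_add, map_mul]
  exact gauge_deriv_identity hts hst hDts hdts

end Families

end SuperZCR
end

noncomputable section
set_option linter.unusedSectionVars false

namespace SuperZCR

open scoped ContDiff Topology TensorProduct unitInterval
open TopologicalSpace (Opens)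

/-! ### Integration in the parameter and propagation of vanishing -/

section Radial

variable {κ o : Type} {𝕜 : Type} [RCLike 𝕜]
variable {𝒰 : Opens (κ → ℝ)} {𝓘 : Opens 𝕜}

/-- The segment from `(x, c)` to `(x, w)`. -/
def paramRay (c : 𝕜) (P : (κ → ℝ) × 𝕜) (s : ℝ) : (κ → ℝ) × 𝕜 := (P.1, c + s • (P.2 - c))

theorem eventually_paramRay {P₀ : (κ → ℝ) × 𝕜} {A : Set ((κ → ℝ) × 𝕜)} (hA : A ∈ 𝓝 P₀) :
    ∀ᶠ P in 𝓝 P₀, ∀ s ∈ Set.Icc (0 : ℝ) 1, paramRay P₀.2 P s ∈ A := by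
  obtain ⟨U, hU, V, hV, hUV⟩ := mem_nhds_prod_iff.1 hA
  obtain ⟨ε, hε, hball⟩ := Metric.mem_nhds_iff.1 hV
  filter_upwards [prod_mem_nhds hU (Metric.ball_mem_nhds P₀.2 hε)] with P hP s hs
  refine hUV ⟨hP.1, hball ?_⟩
  have h := (convex_ball P₀.2 ε).add_smul_sub_mem (Metric.mem_ball_self hε) hP.2 hs
  exact h

theorem continuousOn_paramRay (f : smoothFun 𝒰 𝓘) {c : 𝕜} {P : (κ → ℝ) × 𝕜}
    (hP : ∀ s ∈ Set.Icc (0 : ℝ) 1, paramRay c P s ∈ domain 𝒰 𝓘) :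
    ContinuousOn (fun s => f.1 (paramRay c P s)) (Set.Icc 0 1) := by
  obtain ⟨T, g, hg⟩ := f.2
  have h1 : ContinuousOn (fun s => g (restr T (paramRay c P s))) (Set.Icc 0 1) := by
    intro s hs
    have hc : Continuous fun s => restr T (paramRay c P s) := by
      unfold paramRay
      refine (continuous_restr T).comp ?_
      fun_prop
    exact (ContinuousAt.comp (f := fun s => restr T (paramRay c P s))
      (hg _ (hP s hs).1 (hP s hs).2).1.continuousAt hc.continuousAt).continuousWithinAt
  exact h1.congr fun s hs => (hg _ (hP s hs).1 (hP s hs).2).2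

theorem intervalIntegrable_paramRay (φ : Grassmann o →ₗ[ℂ] ℂ) (f : SuperFun o 𝒰 𝓘) {c : 𝕜}
    {P : (κ → ℝ) × 𝕜} (hP : ∀ s ∈ Set.Icc (0 : ℝ) 1, paramRay c P s ∈ domain 𝒰 𝓘) :
    IntervalIntegrable (fun s => φ (eval (paramRay c P s) f)) MeasureTheory.volume 0 1 := by
  have h := continuousOn_paramRay (coefficient φ f) hP
  simp only [coefficient_apply] at h
  rw [← Set.uIcc_of_le zero_le_one] at h
  exact h.intervalIntegrable

/-- After a cutoff the integrand is a smooth path-valued map, and integration is a bounded linear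
functional of the path. -/
theorem exists_radial_integral_smooth (f : smoothFun 𝒰 𝓘) {P₀ : (κ → ℝ) × 𝕜}
    (hP₀ : P₀ ∈ domain 𝒰 𝓘) : ∃ h : smoothFun 𝒰 𝓘, ∀ᶠ P in 𝓝 P₀,
      h.1 P = ∫ s in (0 : ℝ)..1, f.1 (paramRay P₀.2 P s) := by
  obtain ⟨T, g, hg⟩ := f.2
  have hdom : ∀ᶠ P in 𝓝 P₀, P ∈ domain 𝒰 𝓘 := isOpen_domain.mem_nhds hP₀
  have hgev : ∀ᶠ z in 𝓝 (restr T P₀), ContDiffAt ℝ ∞ g z :=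
    eventually_restr.1 (hdom.mono fun P hP => (hg P hP.1 hP.2).1)
  obtain ⟨χ, -, hχ1, hχg⟩ := exists_contDiff_eventuallyEq hgev
  have hF : ContDiff ℝ ∞ (fun z : ((T → ℝ) × 𝕜) × ℝ =>
      (fun y => χ y • g y) (ray P₀.2 z)) := hχg.comp (contDiff_ray P₀.2)
  let A : C(I, ℂ) →L[ℝ] ℂ :=
    ((ContinuousMap.evalCLM ℂ (1 : I)).comp (primitive (F := ℂ))).restrictScalars ℝ
  have hA : ContDiff ℝ ∞ (fun z => A (curryI _ hF.continuous z)) :=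
    A.contDiff.comp (contDiff_curryI hF)
  refine ⟨smoothOf 𝒰 𝓘 T _ fun P _ => hA.contDiffAt, ?_⟩
  obtain ⟨ε, hε, hball⟩ := Metric.eventually_nhds_iff_ball.1 hχ1
  have hnear : ∀ᶠ P in 𝓝 P₀, restr T P ∈ Metric.ball (restr T P₀) ε :=
    eventually_restr.2 (Metric.ball_mem_nhds _ hε)
  filter_upwards [hnear, eventually_paramRay (isOpen_domain.mem_nhds hP₀)] with P hP hray
  change primitive (curryI _ hF.continuous (restr T P)) 1 = _
  rw [primitive_apply]
  refine intervalIntegral.integral_congr fun s hs => ?_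
  have hs' : s ∈ Set.Icc (0 : ℝ) 1 := by simpa [Set.uIcc_of_le] using hs
  rw [Set.IccExtend_of_mem _ _ hs']
  change χ (ray P₀.2 (restr T P, s)) • g (ray P₀.2 (restr T P, s)) = _
  have h1 := hball _ (mem_ball_ray hP hs'.1 hs'.2)
  have h2 : χ (ray P₀.2 (restr T P, s)) = 1 := h1
  rw [h2, one_smul, (hg _ (hray s hs').1 (hray s hs').2).2]
  rfl

theorem exists_radial_integral (f : SuperFun o 𝒰 𝓘) {P₀ : (κ → ℝ) × 𝕜}
    (hP₀ : P₀ ∈ domain 𝒰 𝓘) : ∃ h : SuperFun o 𝒰 𝓘, ∀ᶠ P in 𝓝 P₀, ∀ φ : Grassmann o →ₗ[ℂ] ℂ,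
      φ (eval P h) = ∫ s in (0 : ℝ)..1, φ (eval (paramRay P₀.2 P s) f) := by
  induction f using SuperFun.induction_on with
  | h0 => exact ⟨0, Filter.Eventually.of_forall fun P φ => by simp⟩
  | ht f x =>
    obtain ⟨h, hh⟩ := exists_radial_integral_smooth f hP₀
    refine ⟨superTmul h x, ?_⟩
    filter_upwards [hh] with P hP φ
    simp only [eval_superTmul, map_smul, smul_eq_mul, hP]
    exact (intervalIntegral.integral_mul_const _ _).symm
  | ha f g hf hg =>
    obtain ⟨h, hh⟩ := hf
    obtain ⟨k, hk⟩ := hg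
    refine ⟨h + k, ?_⟩
    filter_upwards [hh, hk, eventually_paramRay (isOpen_domain.mem_nhds hP₀)] with P hh hk hP φ
    simp only [map_add, hh, hk]
    exact (intervalIntegral.integral_add (intervalIntegrable_paramRay φ f hP)
      (intervalIntegrable_paramRay φ g hP)).symm

theorem eval_sub_eval_paramRay (f : SuperFun o 𝒰 𝓘) {c : 𝕜} {P : (κ → ℝ) × 𝕜}
    (hP : ∀ s ∈ Set.Icc (0 : ℝ) 1, paramRay c P s ∈ domain 𝒰 𝓘) (φ : Grassmann o →ₗ[ℂ] ℂ) :
    φ (eval P f) - φ (eval (P.1, c) f) =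
      ∫ s in (0 : ℝ)..1, φ (eval (paramRay c P s) (evenDeriv (0, P.2 - c) f)) := by
  have h := intervalIntegral.integral_eq_sub_of_hasDerivAt
    (f := fun s : ℝ => φ (eval (paramRay c P s) f))
    (f' := fun s : ℝ => φ (eval (paramRay c P s) (evenDeriv (0, P.2 - c) f))) (a := 0) (b := 1)
    (fun s hs => ?_) (intervalIntegrable_paramRay φ _ hP)
  · rw [h]
    simp [paramRay]
  · have hs' : s ∈ Set.Icc (0 : ℝ) 1 := by simpa [Set.uIcc_of_le] using hs
    have h0 := eval_evenDeriv_hasDerivAt φ (0, P.2 - c) f (hP s hs')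
    have h1 : HasDerivAt (fun t : ℝ => φ (eval (paramRay c P s + t • (0, P.2 - c)) f))
        (φ (eval (paramRay c P s) (evenDeriv (0, P.2 - c) f))) (s - s) := by
      rw [sub_self]
      exact h0
    have h2 := h1.comp_sub_const s s
    refine h2.congr_of_eventuallyEq (Filter.Eventually.of_forall fun t => ?_)
    have : paramRay c P t = paramRay c P s + (t - s) • ((0, P.2 - c) : (κ → ℝ) × 𝕜) := by
      refine Prod.ext (by simp [paramRay]) ?_
      change c + t • (P.2 - c) = c + s • (P.2 - c) + (t - s) • (P.2 - c)
      rw [sub_smul, add_add_sub_cancel]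
    simp only [this]

end Radial

section Propagation

variable {n₀ n₁ m₀ m₁ r : ℕ} {𝕜 : Type} [RCLike 𝕜]
variable {𝒰 : Opens (EvenIdx n₀ n₁ m₀ m₁ → ℝ)} {𝓘 : Opens 𝕜} {E : SuperPDE 𝒰 r}

/-- The generators are constant along the segments, so they leave the integral and only their
coefficients are integrated. -/
theorem SuperPDE.exists_radial_integral_mem {g : JetFun 𝒰 𝓘} (hg : g ∈ E.ideal 𝓘)
    {P₀ : (EvenIdx n₀ n₁ m₀ m₁ → ℝ) × 𝕜} (hP₀ : P₀ ∈ domain 𝒰 𝓘) :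
    ∃ h ∈ E.ideal 𝓘, ∀ᶠ P in 𝓝 P₀, ∀ φ : Grassmann (OddIdx n₀ n₁ m₀ m₁) →ₗ[ℂ] ℂ,
      φ (eval P h) = ∫ s in (0 : ℝ)..1, φ (eval (paramRay P₀.2 P s) g) := by
  rw [SuperPDE.ideal, Ideal.span] at hg
  -- Elements are taken as sums of terms `b ψ` with `ψ` a generator. An induction over
  -- multiplication by arbitrary functions would fail, as integration is not linear over functions
  -- of the parameter.
  induction hg using Submodule.closure_induction with
  | zero => exact ⟨0, Submodule.zero_mem _, Filter.Eventually.of_forall fun P φ => by simp⟩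
  | add f g _ _ hf hg =>
    obtain ⟨h, hh', hh⟩ := hf
    obtain ⟨k, hk', hk⟩ := hg
    refine ⟨h + k, Submodule.add_mem _ hh' hk', ?_⟩
    filter_upwards [hh, hk, eventually_paramRay (isOpen_domain.mem_nhds hP₀)] with P hh hk hP φ
    simp only [map_add, hh, hk]
    exact (intervalIntegral.integral_add (intervalIntegrable_paramRay φ f hP)
      (intervalIntegrable_paramRay φ g hP)).symm
  | smul_mem b ψ hψ =>
    obtain ⟨ψ, hψ, rfl⟩ := hψ
    have hψ : E.Consequence ψ := hψ
    obtain ⟨h, hh⟩ := exists_radial_integral b hP₀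
    refine ⟨h * _, Ideal.mul_mem_left _ _ (hψ.mem_ideal (𝓘 := 𝓘)), ?_⟩
    filter_upwards [hh] with P hP φ
    -- The constant value of the generator is absorbed into the functional.
    have := hP (φ ∘ₗ LinearMap.mulRight ℂ (eval (P.1, PUnit.unit) ψ))
    simp only [smul_eq_mul, map_mul, eval_freeze]
    exact this

theorem contDiff_rclikeMap : ContDiff ℝ ∞ (RCLike.map 𝕜 ℂ : 𝕜 → ℂ) :=
  (RCLike.map 𝕜 ℂ).contDiff

/-- The fundamental theorem of calculus along the segment gives `f - f(c) = (w - c) ∫ ∂f`. The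
factor `w - c` comes out because `f` is differentiable over `𝕜`, and the integral of an element of
the ideal is again in the ideal. -/
theorem SuperPDE.sub_freeze_mem_vanishing {f : JetFun 𝒰 𝓘}
    {P₀ : (EvenIdx n₀ n₁ m₀ m₁ → ℝ) × 𝕜} (hP₀ : P₀ ∈ domain 𝒰 𝓘)
    (hfam : ∀ a : 𝕜, ∀ P ∈ domain 𝒰 𝓘,
      eval P (evenDeriv (0, a) f) = RCLike.map 𝕜 ℂ a • eval P (evenDeriv (0, 1) f))
    (hf : evenDeriv (0, (1 : 𝕜)) f ∈ E.vanishing 𝓘 P₀) :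
    f - freeze 𝓘 ⟨P₀.2, hP₀.2⟩ f ∈ E.vanishing 𝓘 P₀ := by
  obtain ⟨g, hg, hfg⟩ := hf
  obtain ⟨h, hh', hh⟩ := SuperPDE.exists_radial_integral_mem hg hP₀
  have hsm : ContDiff ℝ ∞ (fun z : (((∅ : Finset (EvenIdx n₀ n₁ m₀ m₁)) → ℝ) × 𝕜) =>
      RCLike.map 𝕜 ℂ (z.2 - P₀.2)) := contDiff_rclikeMap.comp (by fun_prop)
  refine ⟨superTmul (smoothOf 𝒰 𝓘 ∅ _ fun P _ => hsm.contDiffAt) 1 * h,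
    Ideal.mul_mem_left _ _ hh', ?_⟩
  filter_upwards [hh, eventually_paramRay (isOpen_domain.mem_nhds hP₀),
    eventually_paramRay hfg] with P hh hP hPg
  refine grassmann_ext fun φ => ?_
  rw [map_sub, map_sub, eval_freeze, eval_sub_eval_paramRay f hP, map_mul, eval_superTmul,
    smul_one_mul, map_smul, hh, smul_eq_mul]
  change _ = RCLike.map 𝕜 ℂ (P.2 - P₀.2) * _
  rw [← intervalIntegral.integral_const_mul]
  refine intervalIntegral.integral_congr fun s hs => ?_
  have hs' : s ∈ Set.Icc (0 : ℝ) 1 := by simpa [Set.uIcc_of_le] using hs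
  have e : eval (paramRay P₀.2 P s) (evenDeriv (0, (1 : 𝕜)) f) = eval (paramRay P₀.2 P s) g :=
    hPg s hs'
  rw [← e]
  change φ (eval (paramRay P₀.2 P s) (evenDeriv (0, P.2 - P₀.2) f)) = _
  rw [hfam _ _ (hP s hs'), map_smul, smul_eq_mul]

theorem SuperPDE.freeze_mem_vanishing {W W' : Type} [NormedAddCommGroup W] [NormedSpace ℝ W]
    [NormedAddCommGroup W'] [NormedSpace ℝ W'] {𝓘 : Opens W} {𝓙 : Opens W'} (w : 𝓘) (w' : W')
    {f : JetFun 𝒰 𝓘} {x : EvenIdx n₀ n₁ m₀ m₁ → ℝ} (hf : f ∈ E.vanishing 𝓘 (x, w.1)) :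
    freeze 𝓙 w f ∈ E.vanishing 𝓙 (x, w') := by
  obtain ⟨g, hg, h⟩ := hf
  refine ⟨freeze 𝓙 w g, ?_, ?_⟩
  · clear h
    induction hg using E.ideal_induction with
    | hgen f hf =>
      have : freeze 𝓙 w (freeze 𝓘 ⟨PUnit.unit, TopologicalSpace.Opens.mem_top _⟩ f) =
          freeze 𝓙 ⟨PUnit.unit, TopologicalSpace.Opens.mem_top _⟩ f :=
        superFun_ext fun P => by simp only [eval_freeze]
      rw [this]
      exact hf.mem_ideal
    | h0 => rw [map_zero]; exact Submodule.zero_mem _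
    | hadd f f' _ _ h h' => rw [map_add]; exact Submodule.add_mem _ h h'
    | hmul a f _ h => rw [map_mul]; exact Ideal.mul_mem_left _ _ h
  · have hc : Filter.Tendsto (fun P : (EvenIdx n₀ n₁ m₀ m₁ → ℝ) × W' => (P.1, w.1))
        (𝓝 (x, w')) (𝓝 (x, w.1)) := by
      have : Continuous (fun P : (EvenIdx n₀ n₁ m₀ m₁ → ℝ) × W' => (P.1, w.1)) := by fun_prop
      exact this.tendsto (x, w')
    filter_upwards [hc.eventually h] with P hP
    rw [eval_freeze, eval_freeze, hP]

theorem SuperPDE.eventually_mem_vanishing {W : Type} [NormedAddCommGroup W] [NormedSpace ℝ W]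
    {𝓘 : Opens W} {f : JetFun 𝒰 𝓘} {P : (EvenIdx n₀ n₁ m₀ m₁ → ℝ) × W}
    (hf : f ∈ E.vanishing 𝓘 P) : ∀ᶠ P' in 𝓝 P, f ∈ E.vanishing 𝓘 P' := by
  obtain ⟨g, hg, h⟩ := hf
  exact h.eventually_nhds.mono fun P' h' => ⟨g, hg, h'⟩

/-- A family whose derivative vanishes on `ℰ^∞` vanishes on `ℰ^∞` if one of its members does. -/
theorem SuperPDE.mem_vanishing_of_deriv [PreconnectedSpace 𝓘] {f : JetFun 𝒰 𝓘}
    (hfam : ∀ a : 𝕜, ∀ P ∈ domain 𝒰 𝓘,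
      eval P (evenDeriv (0, a) f) = RCLike.map 𝕜 ℂ a • eval P (evenDeriv (0, 1) f))
    (hf : ∀ P ∈ domain 𝒰 𝓘, evenDeriv (0, (1 : 𝕜)) f ∈ E.vanishing 𝓘 P) (w₀ : 𝓘)
    (h₀ : ∀ x ∈ 𝒰, eval (x, w₀.1) f = 0) {P : (EvenIdx n₀ n₁ m₀ m₁ → ℝ) × 𝕜}
    (hP : P ∈ domain 𝒰 𝓘) : f ∈ E.vanishing 𝓘 P := by
  obtain ⟨x, w⟩ := P
  have hx : x ∈ 𝒰 := hP.1
  have hfr : ∀ w₁ w₂ : 𝓘, freeze (⊤ : Opens PUnit) w₂ (freeze 𝓘 w₁ f) = freeze ⊤ w₁ f :=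
    fun w₁ w₂ => superFun_ext fun P => by simp only [eval_freeze]
  have hfr' : ∀ w₁ : 𝓘, freeze 𝓘 (⟨PUnit.unit, TopologicalSpace.Opens.mem_top _⟩ :
      (⊤ : Opens PUnit)) (freeze (⊤ : Opens PUnit) w₁ f) = freeze 𝓘 w₁ f :=
    fun w₁ => superFun_ext fun P => by simp only [eval_freeze]
  -- For `w₂` near `w₁` the two members of the family differ, near `x`, by a function vanishing on
  -- `ℰ^∞`, so one of them vanishes there if and only if the other does.
  have key : ∀ w₁ : 𝓘, freeze (⊤ : Opens PUnit) w₁ f ∈ E.vanishing ⊤ (x, PUnit.unit) := by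
    refine forall_of_locally_iff (x₀ := w₀) (fun w₁ => ?_) ?_
    · have h1 := SuperPDE.sub_freeze_mem_vanishing (P₀ := (x, w₁.1)) ⟨hx, w₁.2⟩ hfam
        (hf _ ⟨hx, w₁.2⟩)
      have hc : Filter.Tendsto (fun w₂ : 𝓘 => (x, w₂.1)) (𝓝 w₁) (𝓝 (x, w₁.1)) := by
        have : Continuous (fun w₂ : 𝓘 => (x, w₂.1)) := by fun_prop
        exact this.tendsto w₁
      filter_upwards [hc.eventually (SuperPDE.eventually_mem_vanishing h1)] with w₂ h2
      have h3 := SuperPDE.freeze_mem_vanishing (𝓙 := (⊤ : Opens PUnit)) w₂ PUnit.unit h2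
      rw [map_sub] at h3
      have h4 : freeze (⊤ : Opens PUnit) w₂ (freeze 𝓘 ⟨(x, w₁.1).2, w₁.2⟩ f) = freeze ⊤ w₁ f :=
        hfr w₁ w₂
      rw [h4] at h3
      constructor
      · intro h
        have := Submodule.add_mem _ h3 h
        rwa [sub_add_cancel] at this
      · intro h
        have := Submodule.sub_mem _ h h3
        rwa [sub_sub_cancel] at this
    · refine ⟨0, Submodule.zero_mem _, ?_⟩
      have hopen : IsOpen {P : (EvenIdx n₀ n₁ m₀ m₁ → ℝ) × PUnit | P.1 ∈ 𝒰} :=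
        𝒰.isOpen.preimage continuous_fst
      filter_upwards [hopen.mem_nhds hx] with P hP
      rw [eval_freeze, h₀ _ hP, map_zero]
  have h1 := SuperPDE.sub_freeze_mem_vanishing hP hfam (hf _ hP)
  have h2 := SuperPDE.freeze_mem_vanishing (𝓙 := 𝓘) (E := E)
    (⟨PUnit.unit, TopologicalSpace.Opens.mem_top _⟩ : (⊤ : Opens PUnit)) w (key ⟨w, hP.2⟩)
  rw [hfr'] at h2
  have := Submodule.add_mem _ h1 h2
  rwa [sub_add_cancel] at this

end Propagation

end SuperZCR
end

noncomputable section
set_option linter.unusedSectionVars false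

namespace SuperZCR

open scoped ContDiff Topology TensorProduct
open TopologicalSpace (Opens)

/-! ### Solutions as products of exponentials -/

section ParityModel

variable {p q : ℕ} {o : Type}

/-- The parity automorphism of the model. -/
def Model.parity (T : Finset o) : Model p q T →ₐ[ℂ] Model p q T :=
  AlgHom.ofLinearMap
    { toFun := fun X => (Model.toMat T).symm (superParity CliffordAlgebra.involute (Model.toMat T X))
      map_add' := fun X Y => by rw [map_add, superParity_add, map_add]
      map_smul' := fun c X => by rw [map_smul, superParity_smul, map_smul, RingHom.id_apply] }
    (by simp [superParity_one]) (fun X Y => by simp [superParity_mul])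

theorem incl_parity (T : Finset o) (X : Model p q T) :
    incl T (Model.parity T X) = superParity CliffordAlgebra.involute (incl T X) := by
  rw [incl_apply, incl_apply, ← superParity_map (grassmannMap_involute _)]
  rfl

theorem Model.parity_eq_self_iff {T : Finset o} {X : Model p q T} :
    Model.parity T X = X ↔ superParity CliffordAlgebra.involute (incl T X) = incl T X := by
  rw [← incl_parity]
  exact (incl_injective T).eq_iff.symm

theorem Model.parity_exp {T : Finset o} {X : Model p q T} (hX : Model.parity T X = X) :
    Model.parity T (NormedSpace.exp X) = NormedSpace.exp X := by
  let _ : NormedAlgebra ℚ (Model p q T) := NormedAlgebra.restrictScalars ℚ ℂ _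
  have hc : Continuous (Model.parity T : Model p q T → Model p q T) :=
    LinearMap.continuous_of_finiteDimensional (Model.parity T).toLinearMap
  rw [NormedSpace.map_exp (Model.parity T) hc, hX]

theorem Model.parity_inverse {T : Finset o} {X : Model p q T} (hX : Model.parity T X = X)
    (hu : IsUnit X) : Model.parity T (Ring.inverse X) = Ring.inverse X := by
  have h1 : Model.parity T (Ring.inverse X) * X = 1 := by
    conv_lhs => rw [← hX]
    rw [hX, ← hX, ← map_mul, hX, Ring.inverse_mul_cancel _ hu, map_one]
  calc _ = Model.parity T (Ring.inverse X) * (X * Ring.inverse X) := by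
        rw [Ring.mul_inverse_cancel _ hu, mul_one]
    _ = _ := by rw [← mul_assoc, h1, one_mul]

end ParityModel

section MatrixExt

variable {n₀ n₁ m₀ m₁ p q : ℕ} {W : Type} [NormedAddCommGroup W] [NormedSpace ℝ W]
variable {𝒰 : Opens (EvenIdx n₀ n₁ m₀ m₁ → ℝ)} {𝓘 : Opens W}

theorem smat_ext {M N : SMat p q 𝒰 𝓘} (h : ∀ P, M.map (eval P) = N.map (eval P)) : M = N :=
  Matrix.ext fun i j => superFun_ext fun P => congrFun (congrFun (h P) i) j

theorem map_eval_matParity (M : SMat p q 𝒰 𝓘) (P : (EvenIdx n₀ n₁ m₀ m₁ → ℝ) × W) :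
    (matParity M).map (eval P) = superParity CliffordAlgebra.involute (M.map (eval P)) :=
  superParity_map (eval_parity P) M

/-- The extended projection onto `𝔤` commutes with evaluation, so pointwise membership makes `M` a
fixed point of it. -/
theorem mem_gMat_of_eval {g : MatrixLieSuperalgebra p q} {M : SMat p q 𝒰 𝓘}
    (h : ∀ P, M.map (eval P) ∈ gSpan CliffordAlgebra.involute g) : M ∈ gMat g 𝒰 𝓘 := by
  obtain ⟨π, hπ1, hπ2, -⟩ := exists_parity_projection g
  have : superExtend parity π M = M := smat_ext fun P => by
    rw [superExtend_map (eval_parity P), superExtend_of_mem superComm_grassmann.1 hπ2 (h P)]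
  rw [← this, gMat_eq]
  exact superExtend_mem parity hπ1 M

theorem IsExpNear.even {g : MatrixLieSuperalgebra p q} {P : (EvenIdx n₀ n₁ m₀ m₁ → ℝ) × W}
    (hP : P ∈ domain 𝒰 𝓘) {M : SMat p q 𝒰 𝓘} (h : IsExpNear g P M) :
    superParity CliffordAlgebra.involute (M.map (eval P)) = M.map (eval P) := by
  obtain ⟨N, hN⟩ := h.exists_log
  obtain ⟨S, T, hST⟩ := exists_represents N
  obtain ⟨G, hG⟩ := hST S T subset_rfl subset_rfl
  have h1 := (hG P hP).2
  have h2 := hN.self_of_nhds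
  rw [h2.2 T _ h1, ← Model.parity_eq_self_iff]
  refine Model.parity_exp (Model.parity_eq_self_iff.2 ?_)
  rw [← h1, h2.1.2]

/-- Near the point `P`, the function `H` represents a product of exponentials of even
`𝔤`-matrices. -/
def ExpProduct (g : MatrixLieSuperalgebra p q) (𝒰 : Opens (EvenIdx n₀ n₁ m₀ m₁ → ℝ)) (𝓘 : Opens W)
    {S : Finset (EvenIdx n₀ n₁ m₀ m₁)} {T : Finset (OddIdx n₀ n₁ m₀ m₁)}
    (P : (EvenIdx n₀ n₁ m₀ m₁ → ℝ) × W) (H : (S → ℝ) × W → Model p q T) : Prop :=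
  ∃ L : List (SMat p q 𝒰 𝓘), (∀ M ∈ L, IsExpNear g P M) ∧
    ∀ᶠ P' in 𝓝 P, L.prod.map (eval P') = incl T (H (restr S P'))

variable {g : MatrixLieSuperalgebra p q} {S : Finset (EvenIdx n₀ n₁ m₀ m₁)}
  {T : Finset (OddIdx n₀ n₁ m₀ m₁)} {P : (EvenIdx n₀ n₁ m₀ m₁ → ℝ) × W}
  {H K : (S → ℝ) × W → Model p q T}

theorem ExpProduct.mul (hH : ExpProduct g 𝒰 𝓘 P H) (hK : ExpProduct g 𝒰 𝓘 P K) :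
    ExpProduct g 𝒰 𝓘 P (fun z => H z * K z) := by
  obtain ⟨L, hL, h⟩ := hH
  obtain ⟨L', hL', h'⟩ := hK
  refine ⟨L ++ L', fun M hM => (List.mem_append.1 hM).elim (hL M) (hL' M), ?_⟩
  filter_upwards [h, h'] with P' h h'
  rw [List.prod_append, map_eval_mul, h, h', map_mul]

theorem ExpProduct.congr (hH : ExpProduct g 𝒰 𝓘 P H) (h : ∀ᶠ z in 𝓝 (restr S P), H z = K z) :
    ExpProduct g 𝒰 𝓘 P K := by
  obtain ⟨L, hL, h'⟩ := hH
  refine ⟨L, hL, ?_⟩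
  filter_upwards [h', eventually_restr.2 h] with P' h1 h2
  rw [h1, h2]

theorem ExpProduct.even (hP : P ∈ domain 𝒰 𝓘) (hH : ExpProduct g 𝒰 𝓘 P H) :
    Model.parity T (H (restr S P)) = H (restr S P) := by
  obtain ⟨L, hL, h⟩ := hH
  rw [Model.parity_eq_self_iff, ← h.self_of_nhds]
  clear h
  induction L with
  | nil => rw [List.prod_nil, map_eval_one, superParity_one]
  | cons M L ih =>
    rw [List.prod_cons, map_eval_mul, superParity_mul, (hL M List.mem_cons_self).even hP,
      ih fun M hM => hL M (List.mem_cons_of_mem _ hM)]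

/-- The exponential of a nilpotent even `𝔤`-matrix. -/
theorem expProduct_soul [FiniteDimensional ℝ W] {p₁ : Model p q T →L[ℝ] Model p q T}
    (hp : ∀ X, IsEvenG g (incl T (p₁ X))) {n : ℕ} (hn : ∀ X, p₁ X ^ n = 0)
    {Y : (S → ℝ) × W → Model p q T} (hY : ∀ᶠ z in 𝓝 (restr S P), ContDiffAt ℝ ∞ Y z) :
    ExpProduct g 𝒰 𝓘 P (fun z => NormedSpace.exp (p₁ (Y z))) := by
  -- The definition of `IsExpNear` asks for an exponent on all of `𝒰 × 𝓘`, so `Y` is cut off away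
  -- from the point; linearity of `p₁` keeps the values even, in `𝔤` and nilpotent.
  obtain ⟨χ, -, hχ1, hχ⟩ := exists_contDiff_eventuallyEq hY
  obtain ⟨N, hN⟩ := exists_of_represents (𝒰 := 𝒰) (𝓘 := 𝓘) (S := S)
    (G := fun z => p₁ (χ z • Y z)) fun P _ => (p₁.contDiff.comp hχ).contDiffAt
  have hN1 : N ∈ gMat g 𝒰 𝓘 := mem_gMat_of_eval fun P => by rw [hN]; exact (hp _).1
  have hN2 : matParity N = N := smat_ext fun P => by
    rw [map_eval_matParity, hN]; exact (hp _).2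
  have hN3 : N ^ n = 0 := smat_ext fun P => by
    rw [map_eval_pow, hN, ← map_pow, hn, map_zero]
    exact (map_zero (eval P).mapMatrix).symm
  refine ⟨[nilExp n N], fun M hM => ?_, ?_⟩
  · rw [List.mem_singleton] at hM
    exact Or.inl ⟨N, hN1, hN2, n, hN3, hM⟩
  · filter_upwards [eventually_restr.2 hχ1] with P' hP'
    have hP' : χ (restr S P') = 1 := hP'
    rw [List.prod_singleton, map_eval_nilExp, hN, ← incl_exp_of_pow_eq_zero, hP', one_smul]
    rw [← map_pow, hn, map_zero]

/-- The exponential of an even `𝔤`-matrix that does not involve the odd coordinates. -/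
theorem expProduct_body [FiniteDimensional ℝ W] {p₀ : Model p q T →L[ℝ] Model p q T}
    {B : Model p q T →L[ℝ] SqMat p q ℂ}
    (hpB : ∀ X, incl T (p₀ X) = (B X).map (algebraMap ℂ (Grassmann (OddIdx n₀ n₁ m₀ m₁))))
    (hB : ∀ X, B X ∈ g.carrier ∧ constParity (B X) = B X)
    {Y : (S → ℝ) × W → Model p q T} (hY : ∀ᶠ z in 𝓝 (restr S P), ContDiffAt ℝ ∞ Y z) :
    ExpProduct g 𝒰 𝓘 P (fun z => NormedSpace.exp (p₀ (Y z))) := by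
  obtain ⟨χ, -, hχ1, hχ⟩ := exists_contDiff_eventuallyEq hY
  obtain ⟨M, hM⟩ := exists_of_represents (𝒰 := 𝒰) (𝓘 := 𝓘) (S := S)
    (G := fun z => NormedSpace.exp (p₀ (χ z • Y z))) fun P _ =>
      (contDiff_exp.comp (p₀.contDiff.comp hχ)).contDiffAt
  have hBs : ∀ i j, ContDiff ℝ ∞ (fun z => B (χ z • Y z) i j) := by
    intro i j
    let A : SqMat p q ℂ →L[ℝ] ℂ := (LinearMap.toContinuousLinearMap
      (Matrix.entryLinearMap ℂ ℂ i j)).restrictScalars ℝ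
    exact (A.comp B).contDiff.comp hχ
  refine ⟨[M], fun M' hM' => ?_, ?_⟩
  · rw [List.mem_singleton] at hM'
    subst hM'
    refine Or.inr ⟨Matrix.of fun i j => smoothOf 𝒰 𝓘 S _ fun P _ => (hBs i j).contDiffAt,
      Filter.Eventually.of_forall fun P' => ?_⟩
    have e : (Matrix.of fun i j => smoothOf 𝒰 𝓘 S _ fun P _ => (hBs i j).contDiffAt).map
        (evalFun P') = B (χ (restr S P') • Y (restr S P')) := rfl
    rw [e]
    exact ⟨(hB _).1, (hB _).2, by rw [hM, incl_exp_of_body (hpB _)]⟩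
  · filter_upwards [eventually_restr.2 hχ1] with P' hP'
    have hP' : χ (restr S P') = 1 := hP'
    rw [List.prod_singleton, hM, hP', one_smul]

theorem map_eval_freezeMat {W' : Type} [NormedAddCommGroup W'] [NormedSpace ℝ W'] (𝓙 : Opens W')
    (w₀ : 𝓘) (M : SMat p q 𝒰 𝓘) (P : (EvenIdx n₀ n₁ m₀ m₁ → ℝ) × W') :
    (freezeMat 𝓙 w₀ M).map (eval P) = M.map (eval (P.1, w₀.1)) := by
  ext i j
  exact eval_freeze _ _ _ _

theorem tendsto_freeze (x : EvenIdx n₀ n₁ m₀ m₁ → ℝ) (w w' : W) :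
    Filter.Tendsto (fun P : (EvenIdx n₀ n₁ m₀ m₁ → ℝ) × W => (P.1, w)) (𝓝 (x, w')) (𝓝 (x, w)) := by
  have : Continuous (fun P : (EvenIdx n₀ n₁ m₀ m₁ → ℝ) × W => (P.1, w)) := by fun_prop
  exact this.tendsto (x, w')

theorem IsExpNear.freezeMat {x : EvenIdx n₀ n₁ m₀ m₁ → ℝ} {w : 𝓘} {M : SMat p q 𝒰 𝓘}
    (h : IsExpNear g (x, w.1) M) (w' : W) : IsExpNear g (x, w') (freezeMat 𝓘 w M) := by
  rcases h with ⟨N, hN, hN', n, hn, rfl⟩ | ⟨X, hX⟩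
  · refine Or.inl ⟨SuperZCR.freezeMat 𝓘 w N, ?_, ?_, n, ?_, ?_⟩
    · rw [gMat_eq] at hN ⊢
      exact gSpan_map (fun x => (parity_freeze 𝓘 w x).symm) hN
    · refine smat_ext fun P => ?_
      rw [map_eval_matParity, map_eval_freezeMat, ← map_eval_matParity, hN']
    · refine smat_ext fun P => ?_
      rw [map_eval_pow, map_eval_freezeMat, ← map_eval_pow, hn]
      exact (map_zero (eval (P.1, w.1)).mapMatrix).trans (map_zero (eval P).mapMatrix).symm
    · refine smat_ext fun P => ?_
      rw [map_eval_freezeMat, map_eval_nilExp, map_eval_nilExp, map_eval_freezeMat]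
  -- Freezing is available for superfunctions; the body reads the frozen function back as an
  -- ordinary smooth function.
  · let Y : Matrix (Fin p ⊕ Fin q) (Fin p ⊕ Fin q) (smoothFun 𝒰 𝓘) := X.map fun f =>
      coefficient body.toLinearMap (freeze 𝓘 w (superTmul f (1 : Grassmann (OddIdx n₀ n₁ m₀ m₁))))
    have hY : ∀ P, Y.map (evalFun P) = X.map (evalFun (P.1, w.1)) := by
      intro P
      ext i j
      change (coefficient body.toLinearMap (SuperZCR.freeze 𝓘 w
        (superTmul (X i j) (1 : Grassmann (OddIdx n₀ n₁ m₀ m₁))))).1 P = (X i j).1 (P.1, w.1)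
      rw [coefficient_apply, eval_freeze, eval_superTmul]
      simp
    refine Or.inr ⟨Y, ?_⟩
    filter_upwards [(tendsto_freeze x w.1 w').eventually hX] with P hP
    rw [hY, map_eval_freezeMat]
    exact hP

theorem ExpProduct.freeze {x : EvenIdx n₀ n₁ m₀ m₁ → ℝ} {w : 𝓘}
    (h : ExpProduct g 𝒰 𝓘 (x, w.1) H) (w' : W) :
    ExpProduct g 𝒰 𝓘 (x, w') (fun z => H (z.1, w.1)) := by
  obtain ⟨L, hL, h⟩ := h
  refine ⟨L.map (freezeMat 𝓘 w), fun M hM => ?_, ?_⟩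
  · obtain ⟨N, hN, rfl⟩ := List.mem_map.1 hM
    exact (hL N hN).freezeMat w'
  · have e : (L.map (freezeMat 𝓘 w)).prod = freezeMat 𝓘 w L.prod :=
      (map_list_prod (SuperZCR.freeze 𝓘 w).mapMatrix L).symm
    filter_upwards [(tendsto_freeze x w.1 w').eventually h] with P hP
    rw [e, map_eval_freezeMat, hP]
    rfl

end MatrixExt

section Solution

variable {n₀ n₁ m₀ m₁ p q : ℕ} {𝕜 : Type} [RCLike 𝕜]
variable {𝒰 : Opens (EvenIdx n₀ n₁ m₀ m₁ → ℝ)} {𝓘 : Opens 𝕜} {g : MatrixLieSuperalgebra p q}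
  {S : Finset (EvenIdx n₀ n₁ m₀ m₁)} {T : Finset (OddIdx n₀ n₁ m₀ m₁)}

/-- The solution of `∂H/∂w = Q H`, where `Q` is an even `𝔤`-matrix, is locally a product of
exponentials of even `𝔤`-matrices, if this holds for the initial value. -/
theorem expProduct_of_solution [PreconnectedSpace 𝓘] {Q H : (S → ℝ) × 𝕜 → Model p q T}
    (hQ : ∀ P ∈ domain 𝒰 𝓘, ContDiffAt ℝ ∞ Q (restr S P) ∧ IsEvenG g (incl T (Q (restr S P))))
    (hH : ∀ P ∈ domain 𝒰 𝓘, ContDiffAt ℝ ∞ H (restr S P) ∧ IsUnit (H (restr S P)) ∧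
      ∀ a, fderiv ℝ H (restr S P) (0, a) = RCLike.map 𝕜 ℂ a • (Q (restr S P) * H (restr S P)))
    {w₀ : 𝓘} (h₀ : ∀ x ∈ 𝒰, H (restr S (x, w₀.1)) = 1)
    {P : (EvenIdx n₀ n₁ m₀ m₁ → ℝ) × 𝕜} (hP : P ∈ domain 𝒰 𝓘) : ExpProduct g 𝒰 𝓘 P H := by
  obtain ⟨x, w⟩ := P
  have hx : x ∈ 𝒰 := hP.1
  obtain ⟨B, p₀, p₁, π, hpB, hB, ⟨n, hn⟩, hsum, h0, h1, hπ, hker, hLie⟩ :=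
    exists_model_projections g T
  have hp₁ : ∀ X, IsEvenG g (incl T (p₁ X)) := fun X => (hker _).1 (h1 X)
  have hfac : ∀ w : 𝓘, ∃ Y : (S → ℝ) × 𝕜 → Model p q T, ∀ᶠ z in 𝓝 (restr S (x, w.1)),
      ContDiffAt ℝ ∞ Y z ∧
        H z = NormedSpace.exp (p₀ (Y z)) * NormedSpace.exp (p₁ (Y z)) * H (z.1, w.1) := by
    intro w
    have hdom : ∀ᶠ P in 𝓝 (x, w.1), P ∈ domain 𝒰 𝓘 := isOpen_domain.mem_nhds ⟨hx, w.2⟩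
    refine exists_exp_factorization (z₀ := restr S (x, w.1)) (Q := Q) hLie hsum h0 h1 hπ ?_ ?_ ?_
    · exact eventually_restr.1 (hdom.mono fun P hP => (hQ P hP).1.continuousAt)
    · refine eventually_restr.1 (hdom.mono fun P hP a => (hker _).2 ?_)
      have h := (hQ P hP).2
      rw [map_smul]
      exact ⟨Submodule.smul_mem _ _ h.1, by rw [superParity_smul, h.2]⟩
    · exact eventually_restr.1 (hdom.mono fun P hP => hH P hP)
  have key : ∀ w : 𝓘, ExpProduct g 𝒰 𝓘 (x, w.1) H := by
    -- Near `(x, w)` the solution is a product of two exponentials and its own slice over `w`, so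
    -- being a product of exponentials at `w` and at a nearby `w₂` are equivalent.
    refine forall_of_locally_iff (x₀ := w₀) (fun w => ?_) ?_
    · obtain ⟨Y, hY⟩ := hfac w
      have hc : Filter.Tendsto (fun w₂ : 𝓘 => restr S (x, w₂.1)) (𝓝 w) (𝓝 (restr S (x, w.1))) := by
        have : Continuous (fun w₂ : 𝓘 => restr S (x, w₂.1)) :=
          (continuous_restr S).comp (by fun_prop)
        exact this.tendsto w
      filter_upwards [hc.eventually hY.eventually_nhds] with w₂ hY₂
      have hYs := hY₂.mono fun z h => h.1
      constructor
      · intro h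
        refine (((expProduct_body hpB hB hYs).mul (expProduct_soul hp₁ hn hYs)).mul
          (h.freeze w₂.1)).congr ?_
        exact hY₂.mono fun z h => h.2.symm
      · intro h
        have ht : Filter.Tendsto (fun z : (S → ℝ) × 𝕜 => (z.1, w₂.1)) (𝓝 (restr S (x, w.1)))
            (𝓝 (restr S (x, w₂.1))) := by
          have : Continuous (fun z : (S → ℝ) × 𝕜 => (z.1, w₂.1)) := by fun_prop
          exact this.tendsto (restr S (x, w.1))
        have hYn : ∀ᶠ z in 𝓝 (restr S (x, w.1)),
            ContDiffAt ℝ ∞ (fun z : (S → ℝ) × 𝕜 => -Y (z.1, w₂.1)) z := by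
          filter_upwards [ht.eventually hYs] with z hz
          exact (ContDiffAt.comp z hz
            (by fun_prop : ContDiff ℝ ∞ fun z : (S → ℝ) × 𝕜 => (z.1, w₂.1)).contDiffAt).neg
        -- To come back from `w₂` to `w`, the factorization is taken over `w₂` and inverted: the
        -- exponentials appear in reverse order with `-Y`. This recovers the slice over `w` from the
        -- frozen slice over `w₂`.
        have hw : ExpProduct g 𝒰 𝓘 (x, w.1) (fun z => H (z.1, w.1)) := by
          refine (((expProduct_soul hp₁ hn hYn).mul (expProduct_body hpB hB hYn)).mul
            (h.freeze w.1)).congr ?_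
          filter_upwards [ht.eventually hY₂] with z hz
          rw [hz.2, map_neg, map_neg]
          simp only [mul_assoc]
          rw [← mul_assoc (NormedSpace.exp (-p₀ (Y (z.1, w₂.1)))), exp_neg_mul_exp, one_mul,
            ← mul_assoc, exp_neg_mul_exp, one_mul]
        have hYw := hY.mono fun z h => h.1
        refine (((expProduct_body hpB hB hYw).mul (expProduct_soul hp₁ hn hYw)).mul hw).congr ?_
        exact hY.mono fun z h => h.2.symm
    · obtain ⟨Y, hY⟩ := hfac w₀
      have hYs := hY.mono fun z h => h.1
      refine ((expProduct_body hpB hB hYs).mul (expProduct_soul hp₁ hn hYs)).congr ?_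
      have hH1 : ∀ᶠ z in 𝓝 (restr S (x, w₀.1)), H (z.1, w₀.1) = 1 := by
        refine eventually_restr.1 ?_
        have hopen : IsOpen {P : (EvenIdx n₀ n₁ m₀ m₁ → ℝ) × 𝕜 | P.1 ∈ 𝒰} :=
          𝒰.isOpen.preimage continuous_fst
        filter_upwards [hopen.mem_nhds hx] with P hP
        exact h₀ P.1 hP
      filter_upwards [hY, hH1] with z hz hz1
      rw [hz.2, hz1, mul_one]
  exact key ⟨w, hP.2⟩

end Solution

end SuperZCR
end

noncomputable section
set_option linter.unusedSectionVars false

namespace SuperZCR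

open scoped ContDiff Topology TensorProduct
open TopologicalSpace (Opens)

/-! ### From the infinitesimal generator to gauge transformations -/

section GaugeFamily

variable {n₀ n₁ m₀ m₁ p q r : ℕ} {𝕜 : Type} [RCLike 𝕜]
variable {𝒰 : Opens (EvenIdx n₀ n₁ m₀ m₁ → ℝ)} {𝓘 : Opens 𝕜} {g : MatrixLieSuperalgebra p q}

/-- The initial value problem `∂H/∂w = Q H`, `H(w₀) = 1`, for the function `Q` that represents
a family of even `𝔤`-matrices. -/
theorem exists_model_solution [SimplyConnectedSpace 𝓘] {Q : SMat p q 𝒰 𝓘} (hQf : IsFamily Q)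
    {S : Finset (EvenIdx n₀ n₁ m₀ m₁)} {T : Finset (OddIdx n₀ n₁ m₀ m₁)}
    {G : (S → ℝ) × 𝕜 → Model p q T} (hG : Represents G Q) (w₀ : 𝓘) :
    ∃ H : (S → ℝ) × 𝕜 → Model p q T, (∀ x ∈ 𝒰, H (restr S (x, w₀.1)) = 1) ∧
      (∀ P ∈ domain 𝒰 𝓘, ContDiffAt ℝ ∞ H (restr S P) ∧ IsUnit (H (restr S P)) ∧
        ∀ a, fderiv ℝ H (restr S P) (0, a) =
          RCLike.map 𝕜 ℂ a • (G (restr S P) * H (restr S P))) ∧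
      ∀ z, z ∉ restr S '' domain 𝒰 𝓘 → H z = 1 := by
  classical
  have hDo : IsOpen (restr S '' domain 𝒰 𝓘) := isOpenMap_restr S _ isOpen_domain
  -- The domain is a product, so its image in finitely many coordinates is `V × 𝓘`, with `V` read
  -- off from the slice over `w₀`.
  let V : Set (S → ℝ) := (fun v => (v, w₀.1)) ⁻¹' (restr S '' domain 𝒰 𝓘)
  have hV : IsOpen V := hDo.preimage (by fun_prop)
  have hVD : ∀ z : (S → ℝ) × 𝕜, z.1 ∈ V → z.2 ∈ 𝓘 → ∃ P ∈ domain 𝒰 𝓘, restr S P = z := by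
    rintro ⟨v, w⟩ ⟨P, hP, hv⟩ hw
    have h1 : (restr S P).1 = v := by rw [hv]
    exact ⟨(P.1, w), ⟨hP.1, hw⟩, Prod.ext h1 rfl⟩
  have hDV : ∀ P ∈ domain 𝒰 𝓘, (restr S P).1 ∈ V ∧ (restr S P).2 ∈ 𝓘 := fun P hP =>
    ⟨⟨(P.1, w₀.1), ⟨hP.1, w₀.2⟩, rfl⟩, hP.2⟩
  obtain ⟨K, hK₀, hK⟩ := exists_global_solution hV (𝓘 := 𝓘) (Q := G)
    (fun z h1 h2 => by
      obtain ⟨P, hP, rfl⟩ := hVD z h1 h2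
      exact (hG P hP).1)
    (fun z h1 h2 a => by
      obtain ⟨P, hP, rfl⟩ := hVD z h1 h2
      have hd : ∀ b : 𝕜, (matDeriv (0, b) Q).map (eval P) =
          incl T (fderiv ℝ G (restr S P) (0, b)) := fun b =>
        map_eval_matDeriv hP ((hG P hP).1.differentiableAt (by simp))
          (Filter.mem_of_superset (isOpen_domain.mem_nhds hP) fun P' hP' => (hG P' hP').2) (0, b)
      refine incl_injective T ?_
      rw [map_smul, ← hd, ← hd]
      exact isFamily_iff.1 hQf a P hP) w₀
  -- The default value `1` off the image makes `H` invertible and even everywhere, so that `S T = 1`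
  -- and the parity identities hold at all points, as equality of superfunctions demands.
  refine ⟨fun z => if z ∈ restr S '' domain 𝒰 𝓘 then K z else 1, fun x hx => ?_, fun P hP => ?_,
    fun z hz => if_neg hz⟩
  · refine (if_pos ⟨_, ⟨hx, w₀.2⟩, rfl⟩).trans ?_
    exact hK₀ _ (hDV (x, w₀.1) ⟨hx, w₀.2⟩).1
  · have hz : restr S P ∈ restr S '' domain 𝒰 𝓘 := ⟨P, hP, rfl⟩
    have he : (fun z => if z ∈ restr S '' domain 𝒰 𝓘 then K z else 1) =ᶠ[𝓝 (restr S P)] K := by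
      filter_upwards [hDo.mem_nhds hz] with z hz
      exact if_pos hz
    obtain ⟨h1, h2, h3⟩ := hK _ (hDV P hP).1 (hDV P hP).2
    have hK' := he.eq_of_nhds
    beta_reduce at hK'
    refine ⟨h1.congr_of_eventuallyEq he, ?_, fun a => ?_⟩
    · beta_reduce
      rw [hK']
      exact h2
    · beta_reduce
      rw [he.fderiv_eq, hK']
      exact h3 a

/-- A family of even `𝔤`-matrices is the logarithmic derivative of a family of `G`-matrices. -/
theorem exists_gMatrix_family [SimplyConnectedSpace 𝓘] {Q : SMat p q 𝒰 𝓘}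
    (hQg : Q ∈ gMat g 𝒰 𝓘) (hQf : IsFamily Q) (hQe : matParity Q = Q) (w₀ : 𝓘) :
    ∃ S T : SMat p q 𝒰 𝓘, matParity S = S ∧ matParity T = T ∧ S * T = 1 ∧ T * S = 1 ∧
      (∀ x ∈ 𝒰, S.map (eval (x, w₀.1)) = 1) ∧
      (∀ a, ∀ P ∈ domain 𝒰 𝓘, (matDeriv (0, a) S).map (eval P) =
        RCLike.map 𝕜 ℂ a • (Q * S).map (eval P)) ∧
      ∀ P ∈ domain 𝒰 𝓘, ∃ L : List (SMat p q 𝒰 𝓘), (∀ M ∈ L, IsExpNear g P M) ∧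
        ∀ᶠ P' in 𝓝 P, S.map (eval P') = L.prod.map (eval P') := by
  obtain ⟨s, t, hst⟩ := exists_represents Q
  obtain ⟨G, hG⟩ := hst s t subset_rfl subset_rfl
  obtain ⟨H, hH₀, hH, hH1⟩ := exists_model_solution hQf hG w₀
  have hexp : ∀ P ∈ domain 𝒰 𝓘, ExpProduct g 𝒰 𝓘 P H := fun P hP =>
    expProduct_of_solution (Q := G) (fun P hP => ⟨(hG P hP).1, by
      rw [← (hG P hP).2]
      exact isEvenG_eval hQg hQe P⟩) hH hH₀ hP
  have hprop : ∀ z, IsUnit (H z) ∧ Model.parity t (H z) = H z := by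
    intro z
    by_cases hz : z ∈ restr s '' domain 𝒰 𝓘
    · obtain ⟨P, hP, rfl⟩ := hz
      exact ⟨(hH P hP).2.1, (hexp P hP).even hP⟩
    · rw [hH1 z hz]
      exact ⟨isUnit_one, map_one _⟩
  obtain ⟨S, hS⟩ := exists_of_represents fun P hP => (hH P hP).1
  obtain ⟨T, hT⟩ := exists_of_represents (𝒰 := 𝒰) (𝓘 := 𝓘) (S := s) (T := t)
    (G := fun z => Ring.inverse (H z)) fun P hP => by
      obtain ⟨u, hu⟩ := (hH P hP).2.1
      have h : ContDiffAt ℝ ∞ (Ring.inverse : Model p q t → Model p q t) (H (restr s P)) := by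
        rw [← hu]
        exact contDiffAt_ringInverse ℝ u
      exact h.comp (restr s P) (hH P hP).1
  refine ⟨S, T, smat_ext fun P => ?_, smat_ext fun P => ?_, smat_ext fun P => ?_,
    smat_ext fun P => ?_, fun x hx => ?_, fun a P hP => ?_, fun P hP => ?_⟩
  · rw [map_eval_matParity, hS, ← incl_parity, (hprop _).2]
  · rw [map_eval_matParity, hT, ← incl_parity, Model.parity_inverse (hprop _).2 (hprop _).1]
  · rw [map_eval_mul, hS, hT, ← map_mul, Ring.mul_inverse_cancel _ (hprop _).1, map_one,
      map_eval_one]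
  · rw [map_eval_mul, hS, hT, ← map_mul, Ring.inverse_mul_cancel _ (hprop _).1, map_one,
      map_eval_one]
  · rw [hS, hH₀ x hx, map_one]
  · rw [map_eval_matDeriv hP ((hH P hP).1.differentiableAt (by simp))
      (Filter.Eventually.of_forall hS), map_eval_mul, hS, (hG P hP).2, ← map_mul, ← map_smul,
      ← (hH P hP).2.2 a]
    rfl
  · obtain ⟨L, hL, h⟩ := hexp P hP
    refine ⟨L, hL, ?_⟩
    filter_upwards [h] with P' h
    rw [h, hS]

theorem map_eval_matD_congr (c : Fin n₀ ⊕ Fin n₁) {M N : SMat p q 𝒰 𝓘}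
    {P : (EvenIdx n₀ n₁ m₀ m₁ → ℝ) × 𝕜} (hP : P ∈ domain 𝒰 𝓘)
    (h : ∀ᶠ P' in 𝓝 P, M.map (eval P') = N.map (eval P')) :
    (matD c M).map (eval P) = (matD c N).map (eval P) := by
  ext i j
  rw [Matrix.map_apply, Matrix.map_apply, matD_apply, matD_apply, map_smul, map_smul,
    eval_totalD_congr c hP (h.mono fun _ h => congrFun (congrFun h i) j)]

theorem matD_smul (c : Fin n₀ ⊕ Fin n₁) (a : ℂ) (M : SMat p q 𝒰 𝓘) :
    matD c (a • M) = a • matD c M := by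
  ext i j
  rw [Matrix.smul_apply, matD_apply, matD_apply, Matrix.smul_apply, totalD_smul, smul_comm]

theorem map_eval_smul (a : ℂ) (M : SMat p q 𝒰 𝓘) (P : (EvenIdx n₀ n₁ m₀ m₁ → ℝ) × 𝕜) :
    (a • M).map (eval P) = a • M.map (eval P) := by
  ext i j
  exact map_smul (eval P) a (M i j)

theorem map_eval_zero (P : (EvenIdx n₀ n₁ m₀ m₁ → ℝ) × 𝕜) :
    (0 : SMat p q 𝒰 𝓘).map (eval P) = 0 :=
  map_zero (eval P).mapMatrix

theorem map_eval_sub (M N : SMat p q 𝒰 𝓘) (P : (EvenIdx n₀ n₁ m₀ m₁ → ℝ) × 𝕜) :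
    (M - N).map (eval P) = M.map (eval P) - N.map (eval P) :=
  map_sub (eval P).mapMatrix M N

theorem IsFamily.matD {M : SMat p q 𝒰 𝓘} (hM : IsFamily M) (c : Fin n₀ ⊕ Fin n₁) :
    IsFamily (matD c M) := by
  rw [isFamily_iff] at *
  intro a P hP
  rw [matDeriv_matD, matDeriv_matD, ← map_eval_smul, ← matD_smul]
  refine map_eval_matD_congr c hP ?_
  filter_upwards [isOpen_domain.mem_nhds hP] with P' hP'
  rw [map_eval_smul, hM a P' hP']

theorem IsFamily.sub {M N : SMat p q 𝒰 𝓘} (hM : IsFamily M) (hN : IsFamily N) :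
    IsFamily (M - N) := by
  rw [isFamily_iff] at *
  intro a P hP
  rw [matDeriv_sub, matDeriv_sub, map_eval_sub, map_eval_sub, hM a P hP, hN a P hP, smul_sub]

theorem isFamily_freezeMat (w₀ : 𝓘) (M : SMat p q 𝒰 𝓘) : IsFamily (freezeMat 𝓘 w₀ M) := by
  rw [isFamily_iff]
  intro a P hP
  rw [matDeriv_freezeMat, matDeriv_freezeMat, map_eval_zero, smul_zero]

/-- At a parameter value where the matrix is the identity, its total derivatives vanish. -/
theorem map_eval_matD_eq_zero {M : SMat p q 𝒰 𝓘} {w₀ : 𝓘}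
    (h : ∀ x ∈ 𝒰, M.map (eval (x, w₀.1)) = 1) (c : Fin n₀ ⊕ Fin n₁)
    {x : EvenIdx n₀ n₁ m₀ m₁ → ℝ} (hx : x ∈ 𝒰) : (matD c M).map (eval (x, w₀.1)) = 0 := by
  have hP : ((x, w₀.1) : (EvenIdx n₀ n₁ m₀ m₁ → ℝ) × 𝕜) ∈ domain 𝒰 𝓘 := ⟨hx, w₀.2⟩
  have h1 : (matD c (freezeMat 𝓘 w₀ M)).map (eval (x, w₀.1)) =
      (matD c M).map (eval (x, w₀.1)) := by
    ext i j
    rw [Matrix.map_apply, Matrix.map_apply, matD_apply, matD_apply, map_smul, map_smul]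
    congr 1
    exact (eval_totalD_freeze 𝓘 w₀ c (M i j) hP).trans (eval_freeze _ _ _ _)
  rw [← h1, map_eval_matD_congr c hP (N := 1), matD_one, map_eval_zero]
  filter_upwards [isOpen_domain.mem_nhds hP] with P' hP'
  rw [map_eval_freezeMat, h _ hP'.1, map_eval_one]

theorem rclike_map_one : RCLike.map 𝕜 ℂ 1 = 1 := by
  simp [RCLike.map]

/-- This is the parameter derivative of `T α S - T · D S`, with `∂S = Q S`, `∂T = -T Q` and `b =
∂α`; in the use `DQ` and `Ds` are the total derivatives of `Q` and `S`. -/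
theorem inverse_gauge_deriv_identity {R : Type} [Ring R] {s t a b Q DQ Ds : R}
    (hb : b = DQ - (a * Q - Q * a)) :
    -(t * Q) * a * s + t * b * s + t * a * (Q * s) -
      (-(t * Q) * Ds + t * (DQ * s + Q * Ds)) = 0 := by
  rw [hb]
  noncomm_ring

/-- The infinitesimal condition implies that the parameter is removable. -/
theorem SuperPDE.isRemovable_of_generator {E : SuperPDE 𝒰 r} [SimplyConnectedSpace 𝓘]
    {α : OneForm p q 𝒰 𝓘} (hα : ∀ c, IsFamily (α c)) {Q : SMat p q 𝒰 𝓘}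
    (hQg : Q ∈ gMat g 𝒰 𝓘) (hQf : IsFamily Q) (hQe : matParity Q = Q)
    (hQ : E.FormEq (fun c => paramDeriv (α c)) (dhMat Q - bracketFormMat α Q)) :
    E.IsRemovable g α := by
  intro w₀
  obtain ⟨S, T, hSe, hTe, hST, hTS, hS₀, hdS, hexp⟩ := exists_gMatrix_family hQg hQf hQe w₀
  have hdT : ∀ a, ∀ P ∈ domain 𝒰 𝓘, (matDeriv (0, a) T).map (eval P) =
      RCLike.map 𝕜 ℂ a • (-(T * Q)).map (eval P) := by
    intro a P hP
    have h1 : matDeriv (0, a) T = -(T * matDeriv (0, a) S * T) := by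
      have h := matDeriv_mul (0, a) T S
      rw [hTS, matDeriv_one] at h
      rw [eq_neg_iff_add_eq_zero]
      calc _ = (matDeriv (0, a) T * S + T * matDeriv (0, a) S) * T := by
            rw [add_mul, mul_assoc (matDeriv (0, a) T), hST, mul_one]
        _ = 0 := by rw [← h, zero_mul]
    have h2 : -(T * Q) = -(T * (Q * S) * T) := by
      rw [mul_assoc, mul_assoc, hST, mul_one]
    rw [h1, h2, ← zero_sub, ← zero_sub (T * _ * T), map_eval_sub, map_eval_sub, map_eval_mul,
      map_eval_mul, hdS a P hP, map_eval_mul (T * _), map_eval_mul T, map_eval_zero, zero_sub,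
      zero_sub, mul_smul_comm, smul_mul_assoc, smul_neg]
  have hSf : IsFamily S := isFamily_iff.2 fun a P hP => by
    rw [hdS a P hP, hdS 1 P hP, rclike_map_one, one_smul]
  have hTf : IsFamily T := isFamily_iff.2 fun a P hP => by
    rw [hdT a P hP, hdT 1 P hP, rclike_map_one, one_smul]
  have hgS : ∀ P ∈ domain 𝒰 𝓘, E.germ P (matDeriv (0, (1 : 𝕜)) S) = E.germ P (Q * S) :=
    fun P hP => SuperPDE.germ_congr (Filter.mem_of_superset (isOpen_domain.mem_nhds hP) fun P' hP' => by
      change _ = _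
      rw [hdS 1 P' hP', rclike_map_one, one_smul])
  have hgT : ∀ P ∈ domain 𝒰 𝓘, E.germ P (matDeriv (0, (1 : 𝕜)) T) = E.germ P (-(T * Q)) :=
    fun P hP => SuperPDE.germ_congr (Filter.mem_of_superset (isOpen_domain.mem_nhds hP) fun P' hP' => by
      change _ = _
      rw [hdT 1 P' hP', rclike_map_one, one_smul])
  have hT₀ : ∀ x ∈ 𝒰, T.map (eval (x, w₀.1)) = 1 := fun x hx => by
    have h := congrArg (fun M : SMat p q 𝒰 𝓘 => M.map (eval (x, w₀.1))) hST
    simp only [map_eval_mul, hS₀ x hx, one_mul, map_eval_one] at h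
    exact h
  refine ⟨S, T, hSf, hTf, ⟨hSe, hTe, ?_, ?_, fun P h1 h2 => ?_⟩, ?_, fun c => ?_⟩
  · rw [hST]
    exact SuperPDE.matEq_iff.2 fun _ _ => rfl
  · rw [hTS]
    exact SuperPDE.matEq_iff.2 fun _ _ => rfl
  · obtain ⟨L, hL, h⟩ := hexp P ⟨h1, h2⟩
    exact ⟨L, hL, fun i j => SuperPDE.germ_eq.1 (SuperPDE.germ_congr h) i j⟩
  · refine SuperPDE.matEq_iff.2 fun P hP => SuperPDE.germ_congr ?_
    filter_upwards [isOpen_domain.mem_nhds hP] with P' hP'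
    rw [map_eval_freezeMat, hS₀ _ hP'.1, map_eval_one]
  · refine SuperPDE.matEq_iff.2 fun P hP => ?_
    rw [gauge_of_even hSe]
    have hfr : freezeForm 𝓘 w₀ α c = freezeMat 𝓘 w₀ (α c) := rfl
    rw [hfr]
    -- The gauge equation is tested in the equivalent form `T α S - T · D S = α₀`. Unlike the
    -- original it has a left side whose parameter derivative vanishes on `ℰ^∞`, and at `w₀` both
    -- sides agree since `S = T = 1` and `D S = 0` there.
    have hfam : IsFamily (T * α c * S - T * matD c S - freezeMat 𝓘 w₀ (α c)) :=
      (((hTf.mul (hα c)).mul hSf).sub (hTf.mul (hSf.matD c))).sub (isFamily_freezeMat w₀ (α c))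
    have key : E.germ P (T * α c * S - T * matD c S - freezeMat 𝓘 w₀ (α c)) = 0 := by
      rw [SuperPDE.germ_eq_zero]
      intro i j
      refine SuperPDE.mem_vanishing_of_deriv (w₀ := w₀)
        (fun a P hP => hfam a P hP.1 hP.2 i j) (fun P hP => ?_) (fun x hx => ?_) hP
      · have h : E.germ P (matDeriv (0, (1 : 𝕜))
            (T * α c * S - T * matD c S - freezeMat 𝓘 w₀ (α c))) = 0 := by
          have hb : E.germ P (matDeriv (0, (1 : 𝕜)) (α c)) =
              E.germ P (matD c Q - bracketFormMat α Q c) := SuperPDE.matEq_iff.1 (hQ c) P hP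
          rw [bracketFormMat_of_even _ hQe] at hb
          simp only [map_sub, map_mul] at hb
          have hD := SuperPDE.germ_matD hP c (hgS P hP)
          rw [matD_mul c hQe] at hD
          simp only [matDeriv_sub, matDeriv_mul, matDeriv_freezeMat, sub_zero, matDeriv_matD,
            map_sub, map_mul, map_add, hgS P hP, hgT P hP, hD, map_neg]
          rw [← inverse_gauge_deriv_identity hb]
          noncomm_ring
        exact SuperPDE.germ_eq_zero.1 h i j
      · have h : (T * α c * S - T * matD c S - freezeMat 𝓘 w₀ (α c)).map (eval (x, w₀.1)) = 0 := by
          simp only [map_eval_sub, map_eval_mul, map_eval_freezeMat, hS₀ x hx, hT₀ x hx,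
            map_eval_matD_eq_zero hS₀ c hx, one_mul, mul_one, sub_zero, sub_self]
        exact congrFun (congrFun h i) j
    -- Multiplying by `S` on the left and by `T` on the right returns to `α = D S · T + S α₀ T`.
    rw [map_sub, sub_eq_zero] at key
    rw [map_add, map_mul _ (S * _), map_mul _ S, ← key]
    have hst := congrArg (E.germ P) hST
    rw [map_mul, map_one] at hst
    simp only [map_sub, map_mul]
    simp only [mul_sub, sub_mul, mul_assoc, hst, mul_one]
    simp only [← mul_assoc, hst, one_mul]
    abel

end GaugeFamily

end SuperZCR
end

theorem proposition1 {n₀ n₁ m₀ m₁ p q r : ℕ}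
    (𝒰 : TopologicalSpace.Opens (SuperZCR.EvenIdx n₀ n₁ m₀ m₁ → ℝ))
    (E : SuperZCR.SuperPDE 𝒰 r) (g : SuperZCR.MatrixLieSuperalgebra p q)
    {𝕜 : Type} [RCLike 𝕜] (𝓘 : TopologicalSpace.Opens 𝕜) [SimplyConnectedSpace 𝓘]
    (α : SuperZCR.OneForm p q 𝒰 𝓘)
    (hα : SuperZCR.IsGForm g α) (hfam : ∀ c, SuperZCR.IsFamily (α c))
    (hzcr : ∀ w : 𝓘, E.IsZCR g (SuperZCR.freezeForm (⊤ : TopologicalSpace.Opens PUnit) w α)) :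
    E.IsRemovable g α ↔
      ∃ Q : SuperZCR.SMat p q 𝒰 𝓘,
        Q ∈ SuperZCR.gMat g 𝒰 𝓘 ∧ SuperZCR.IsFamily Q ∧ SuperZCR.matParity Q = Q ∧
        E.FormEq (fun c => SuperZCR.paramDeriv (α c))
          (SuperZCR.dhMat Q - SuperZCR.bracketFormMat α Q) := by
  refine ⟨fun h => h.exists_generator, ?_⟩
  rintro ⟨Q, hQg, hQf, hQe, hQ⟩
  exact SuperZCR.SuperPDE.isRemovable_of_generator hfam hQg hQf hQe hQ
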